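/- **Setting.** Consider functions of two infinite families of complex times $\mathrm t=(t_1,t_2,\dots)$, $\bar{\mathrm t}=(\bar t_1,\bar t_2,\dots)$ and the Miwa shifts $\mathbb T_\xi f(\mathrm t,\bar{\mathrm t})=f(t_j+i\xi^j/j,\bar t_k)$, $\overline{\mathbb T}_\eta f(\mathrm t,\bar{\mathrm t})=f(t_j,\bar t_k+i\eta^k/k)$. Put $G(\xi)=1+\xi(\mathbb T_\xi U)V$ and $g(\eta)=1+\eta(\overline{\mathbb T}_\eta u)v$. A pair $(U,V)$ solves the *extended derivative nonlinear Schrödinger hierarchy* (extended DNLSH) if there are $u,v$ such that, for all sufficiently small complex $\xi,\xi_1,\xi_2,\eta,\eta_1,\eta_2$ (with $\mathbb T_j=\mathbb T_{\xi_j}$, $G_j=G(\xi_j)$, $\overline{\mathbb T}_j=\overline{\mathbb T}_{\eta_j}$, $g_j=g(\eta_j)$), at all times where the functions involved are defined, - $(\xi_1G_2-\xi_2G_1)\,\mathbb T_1\mathbb T_2U-\xi_1\mathbb T_1U+\xi_2\mathbb T_2U=0$ and $\bigl(\xi_1\mathbb T_1G_2-\xi_2\mathbb T_2G_1\bigr)V-\xi_1\mathbb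 T_2V+\xi_2\mathbb T_1V=0$; - $(\eta_1g_2-\eta_2g_1)\,\overline{\mathbb T}_1\overline{\mathbb T}_2u-\eta_1\overline{\mathbb T}_1u+\eta_2\overline{\mathbb T}_2u=0$ and $\bigl(\eta_1\overline{\mathbb T}_1g_2-\eta_2\overline{\mathbb T}_2g_1\bigr)v-\eta_1\overline{\mathbb T}_2v+\eta_2\overline{\mathbb T}_1v=0$; - $g(\eta)\overline{\mathbb T}_\eta U-U=\eta\,\overline{\mathbb T}_\eta u$, $\ g(\eta)V-\overline{\mathbb T}_\eta V=\eta v$, $\ G(\xi)\mathbb T_\xi u-u=\xi\,\mathbb T_\xi U$, $\ G(\xi)v-\mathbb T_\xi v=\xi V$. **Data.** Let $N\ge 0$, $\mu\in\mathbb R\setminus\{0,\pm1\}$, $U^{(0)}\in\mathbb C\setminus\{0\}$, $c=|U^{(0)}|^{-2}$, and let $\theta_1,\dots,\theta_N\in\mathbb R$ satisfy $\sin\frac{\theta_m+\theta_n}2\ne0$ for all $m,n$ (including $m=n$). Let $\alpha,\beta$ be real functions near $0$, continuous at $0$, with $$\alpha(\xi)+\alpha(\xi)^{-1}=\mu+\mu^{-1}+c\mu\,\xi^{-1}\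 (\xi\ne0),\quad\alpha(0)=0;\qquad \beta(\eta)+\beta(\eta)^{-1}=\mu+\mu^{-1}+c\mu\,\eta,\quad\beta(0)=\mu,$$ and let the real numbers $\nu_{nk},\tilde\nu_{nk},\varphi_k,\tilde\varphi_k$ be given by the expansions, for small real $\xi,\eta$, $$\sum_{k\ge1}\nu_{nk}\tfrac{\xi^k}k=2\arg\bigl[1-\alpha(\xi)e^{-i\theta_n}\bigr],\qquad \sum_{k\ge1}\tilde\nu_{nk}\tfrac{\eta^k}k=2\arg\bigl[1-\beta(\eta)e^{-i\theta_n}\bigr]-2\arg\bigl[1-\mu e^{-i\theta_n}\bigr],$$ $$\sum_{k\ge1}\varphi_k\tfrac{\xi^k}k=-\ln\bigl[1-\mu^{-1}\alpha(\xi)\bigr],\qquad \sum_{k\ge1}\tilde\varphi_k\tfrac{\eta^k}k=\ln\bigl|1-\mu^{-1}\beta(\eta)^{-1}\bigr|-\ln\bigl|1-\mu^{-2}\bigr|.$$ Set $\nu_n=\sum_{k\ge1}(\nu_{nk}t_k+\tilde\nu_{nk}\bar t_k)$ and $\varphi=\sum_{k\ge1}(\varphi_kt_k+\tilde\varphi_k\bar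 t_k)$ at the times where all these series converge absolutely, $\gamma^{(2)}_n=\arg(1-\mu e^{i\theta_n})$, $\gamma^{(1)}_n=2\theta_n-\gamma^{(2)}_n$, and for arbitrary real constants $C^{(0)}_1,\dots,C^{(0)}_N$ $$\Delta_\ell=\det\Bigl(\delta_{mn}+C^{(0)}_n\frac{\exp[\nu_n+i\gamma^{(\ell)}_n]}{\sin\frac{\theta_m+\theta_n}2}\Bigr)_{m,n=1}^N\quad(\ell=1,2),\qquad U=U^{(0)}e^{i\varphi}\,\frac{\Delta_1}{\Delta_2}.$$ **Proposition.** Such $\alpha,\beta,\nu_{nk},\tilde\nu_{nk},\varphi_k,\tilde\varphi_k$ exist, and for every such choice: 1. Let $V=U^*$, i.e. $V$ is the complex conjugate of $U$ at real times, continued to complex times by $V(\mathrm t,\bar{\mathrm t})=\overline{U(\mathrm t^*,\bar{\mathrm t}^*)}$. Let $D$ be the set of times at which the series converge and the denominators of $U$ and $V$ do not vanish. Every point of $D$ stays in $D$ under any two sufficiently small Miwa shifts, and $(U,V)$ solves the extended DNLSH on $D$: for some $u,v$, with $v=u^*$ at real times, and some $r>0$, the above equations hold for all shift parameters of modulus less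 than $r$ at every point of $D$ whose shifts occurring in the equation lie in $D$. 2. If moreover $\sin\frac{\theta_m-\theta_n}2\neq0$ for $m\ne n$, then $U$ satisfies non-vanishing boundary conditions: there are constants $w_\pm$ with $|w_\pm|=1$ such that at all real times (where the series converge) $U/(U^{(0)}e^{i\varphi})\to w_\pm$ as $t_1\to\pm\infty$ with the other times fixed; in particular $|U|\to|U^{(0)}|$. -/

import Mathlib

namespace DNLS

/-- The two infinite families of (complex) times of the extended hierarchy:
`pos j` is `t_{j+1}` and `neg k` is `t̄_{k+1}`. -/
structure Times where
  pos : ℕ → ℂ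
  neg : ℕ → ℂ

/-- Complex conjugation of all times; the fixed points are the real times. -/
def Times.conj (p : Times) : Times where
  pos j := starRingEnd ℂ (p.pos j)
  neg k := starRingEnd ℂ (p.neg k)

def Times.IsReal (p : Times) : Prop := p.conj = p

/-- Translation `t₁ ↦ t₁ + x` in the first positive time. -/
noncomputable def Times.addFirst (x : ℝ) (p : Times) : Times where
  pos j := p.pos j + if j = 0 then (x : ℂ) else 0
  neg := p.neg

/-- The positive Miwa shift `t_j ↦ t_j + i ξ^j / j`. -/
noncomputable def shiftPos (ξ : ℂ) (p : Times) : Times where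
  pos j := p.pos j + Complex.I * ξ ^ (j + 1) / ((j : ℂ) + 1)
  neg := p.neg

/-- The negative Miwa shift `t̄_k ↦ t̄_k + i η^k / k`. -/
noncomputable def shiftNeg (η : ℂ) (p : Times) : Times where
  pos := p.pos
  neg k := p.neg k + Complex.I * η ^ (k + 1) / ((k : ℂ) + 1)

/-- `G(ξ) = 1 + ξ (T_ξ U) V`. -/
noncomputable def bigG (U V : Times → ℂ) (ξ : ℂ) (p : Times) : ℂ :=
  1 + ξ * U (shiftPos ξ p) * V p

/-- `g(η) = 1 + η (T̄_η u) v`. -/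
noncomputable def smallG (u v : Times → ℂ) (η : ℂ) (p : Times) : ℂ :=
  1 + η * u (shiftNeg η p) * v p

/-- The functional equations of the extended DNLS hierarchy (positive, negative and mixed
subhierarchies) for functions `U, V, u, v` defined on a set `D` of times: they hold for all shift
parameters of modulus less than `r`, at every point of `D` whose shifts that occur are in `D`. -/
structure IsExtendedDNLSH (D : Set Times) (r : ℝ) (U V u v : Times → ℂ) : Prop where
  pos_U : ∀ ξ₁ ξ₂ : ℂ, ‖ξ₁‖ < r → ‖ξ₂‖ < r → ∀ p ∈ D, shiftPos ξ₁ p ∈ D → shiftPos ξ₂ p ∈ D →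
    shiftPos ξ₁ (shiftPos ξ₂ p) ∈ D →
    (ξ₁ * bigG U V ξ₂ p - ξ₂ * bigG U V ξ₁ p) * U (shiftPos ξ₁ (shiftPos ξ₂ p))
      - ξ₁ * U (shiftPos ξ₁ p) + ξ₂ * U (shiftPos ξ₂ p) = 0
  pos_V : ∀ ξ₁ ξ₂ : ℂ, ‖ξ₁‖ < r → ‖ξ₂‖ < r → ∀ p ∈ D, shiftPos ξ₁ p ∈ D → shiftPos ξ₂ p ∈ D →
    shiftPos ξ₁ (shiftPos ξ₂ p) ∈ D →
    (ξ₁ * bigG U V ξ₂ (shiftPos ξ₁ p) - ξ₂ * bigG U V ξ₁ (shiftPos ξ₂ p)) * V p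
      - ξ₁ * V (shiftPos ξ₂ p) + ξ₂ * V (shiftPos ξ₁ p) = 0
  neg_u : ∀ η₁ η₂ : ℂ, ‖η₁‖ < r → ‖η₂‖ < r → ∀ p ∈ D, shiftNeg η₁ p ∈ D → shiftNeg η₂ p ∈ D →
    shiftNeg η₁ (shiftNeg η₂ p) ∈ D →
    (η₁ * smallG u v η₂ p - η₂ * smallG u v η₁ p) * u (shiftNeg η₁ (shiftNeg η₂ p))
      - η₁ * u (shiftNeg η₁ p) + η₂ * u (shiftNeg η₂ p) = 0
  neg_v : ∀ η₁ η₂ : ℂ, ‖η₁‖ < r → ‖η₂‖ < r → ∀ p ∈ D, shiftNeg η₁ p ∈ D → shiftNeg η₂ p ∈ D →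
    shiftNeg η₁ (shiftNeg η₂ p) ∈ D →
    (η₁ * smallG u v η₂ (shiftNeg η₁ p) - η₂ * smallG u v η₁ (shiftNeg η₂ p)) * v p
      - η₁ * v (shiftNeg η₂ p) + η₂ * v (shiftNeg η₁ p) = 0
  mixed_U : ∀ η : ℂ, ‖η‖ < r → ∀ p ∈ D, shiftNeg η p ∈ D →
    smallG u v η p * U (shiftNeg η p) - U p = η * u (shiftNeg η p)
  mixed_V : ∀ η : ℂ, ‖η‖ < r → ∀ p ∈ D, shiftNeg η p ∈ D →
    smallG u v η p * V p - V (shiftNeg η p) = η * v p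
  mixed_u : ∀ ξ : ℂ, ‖ξ‖ < r → ∀ p ∈ D, shiftPos ξ p ∈ D →
    bigG U V ξ p * u (shiftPos ξ p) - u p = ξ * U (shiftPos ξ p)
  mixed_v : ∀ ξ : ℂ, ‖ξ‖ < r → ∀ p ∈ D, shiftPos ξ p ∈ D →
    bigG U V ξ p * v p - v (shiftPos ξ p) = ξ * V p

/-- The functions `α, β` and the coefficients `ν_{n,k+1}`, `ν̃_{n,k+1}`, `φ_{k+1}`, `φ̃_{k+1}`
(at index `k`) of the linear phases. They are pinned down by `IsDispersion`. -/
structure Dispersion (N : ℕ) where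
  alpha : ℝ → ℝ
  beta : ℝ → ℝ
  nu : Fin N → ℕ → ℝ
  nuBar : Fin N → ℕ → ℝ
  phi : ℕ → ℝ
  phiBar : ℕ → ℝ

/-- The equations that determine (near `0`) `α` and `β`, and the generating series that determine
the coefficients of the phases. Here `c` is the amplitude constant. -/
structure IsDispersion {N : ℕ} (μ c : ℝ) (θ : Fin N → ℝ) (d : Dispersion N) : Prop where
  alpha_continuousAt : ContinuousAt d.alpha 0
  alpha_zero : d.alpha 0 = 0
  alpha_eq : ∀ᶠ ξ in nhdsWithin (0 : ℝ) {0}ᶜ,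
    d.alpha ξ ≠ 0 ∧ d.alpha ξ + (d.alpha ξ)⁻¹ = μ + μ⁻¹ + c * μ * ξ⁻¹
  beta_continuousAt : ContinuousAt d.beta 0
  beta_zero : d.beta 0 = μ
  beta_eq : ∀ᶠ η in nhds (0 : ℝ),
    d.beta η ≠ 0 ∧ d.beta η + (d.beta η)⁻¹ = μ + μ⁻¹ + c * μ * η
  nu_series : ∀ n, ∀ᶠ ξ in nhds (0 : ℝ),
    HasSum (fun k : ℕ => d.nu n k * ξ ^ (k + 1) / ((k : ℝ) + 1))
      (2 * Complex.arg (1 - d.alpha ξ * Complex.exp (-Complex.I * θ n)))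
  nuBar_series : ∀ n, ∀ᶠ η in nhds (0 : ℝ),
    HasSum (fun k : ℕ => d.nuBar n k * η ^ (k + 1) / ((k : ℝ) + 1))
      (2 * Complex.arg (1 - d.beta η * Complex.exp (-Complex.I * θ n))
        - 2 * Complex.arg (1 - μ * Complex.exp (-Complex.I * θ n)))
  phi_series : ∀ᶠ ξ in nhds (0 : ℝ),
    HasSum (fun k : ℕ => d.phi k * ξ ^ (k + 1) / ((k : ℝ) + 1))
      (-Real.log (1 - μ⁻¹ * d.alpha ξ))
  phiBar_series : ∀ᶠ η in nhds (0 : ℝ),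
    HasSum (fun k : ℕ => d.phiBar k * η ^ (k + 1) / ((k : ℝ) + 1))
      (Real.log (1 - μ⁻¹ * (d.beta η)⁻¹) - Real.log (1 - (μ ^ 2)⁻¹))

/-- The times at which the series for all phases converge. -/
def convergenceDomain {N : ℕ} (d : Dispersion N) : Set Times :=
  {p | (Summable fun k : ℕ => (d.phi k : ℂ) * p.pos k + (d.phiBar k : ℂ) * p.neg k) ∧
    ∀ n, Summable fun k : ℕ => (d.nu n k : ℂ) * p.pos k + (d.nuBar n k : ℂ) * p.neg k}

/-- `φ(t, t̄)`. -/
noncomputable def phase {N : ℕ} (d : Dispersion N) (p : Times) : ℂ :=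
  ∑' k : ℕ, ((d.phi k : ℂ) * p.pos k + (d.phiBar k : ℂ) * p.neg k)

/-- `ν_n(t, t̄)`. -/
noncomputable def solitonPhase {N : ℕ} (d : Dispersion N) (n : Fin N) (p : Times) : ℂ :=
  ∑' k : ℕ, ((d.nu n k : ℂ) * p.pos k + (d.nuBar n k : ℂ) * p.neg k)

/-- `γ_n⁽²⁾ = arg (1 - μ e^{iθ_n})`. -/
noncomputable def gammaTwo {N : ℕ} (μ : ℝ) (θ : Fin N → ℝ) (n : Fin N) : ℝ :=
  Complex.arg (1 - μ * Complex.exp (Complex.I * θ n))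

/-- `γ_n⁽¹⁾ = 2 θ_n - γ_n⁽²⁾`. -/
noncomputable def gammaOne {N : ℕ} (μ : ℝ) (θ : Fin N → ℝ) (n : Fin N) : ℝ :=
  2 * θ n - gammaTwo μ θ n

/-- The determinant `Δ` with constant phases `γ_n`. -/
noncomputable def solitonDet {N : ℕ} (θ C γ : Fin N → ℝ) (d : Dispersion N) (p : Times) : ℂ :=
  Matrix.det (Matrix.of fun m n : Fin N =>
    (if m = n then (1 : ℂ) else 0) +
      (C n : ℂ) * Complex.exp (solitonPhase d n p + Complex.I * γ n) /
        (Real.sin ((θ m + θ n) / 2) : ℂ))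

/-- `Δ₁`. -/
noncomputable def deltaOne {N : ℕ} (μ : ℝ) (θ C : Fin N → ℝ) (d : Dispersion N) (p : Times) : ℂ :=
  solitonDet θ C (gammaOne μ θ) d p

/-- `Δ₂`. -/
noncomputable def deltaTwo {N : ℕ} (μ : ℝ) (θ C : Fin N → ℝ) (d : Dispersion N) (p : Times) : ℂ :=
  solitonDet θ C (gammaTwo μ θ) d p

/-- The `N`-soliton function `U = U₀ e^{iφ} Δ₁ / Δ₂`. -/
noncomputable def solitonU {N : ℕ} (μ : ℝ) (U₀ : ℂ) (θ C : Fin N → ℝ) (d : Dispersion N)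
    (p : Times) : ℂ :=
  U₀ * Complex.exp (Complex.I * phase d p) * (deltaOne μ θ C d p / deltaTwo μ θ C d p)

/-- The continuation to complex times of the complex conjugate `f*` of a function of real times. -/
noncomputable def reflect (f : Times → ℂ) (p : Times) : ℂ := starRingEnd ℂ (f p.conj)

/-- The times at which the series converge and neither `U` nor `U*` has a vanishing denominator
(at real times: `Δ₂ ≠ 0`). -/
def regularDomain {N : ℕ} (μ : ℝ) (θ C : Fin N → ℝ) (d : Dispersion N) : Set Times :=
  {p | p ∈ convergenceDomain d ∧ deltaTwo μ θ C d p ≠ 0 ∧ deltaTwo μ θ C d p.conj ≠ 0}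

/-- Every point of `D` stays in `D` under any two sufficiently small Miwa shifts. -/
def IsShiftStable (D : Set Times) : Prop :=
  ∀ p ∈ D, ∀ᶠ q : ℂ × ℂ in nhds (0, 0),
    shiftPos q.1 (shiftPos q.2 p) ∈ D ∧ shiftNeg q.1 (shiftNeg q.2 p) ∈ D ∧
      shiftPos q.1 (shiftNeg q.2 p) ∈ D

/-- Non-vanishing boundary conditions: along the real `t₁`-axis, `U` is asymptotic to the plane wave
`U₀ e^{iφ}` up to a constant phase factor at each end (so `|U| → |U₀|`). -/
def HasNonvanishingBoundary {N : ℕ} (U₀ : ℂ) (d : Dispersion N) (U : Times → ℂ) : Prop :=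
  ∃ wPlus wMinus : ℂ, ‖wPlus‖ = 1 ∧ ‖wMinus‖ = 1 ∧
    ∀ p ∈ convergenceDomain d, p.IsReal →
      Filter.Tendsto (fun x : ℝ => U (p.addFirst x) /
        (U₀ * Complex.exp (Complex.I * phase d (p.addFirst x)))) Filter.atTop (nhds wPlus) ∧
      Filter.Tendsto (fun x : ℝ => U (p.addFirst x) /
        (U₀ * Complex.exp (Complex.I * phase d (p.addFirst x)))) Filter.atBot (nhds wMinus)

end DNLS

/-! Up to diagonal scalings the matrix `1 / sin ((θ m + θ n) / 2)` is the Cauchy matrix `1 / (p n -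
q m)` with `p n = e^{iθ_n}` and `q n = e^{-iθ_n}`, so it has displacement rank one. Let τ(X) be the
soliton determinant with exponentials `X`. A point `a = (a₁ : a₂)` of the projective line acts on τ
by multiplying `X n` by the weight w(a) = `(a₂ - a₁ q n) / (a₂ - a₁ p n)`. For four points these
actions satisfy the three-term Fay identity (`fay_identity`).

Everything in the statement is such an action. A positive Miwa shift multiplies `X` by A = w(α(ξ)),
a negative one by w(β(η)) / M with M = w(μ). Let J = w(1/μ), the weight of the point `(1, μ)`. If X
are the exponentials of Δ₂, the constant phases are exactly such that Δ₁ = τ(X / J). Conjugation,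
continued to complex times, turns X into X M and X / J into X M J. Since w(0) = 1 and w(∞) = M J,
every equation of the hierarchy only involves the points α₁, α₂ (or β₁, β₂), μ, 1/μ, 0, ∞.

First the Fay identity turns the sums `G` and `g` into single quotients of τ's (`bigG_eq`,
`smallG_eq`). Each equation of the hierarchy then reduces to one or two further Fay identities and
rational algebra in μ and α or β (`isExtendedDNLSH_soliton`). The companions are `companionU`,
proportional to e^{iφ} τ(X M / J) / τ(X M), and its reflection `companionV`.

The phases are only given by real power series, so the action of complex Miwa shifts is obtained by
analytic continuation from the real axis (`IsDispersion.exists_alpha`, `IsDispersion.exists_beta`).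

For the boundary values, each exponential with nonzero constant grows or decays along `t₁`, because
its rate is proportional to `sin θ_n`. The leading coefficient of τ is nonzero by the Cauchy kernel
lemma and cancels in Δ₁ / Δ₂. What remains is a product of factors 1 / J_n, each of modulus one. -/

open Filter Topology

namespace DNLS

/-! ### Fay identity for determinants of displacement rank one. -/

section Fay

variable {K : Type*} [Field K] {ι : Type*} [Fintype ι] [DecidableEq ι]

/-- The value at `t` of the linear form with root `a`, for a point `a = (x : y)` of the projective
line with affine coordinate `x / y`. -/
def lin (a : K × K) (t : K) : K := a.2 - a.1 * t

/-- The determinant of two points of the projective line. -/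
def bracket (a b : K × K) : K := a.1 * b.2 - b.1 * a.2

/-- The weights by which the shift attached to a point of the projective line multiplies the
exponentials of a soliton tau function. -/
def shiftWeight (p q : ι → K) (a : K × K) (n : ι) : K := lin a (q n) / lin a (p n)

/-- Two simultaneous shifts amount, after a diagonal conjugation, to a rank-two perturbation of `z +
A`. The matrix determinant lemma then leaves a 2×2 determinant, and after multiplication by the
bracket it takes the form `f a * g b - f b * g a`, where each factor depends on one point only. The
Fay identity is the Plücker relation for such expressions. -/
theorem det_scalar_add_mul_shiftWeight {A : Matrix ι ι K} {p q x y : ι → K}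
    (hA : ∀ m n, A m n * (p n - q m) = x m * y n) (z : K)
    (hM : (Matrix.scalar ι z + A).det ≠ 0) (a b : K × K)
    (hap : ∀ n, lin a (p n) ≠ 0) (haq : ∀ n, lin a (q n) ≠ 0)
    (hbp : ∀ n, lin b (p n) ≠ 0) (hbq : ∀ n, lin b (q n) ≠ 0) :
    bracket a b * (Matrix.scalar ι z +
        A * Matrix.diagonal (shiftWeight p q a * shiftWeight p q b)).det =
      (Matrix.scalar ι z + A).det *
        (a.1 * (1 + a.1 * ((fun n => y n / lin a (p n)) ⬝ᵥ
            (Matrix.scalar ι z + A)⁻¹.mulVec x)) *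
          (b.2 + b.1 ^ 2 * ((fun n => y n / lin b (p n)) ⬝ᵥ
            (Matrix.scalar ι z + A)⁻¹.mulVec (q * x))) -
        b.1 * (1 + b.1 * ((fun n => y n / lin b (p n)) ⬝ᵥ
            (Matrix.scalar ι z + A)⁻¹.mulVec x)) *
          (a.2 + a.1 ^ 2 * ((fun n => y n / lin a (p n)) ⬝ᵥ
            (Matrix.scalar ι z + A)⁻¹.mulVec (q * x)))) := by
  set M := Matrix.scalar ι z + A with hMdef
  set ra := (fun n => y n / lin a (p n)) ⬝ᵥ M⁻¹.mulVec x with hra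
  set rb := (fun n => y n / lin b (p n)) ⬝ᵥ M⁻¹.mulVec x with hrb
  set sa := (fun n => y n / lin a (p n)) ⬝ᵥ M⁻¹.mulVec (q * x) with hsa
  set sb := (fun n => y n / lin b (p n)) ⬝ᵥ M⁻¹.mulVec (q * x) with hsb
  -- The two rank-one terms come from moving first the `a` factor and then the `b` factor past `A`,
  -- each at the cost of one displacement `x yᵀ`.
  let X : Matrix ι (Fin 2) K := Matrix.of fun m j => ![x m, lin b (q m) * x m] j
  let W : Matrix (Fin 2) ι K := Matrix.of fun i n =>
    ![b.1 * (y n / lin b (p n)), a.1 * (y n / (lin a (p n) * lin b (p n)))] i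
  have hconj : (Matrix.scalar ι z +
      A * Matrix.diagonal (shiftWeight p q a * shiftWeight p q b)).det = (M + X * W).det := by
    -- The intertwining relation is `D (z + A S) = (z + A + X W) D`, with `S` the diagonal of shift
    -- weights; `det D` cancels.
    have hD : IsUnit (Matrix.diagonal (fun n => lin a (q n) * lin b (q n)) : Matrix ι ι K).det := by
      rw [Matrix.det_diagonal]
      exact isUnit_iff_ne_zero.2
        (Finset.prod_ne_zero_iff.2 fun n _ => mul_ne_zero (haq n) (hbq n))
    refine mul_right_cancel₀ hD.ne_zero ?_
    rw [mul_comm, ← Matrix.det_mul, ← Matrix.det_mul]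
    congr 1
    ext m n
    have hXW : (X * W) m n = x m * (b.1 * (y n / lin b (p n))) +
        lin b (q m) * x m * (a.1 * (y n / (lin a (p n) * lin b (p n)))) := by
      rw [Matrix.mul_apply, Fin.sum_univ_two]
      rfl
    simp only [Matrix.diagonal_mul, Matrix.mul_diagonal, Matrix.add_apply, hXW, hMdef,
      Pi.mul_apply, shiftWeight, Matrix.scalar_apply]
    have hz : lin a (q m) * lin b (q m) * Matrix.diagonal (fun _ : ι => z) m n =
        Matrix.diagonal (fun _ : ι => z) m n * (lin a (q n) * lin b (q n)) := by
      by_cases h : m = n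
      · subst h; ring
      · simp [h]
    have h1 : lin a (q m) * lin b (q m) * A m n / (lin a (p n) * lin b (p n)) =
        A m n + (x m * (b.1 * (y n / lin b (p n))) +
          lin b (q m) * x m * (a.1 * (y n / (lin a (p n) * lin b (p n))))) := by
      have h := hA m n
      have h2 := hap n
      have h3 := hbp n
      field_simp
      simp only [lin] at *
      linear_combination (b.1 * (a.2 - a.1 * p n) + a.1 * (b.2 - b.1 * q m)) * h
    have h2 : lin a (q m) * lin b (q m) * (A m n *
        (lin a (q n) / lin a (p n) * (lin b (q n) / lin b (p n)))) =
        (lin a (q m) * lin b (q m) * A m n / (lin a (p n) * lin b (p n))) *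
          (lin a (q n) * lin b (q n)) := by
      have h2 := hap n
      have h3 := hbp n
      field_simp
    rw [mul_add, hz, h2, h1]
    ring
  rw [hconj, Matrix.det_add_mul _ _ (isUnit_iff_ne_zero.2 hM), Matrix.det_fin_two]
  have hent : ∀ i j, (W * M⁻¹ * X) i j =
      (fun n => W i n) ⬝ᵥ M⁻¹.mulVec (fun m => X m j) := by
    intro i j
    rw [Matrix.mul_assoc]
    rfl
  have hX0 : (fun m => X m 0) = x := rfl
  have hX1 : (fun m => X m 1) = b.2 • x - b.1 • (q * x) := by
    funext m
    simp [X, lin]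
    ring
  have hW0 : (fun n => W 0 n) = b.1 • (fun n => y n / lin b (p n)) := rfl
  -- Partial fractions in `p n`: this is what separates the dependence on `a` from that on `b`.
  have hW1 : bracket a b • (fun n => W 1 n) = (a.1 * a.1) • (fun n => y n / lin a (p n)) -
      (a.1 * b.1) • (fun n => y n / lin b (p n)) := by
    funext n
    have h2 := hap n
    have h3 := hbp n
    simp only [W, Matrix.of_apply, Matrix.cons_val_one, Pi.smul_apply, smul_eq_mul, Pi.sub_apply]
    simp only [Matrix.cons_val_fin_one]
    field_simp
    simp only [bracket, lin]
    ring
  have e00 : (W * M⁻¹ * X) 0 0 = b.1 * rb := by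
    rw [hent, hX0, hW0, smul_dotProduct, smul_eq_mul]
  have e01 : (W * M⁻¹ * X) 0 1 = b.1 * (b.2 * rb - b.1 * sb) := by
    rw [hent, hX1, hW0, smul_dotProduct, Matrix.mulVec_sub, Matrix.mulVec_smul,
      Matrix.mulVec_smul, dotProduct_sub, dotProduct_smul, dotProduct_smul]
    rfl
  have e10 : bracket a b * (W * M⁻¹ * X) 1 0 = a.1 * (a.1 * ra - b.1 * rb) := by
    rw [hent, hX0, ← smul_eq_mul, ← smul_dotProduct, hW1, sub_dotProduct, smul_dotProduct,
      smul_dotProduct, smul_eq_mul, smul_eq_mul]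
    ring
  have e11 : bracket a b * (W * M⁻¹ * X) 1 1 =
      a.1 * (a.1 * (b.2 * ra - b.1 * sa) - b.1 * (b.2 * rb - b.1 * sb)) := by
    rw [hent, hX1, ← smul_eq_mul, ← smul_dotProduct, hW1, Matrix.mulVec_sub, Matrix.mulVec_smul,
      Matrix.mulVec_smul, dotProduct_sub, dotProduct_smul, dotProduct_smul, sub_dotProduct,
      sub_dotProduct, smul_dotProduct, smul_dotProduct, smul_dotProduct, smul_dotProduct]
    simp only [smul_eq_mul, ← hra, ← hrb, ← hsa, ← hsb]
    ring
  simp only [Matrix.add_apply, Matrix.one_apply_eq, ne_eq, zero_ne_one, not_false_eq_true,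
    Matrix.one_apply_ne, one_ne_zero, zero_add]
  rw [e00, e01]
  have hb : bracket a b = a.1 * b.2 - b.1 * a.2 := rfl
  linear_combination M.det * ((1 + b.1 * rb) * e11 - b.1 * (b.2 * rb - b.1 * sb) * e10 +
    (1 + b.1 * rb) * hb)

/-- The Fay identity for the determinants `det (1 + A D)` of a matrix `A` with displacement rank
one:
`A P - Q A` is a rank one matrix, with `P`, `Q` diagonal. -/
theorem fay_identity [Infinite K] {A : Matrix ι ι K} {p q x y : ι → K}
    (hA : ∀ m n, A m n * (p n - q m) = x m * y n) (a b c d : K × K)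
    (hap : ∀ n, lin a (p n) ≠ 0) (haq : ∀ n, lin a (q n) ≠ 0)
    (hbp : ∀ n, lin b (p n) ≠ 0) (hbq : ∀ n, lin b (q n) ≠ 0)
    (hcp : ∀ n, lin c (p n) ≠ 0) (hcq : ∀ n, lin c (q n) ≠ 0)
    (hdp : ∀ n, lin d (p n) ≠ 0) (hdq : ∀ n, lin d (q n) ≠ 0)
    (t : (ι → K) → K) (ht : ∀ s, t s = (1 + A * Matrix.diagonal s).det) :
    bracket a b * bracket c d * (t (shiftWeight p q a * shiftWeight p q b) *
        t (shiftWeight p q c * shiftWeight p q d)) -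
      bracket a c * bracket b d * (t (shiftWeight p q a * shiftWeight p q c) *
        t (shiftWeight p q b * shiftWeight p q d)) +
      bracket a d * bracket b c * (t (shiftWeight p q a * shiftWeight p q d) *
        t (shiftWeight p q b * shiftWeight p q c)) = 0 := by
  -- `1 + A` may be singular, so the identity is proved for `z + A` with `z` an indeterminate,
  -- multiplied by the monic polynomial `det (z + A)`. That factor cancels in the polynomial ring,
  -- and then `z = 1`.
  let P : (ι → K) → Polynomial K := fun s => (-(A * Matrix.diagonal s)).charpoly
  have hP : ∀ s z, (P s).eval z = (Matrix.scalar ι z + A * Matrix.diagonal s).det := by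
    intro s z
    rw [Matrix.eval_charpoly, sub_neg_eq_add]
  have hPA : ∀ z, (-A).charpoly.eval z = (Matrix.scalar ι z + A).det := by
    intro z
    rw [Matrix.eval_charpoly, sub_neg_eq_add]
  let S := shiftWeight p q
  have key : (Polynomial.C (bracket a b * bracket c d) * (P (S a * S b) * P (S c * S d)) -
      Polynomial.C (bracket a c * bracket b d) * (P (S a * S c) * P (S b * S d)) +
      Polynomial.C (bracket a d * bracket b c) * (P (S a * S d) * P (S b * S c))) *
        (-A).charpoly = 0 := by
    refine Polynomial.funext fun z => ?_
    simp only [Polynomial.eval_mul, Polynomial.eval_add, Polynomial.eval_sub, Polynomial.eval_C,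
      hP, hPA, Polynomial.eval_zero]
    by_cases hM : (Matrix.scalar ι z + A).det = 0
    · rw [hM, mul_zero]
    · have hab := det_scalar_add_mul_shiftWeight hA z hM a b hap haq hbp hbq
      have hac := det_scalar_add_mul_shiftWeight hA z hM a c hap haq hcp hcq
      have had := det_scalar_add_mul_shiftWeight hA z hM a d hap haq hdp hdq
      have hbc := det_scalar_add_mul_shiftWeight hA z hM b c hbp hbq hcp hcq
      have hbd := det_scalar_add_mul_shiftWeight hA z hM b d hbp hbq hdp hdq
      have hcd := det_scalar_add_mul_shiftWeight hA z hM c d hcp hcq hdp hdq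
      have e : ∀ f g h k : K, f * g * (h * k) = (f * h) * (g * k) := fun f g h k => by ring
      rw [e, e (bracket a c), e (bracket a d), hab, hac, had, hbc, hbd, hcd]
      ring
  have key' := (mul_eq_zero.1 key).resolve_right (Matrix.charpoly_monic _).ne_zero
  have h := congrArg (Polynomial.eval 1) key'
  have ht' : ∀ s, (P s).eval 1 = t s := fun s => by rw [hP, ht, map_one]
  simpa only [Polynomial.eval_mul, Polynomial.eval_add, Polynomial.eval_sub, Polynomial.eval_C,
    ht', Polynomial.eval_zero] using h

end Fay

/-! ### The analytic branches α(ξ) and β(η), and their uniqueness. -/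

section Branches

theorem exp_half_log_sq {z : ℂ} (hz : z ≠ 0) : Complex.exp (Complex.log z / 2) ^ 2 = z := by
  rw [← Complex.exp_nat_mul, Nat.cast_ofNat, mul_div_cancel₀ _ two_ne_zero, Complex.exp_log hz]

/-- The analytic solution `α` of `α + α⁻¹ = μ + μ⁻¹ + c μ / ξ` that vanishes at `0`. -/
theorem exists_analytic_alpha {μ c : ℂ} (hμ : μ ≠ 0) (hc : c ≠ 0) :
    ∃ a : ℂ → ℂ, AnalyticAt ℂ a 0 ∧ a 0 = 0 ∧
      ∀ᶠ ξ in 𝓝 0, ξ * (a ξ - μ) * (a ξ * μ - 1) = c * μ ^ 2 * a ξ := by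
  let B : ℂ → ℂ := fun ξ => ξ * (μ + μ⁻¹) + c * μ
  -- The equation reads `α + α⁻¹ = 1 / w` with `w 0 = 0`. Its small root is `2 w / (1 + √(1 - 4
  -- w²))`, a form without division by `w`.
  let w : ℂ → ℂ := fun ξ => ξ / B ξ
  let s : ℂ → ℂ := fun ξ => Complex.exp (Complex.log (1 - 4 * w ξ ^ 2) / 2)
  have hB0 : B 0 = c * μ := by simp [B]
  have hB0' : B 0 ≠ 0 := by rw [hB0]; exact mul_ne_zero hc hμ
  have hw0 : w 0 = 0 := by simp [w]
  have hs0 : s 0 = 1 := by simp [s, hw0]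
  have hB : AnalyticAt ℂ B 0 := by fun_prop
  have hw : AnalyticAt ℂ w 0 := analyticAt_id.div hB hB0'
  have hd : AnalyticAt ℂ (fun ξ => 1 - 4 * w ξ ^ 2) 0 := by fun_prop
  have hs : AnalyticAt ℂ s 0 :=
    ((hd.clog (by simp [hw0])).div analyticAt_const two_ne_zero).cexp
  have hs1 : (1 : ℂ) + s 0 ≠ 0 := by rw [hs0]; norm_num
  refine ⟨fun ξ => 2 * w ξ / (1 + s ξ),
    (analyticAt_const.mul hw).div (analyticAt_const.add hs) hs1, by simp [hw0], ?_⟩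
  have hd1 : (1 : ℂ) - 4 * w 0 ^ 2 ≠ 0 := by simp [hw0]
  filter_upwards [hB.continuousAt.eventually_ne hB0', hd.continuousAt.eventually_ne hd1,
    (continuousAt_const.add hs.continuousAt).eventually_ne hs1] with ξ h1 h2 h3
  replace h3 : 1 + s ξ ≠ 0 := h3
  have hsq : s ξ ^ 2 = 1 - 4 * w ξ ^ 2 := exp_half_log_sq h2
  have hwB : w ξ * B ξ = ξ := div_mul_cancel₀ _ h1
  have hBdef : B ξ * μ = ξ * (μ ^ 2 + 1) + c * μ ^ 2 := by
    simp only [B]; field_simp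
  generalize s ξ = s at *
  generalize w ξ = w at *
  generalize B ξ = B at *
  subst hwB
  field_simp
  linear_combination (w * B * μ) * hsq + 2 * w * (1 + s) * hBdef

/-- The difference of two solutions is annihilated by a factor that equals `-c μ²` at `0`. No value
at `0` is prescribed, since the cleared equation forces it to vanish. -/
theorem alpha_unique {μ c : ℂ} (hμ : μ ≠ 0) (hc : c ≠ 0) {f g : ℝ → ℂ}
    (hf : ContinuousAt f 0) (hg : ContinuousAt g 0)
    (hf' : ∀ᶠ ξ : ℝ in 𝓝 0, (ξ : ℂ) * (f ξ - μ) * (f ξ * μ - 1) = c * μ ^ 2 * f ξ)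
    (hg' : ∀ᶠ ξ : ℝ in 𝓝 0, (ξ : ℂ) * (g ξ - μ) * (g ξ * μ - 1) = c * μ ^ 2 * g ξ) :
    f =ᶠ[𝓝 0] g := by
  have h : ContinuousAt (fun ξ : ℝ => (ξ : ℂ) * μ * (f ξ + g ξ) - ξ * (μ ^ 2 + 1) - c * μ ^ 2) 0 := by
    have := Complex.continuous_ofReal.continuousAt (x := (0 : ℝ))
    fun_prop
  have h0 : ((0 : ℝ) : ℂ) * μ * (f 0 + g 0) - (0 : ℝ) * (μ ^ 2 + 1) - c * μ ^ 2 ≠ 0 := by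
    simp [hμ, hc]
  filter_upwards [hf', hg', h.eventually_ne h0] with ξ h1 h2 h3
  have : (f ξ - g ξ) * ((ξ : ℂ) * μ * (f ξ + g ξ) - ξ * (μ ^ 2 + 1) - c * μ ^ 2) = 0 := by
    linear_combination h1 - h2
  exact sub_eq_zero.1 ((mul_eq_zero.1 this).resolve_right h3)

/-- The analytic solution `β` of `β + β⁻¹ = μ + μ⁻¹ + c μ η` that takes the value `μ` at `0`. -/
theorem exists_analytic_beta {μ c : ℂ} (hμ : μ ≠ 0) (hμ₁ : μ ^ 2 ≠ 1) :
    ∃ b : ℂ → ℂ, AnalyticAt ℂ b 0 ∧ b 0 = μ ∧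
      ∀ᶠ η in 𝓝 0, (b η - μ) * (b η * μ - 1) = c * μ ^ 2 * b η * η := by
  have hδ : μ - μ⁻¹ ≠ 0 := by
    intro h
    apply hμ₁
    field_simp at h
    linear_combination h
  let k : ℂ → ℂ := fun η => μ + μ⁻¹ + c * μ * η
  -- The discriminant is normalized to `1` at `0`, so the principal logarithm gives an analytic root
  -- there and selects the branch with value `μ`, not `μ⁻¹`.
  let D : ℂ → ℂ := fun η => (k η ^ 2 - 4) / (μ - μ⁻¹) ^ 2
  let s : ℂ → ℂ := fun η => Complex.exp (Complex.log (D η) / 2)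
  have hk : AnalyticAt ℂ k 0 := by fun_prop
  have hD : AnalyticAt ℂ D 0 :=
    ((hk.pow 2).sub analyticAt_const).div analyticAt_const (pow_ne_zero 2 hδ)
  have hD0 : D 0 = 1 := by
    simp only [D, k, mul_zero, add_zero]
    rw [div_eq_one_iff_eq (pow_ne_zero 2 hδ)]
    field_simp
    ring
  have hs : AnalyticAt ℂ s 0 :=
    ((hD.clog (by simp [hD0])).div analyticAt_const two_ne_zero).cexp
  refine ⟨fun η => (k η + (μ - μ⁻¹) * s η) / 2,
    (hk.add (analyticAt_const.mul hs)).div analyticAt_const two_ne_zero, ?_, ?_⟩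
  · simp [s, hD0, k]
  · filter_upwards [hD.continuousAt.eventually_ne (by rw [hD0]; exact one_ne_zero)] with η h
    have hsq : s η ^ 2 = D η := exp_half_log_sq h
    have h1 : (μ - μ⁻¹) ^ 2 * s η ^ 2 = k η ^ 2 - 4 := by
      rw [hsq]
      exact mul_div_cancel₀ _ (pow_ne_zero 2 hδ)
    have hkμ : k η * μ = μ ^ 2 + 1 + c * μ ^ 2 * η := by
      simp only [k]; field_simp
    generalize (μ - μ⁻¹) = δ at *
    generalize s η = s at *
    generalize k η = k at *
    linear_combination μ / 4 * h1 + ((k + δ * s) / 2) * hkμ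

/-- Here the annihilating factor equals `μ² - 1` at `0`; it is nonzero because the two roots `μ` and
`μ⁻¹` are distinct. -/
theorem beta_unique {μ c : ℂ} (hμ₁ : μ ^ 2 ≠ 1) {f g : ℝ → ℂ}
    (hf : ContinuousAt f 0) (hg : ContinuousAt g 0) (hf0 : f 0 = μ) (hg0 : g 0 = μ)
    (hf' : ∀ᶠ η : ℝ in 𝓝 0, (f η - μ) * (f η * μ - 1) = c * μ ^ 2 * f η * η)
    (hg' : ∀ᶠ η : ℝ in 𝓝 0, (g η - μ) * (g η * μ - 1) = c * μ ^ 2 * g η * η) :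
    f =ᶠ[𝓝 0] g := by
  have h : ContinuousAt (fun η : ℝ => μ * (f η + g η) - (μ ^ 2 + 1) - c * μ ^ 2 * η) 0 := by
    have := Complex.continuous_ofReal.continuousAt (x := (0 : ℝ))
    fun_prop
  have h0 : μ * (f 0 + g 0) - (μ ^ 2 + 1) - c * μ ^ 2 * (0 : ℝ) ≠ 0 := by
    rw [hf0, hg0]
    intro h
    apply hμ₁
    push_cast at h
    linear_combination h
  filter_upwards [hf', hg', h.eventually_ne h0] with η h1 h2 h3
  have : (f η - g η) * (μ * (f η + g η) - (μ ^ 2 + 1) - c * μ ^ 2 * η) = 0 := by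
    linear_combination h1 - h2
  exact sub_eq_zero.1 ((mul_eq_zero.1 this).resolve_right h3)

end Branches

/-! ### Passing between real power series and complex analytic functions. -/

section PowerSeries

theorem tendsto_ofReal_nhds_zero : Tendsto (fun x : ℝ => (x : ℂ)) (𝓝 0) (𝓝 0) := by
  have := Complex.continuous_ofReal.tendsto 0
  rwa [Complex.ofReal_zero] at this

/-- A real power series that converges near `0` extends to an analytic function near `0 : ℂ`. -/
theorem exists_analytic_extension {e : ℕ → ℝ} {f : ℝ → ℝ}
    (h : ∀ᶠ x : ℝ in 𝓝 0, HasSum (fun k : ℕ => e k * x ^ (k + 1) / ((k : ℝ) + 1)) (f x)) :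
    ∃ H : ℂ → ℂ, AnalyticAt ℂ H 0 ∧ HasDerivAt H (e 0) 0 ∧
      (∀ᶠ z in 𝓝 (0 : ℂ),
        HasSum (fun k : ℕ => (e k : ℂ) * (z ^ (k + 1) / ((k : ℂ) + 1))) (H z)) ∧
      ∀ᶠ x : ℝ in 𝓝 0, H x = f x := by
  let e' : ℕ → ℂ := fun n => Nat.rec 0 (fun k _ => (e k : ℂ) / ((k : ℂ) + 1)) n
  let P := FormalMultilinearSeries.ofScalars ℂ e'
  -- Convergence at a single positive point bounds the radius of convergence from below.
  obtain ⟨ρ, hρ0, hρ⟩ : ∃ ρ : NNReal, 0 < ρ ∧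
      Summable (fun k : ℕ => e k * (ρ : ℝ) ^ (k + 1) / ((k : ℝ) + 1)) := by
    obtain ⟨ε, hε, hball⟩ := Metric.eventually_nhds_iff.1 h
    have hρ : ((ε / 2).toNNReal : ℝ) = ε / 2 := Real.coe_toNNReal _ (half_pos hε).le
    refine ⟨(ε / 2).toNNReal, Real.toNNReal_pos.2 (half_pos hε), ?_⟩
    rw [hρ]
    refine (hball (y := ε / 2) ?_).summable
    rw [dist_zero_right, Real.norm_of_nonneg (by positivity)]
    linarith
  have hrad : (ρ : ENNReal) ≤ P.radius := by
    refine P.le_radius_of_tendsto (l := 0) ?_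
    rw [← tendsto_add_atTop_iff_nat 1]
    have := hρ.tendsto_atTop_zero.norm
    rw [norm_zero] at this
    refine this.congr fun k => ?_
    have h1 : ‖P (k + 1)‖ = ‖e' (k + 1)‖ := by simp [P]
    have h2 : (0 : ℝ) ≤ (k : ℝ) + 1 := by positivity
    have h3 : ‖e' (k + 1)‖ = |e k| / ((k : ℝ) + 1) := by
      change ‖(e k : ℂ) / ((k : ℂ) + 1)‖ = _
      rw [norm_div, Complex.norm_real, Real.norm_eq_abs]
      congr 1
      rw [← Nat.cast_add_one, Complex.norm_natCast, Nat.cast_add_one]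
    rw [h1, h3, Real.norm_eq_abs, abs_div, abs_mul, abs_of_nonneg h2,
      abs_of_nonneg (by positivity : (0 : ℝ) ≤ (ρ : ℝ) ^ (k + 1))]
    ring
  have hP : HasFPowerSeriesAt P.sum P 0 :=
    (P.hasFPowerSeriesOnBall (lt_of_lt_of_le (by exact_mod_cast hρ0) hrad)).hasFPowerSeriesAt
  have hsum : ∀ᶠ z in 𝓝 (0 : ℂ),
      HasSum (fun k : ℕ => (e k : ℂ) * (z ^ (k + 1) / ((k : ℂ) + 1))) (P.sum z) := by
    filter_upwards [hP.eventually_hasSum] with z hz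
    rw [zero_add, ← hasSum_nat_add_iff' 1] at hz
    simp only [Finset.range_one, Finset.sum_singleton] at hz
    have h0 : (P 0 fun _ => z) = 0 := by simp [P, e']
    rw [h0, sub_zero] at hz
    refine hz.congr_fun ?_
    intro k
    simp [P, FormalMultilinearSeries.ofScalars, e']
    ring
  have hder : HasDerivAt P.sum (e 0 : ℂ) 0 := by
    have := hP.hasDerivAt
    simpa [P, e'] using this
  refine ⟨P.sum, hP.analyticAt, hder, hsum, ?_⟩
  filter_upwards [tendsto_ofReal_nhds_zero.eventually hsum, h] with x h1 h2
  have h3 := Complex.hasSum_ofReal.2 h2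
  refine h1.unique (h3.congr_fun ?_)
  intro k
  push_cast
  ring

/-- Two functions analytic at `0` that agree on the real axis near `0` agree near `0`. -/
theorem eventually_eq_of_eventually_eq_ofReal {F G : ℂ → ℂ} (hF : AnalyticAt ℂ F 0)
    (hG : AnalyticAt ℂ G 0) (h : ∀ᶠ x : ℝ in 𝓝 0, F x = G x) : ∀ᶠ z in 𝓝 (0 : ℂ), F z = G z := by
  refine (hF.frequently_eq_iff_eventually_eq hG).1 ?_
  have ht : Tendsto (fun x : ℝ => (x : ℂ)) (𝓝[≠] 0) (𝓝[≠] 0) := by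
    refine tendsto_nhdsWithin_iff.2 ⟨tendsto_ofReal_nhds_zero.mono_left nhdsWithin_le_nhds, ?_⟩
    filter_upwards [self_mem_nhdsWithin] with x hx
    simpa using hx
  exact ht.frequently (h.filter_mono nhdsWithin_le_nhds).frequently

/-- The real part on the real axis of a function analytic at `0` and vanishing there. -/
theorem exists_real_coefficients {F : ℂ → ℂ} (hF : AnalyticAt ℂ F 0) (hF0 : F 0 = 0) :
    ∃ e : ℕ → ℝ, ∀ᶠ x : ℝ in 𝓝 0,
      HasSum (fun k : ℕ => e k * x ^ (k + 1) / ((k : ℝ) + 1)) (F x).re := by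
  obtain ⟨P, hP⟩ := hF
  refine ⟨fun k => (P.coeff (k + 1)).re * ((k : ℝ) + 1), ?_⟩
  filter_upwards [tendsto_ofReal_nhds_zero.eventually hP.eventually_hasSum] with x hx
  rw [zero_add, ← hasSum_nat_add_iff' 1] at hx
  have h0 : (P 0 fun _ => (x : ℂ)) = 0 := by
    rw [hP.coeff_zero, hF0]
  simp only [Finset.range_one, Finset.sum_singleton] at hx
  rw [h0, sub_zero] at hx
  refine (Complex.hasSum_re hx).congr_fun ?_
  intro k
  have h1 : (P (k + 1) fun _ => (x : ℂ)) = ((x ^ (k + 1) : ℝ) : ℂ) * P.coeff (k + 1) := by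
    rw [FormalMultilinearSeries.apply_eq_pow_smul_coeff, smul_eq_mul]
    push_cast
    rfl
  have h2 : ((k : ℝ) + 1) ≠ 0 := by positivity
  rw [h1, Complex.re_ofReal_mul]
  field_simp

end PowerSeries

/-! ### The action of small complex Miwa shifts on the phases. -/

section Dispersion

variable {N : ℕ}

/-- The numbers `e^{iθ_n}`. -/
noncomputable def expPos (θ : Fin N → ℝ) (n : Fin N) : ℂ := Complex.exp (Complex.I * θ n)

/-- The numbers `e^{-iθ_n}`. -/
noncomputable def expNeg (θ : Fin N → ℝ) (n : Fin N) : ℂ := Complex.exp (-Complex.I * θ n)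

theorem conj_expNeg (θ : Fin N → ℝ) (n : Fin N) :
    starRingEnd ℂ (expNeg θ n) = expPos θ n := by
  simp [expNeg, expPos, ← Complex.exp_conj]

theorem conj_expPos (θ : Fin N → ℝ) (n : Fin N) :
    starRingEnd ℂ (expPos θ n) = expNeg θ n := by
  simp [expNeg, expPos, ← Complex.exp_conj]

theorem expPos_mul_expNeg (θ : Fin N → ℝ) (n : Fin N) : expPos θ n * expNeg θ n = 1 := by
  rw [expPos, expNeg, ← Complex.exp_add]
  simp

theorem norm_expPos (θ : Fin N → ℝ) (n : Fin N) : ‖expPos θ n‖ = 1 := by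
  rw [expPos, mul_comm]
  exact Complex.norm_exp_ofReal_mul_I _

theorem norm_expNeg (θ : Fin N → ℝ) (n : Fin N) : ‖expNeg θ n‖ = 1 := by
  rw [← conj_expPos, RCLike.norm_conj, norm_expPos]

/-- All zeros and poles of the weights lie on the unit circle, so it suffices to keep the points α,
β, μ off it. -/
theorem lin_ne_zero_of_norm_ne {a : ℂ × ℂ} {t : ℂ} (ht : ‖t‖ = 1) (ha : ‖a.1‖ ≠ ‖a.2‖) :
    lin a t ≠ 0 := by
  intro h
  apply ha
  rw [lin, sub_eq_zero] at h
  rw [h, norm_mul, ht, mul_one]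

/-- The weights of the shift attached to a point of the projective line in the `N`-soliton
tau function. -/
noncomputable def weight (θ : Fin N → ℝ) (a : ℂ × ℂ) : Fin N → ℂ :=
  shiftWeight (expPos θ) (expNeg θ) a

theorem weight_apply (θ : Fin N → ℝ) (a : ℂ × ℂ) (n : Fin N) :
    weight θ a n = lin a (expNeg θ n) / lin a (expPos θ n) := rfl

theorem weight_ne_zero (θ : Fin N → ℝ) {a : ℂ × ℂ} (ha : ‖a.1‖ ≠ ‖a.2‖) (n : Fin N) :
    weight θ a n ≠ 0 :=
  div_ne_zero (lin_ne_zero_of_norm_ne (norm_expNeg θ n) ha)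
    (lin_ne_zero_of_norm_ne (norm_expPos θ n) ha)

theorem exp_I_mul_two_arg (w : ℂ) (hw : w ≠ 0) :
    Complex.exp (Complex.I * ((2 * Complex.arg w : ℝ) : ℂ)) = w / starRingEnd ℂ w := by
  have h1 : (‖w‖ : ℂ) * Complex.exp (Complex.arg w * Complex.I) = w :=
    Complex.norm_mul_exp_arg_mul_I w
  have h2 : (‖w‖ : ℂ) * Complex.exp (-(Complex.arg w * Complex.I)) = starRingEnd ℂ w := by
    have h := congrArg (starRingEnd ℂ) h1
    rw [map_mul, ← Complex.exp_conj, map_mul, Complex.conj_ofReal, Complex.conj_ofReal,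
      Complex.conj_I, mul_neg] at h
    exact h
  have h3 : (‖w‖ : ℂ) ≠ 0 := by simpa using hw
  rw [← h2]
  nth_rewrite 2 [← h1]
  rw [mul_div_mul_left _ _ h3, ← Complex.exp_sub]
  congr 1
  push_cast
  ring

/-- For real `x` the conjugate of `1 - x e^{-iθ}` is `1 - x e^{iθ}`, so twice its argument
exponentiates to a weight. The weight is rational in `x`, hence continues to complex points. -/
theorem exp_I_mul_two_arg_one_sub (θ : Fin N → ℝ) (n : Fin N) (x : ℝ) (hx : |x| ≠ 1) :
    Complex.exp (Complex.I *
      ((2 * Complex.arg (1 - x * Complex.exp (-Complex.I * θ n)) : ℝ) : ℂ)) =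
      weight θ ((x : ℂ), 1) n := by
  have h0 : (1 : ℂ) - x * expNeg θ n ≠ 0 :=
    lin_ne_zero_of_norm_ne (a := ((x : ℂ), 1)) (norm_expNeg θ n) (by simpa using hx)
  have h := exp_I_mul_two_arg _ h0
  rw [map_sub, map_mul, map_one, Complex.conj_ofReal, conj_expNeg] at h
  exact h

theorem hasSum_I_mul {e : ℕ → ℝ} {z S : ℂ}
    (h : HasSum (fun k : ℕ => (e k : ℂ) * (z ^ (k + 1) / ((k : ℂ) + 1))) S) :
    HasSum (fun k : ℕ => (e k : ℂ) * (Complex.I * z ^ (k + 1) / ((k : ℂ) + 1)))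
      (Complex.I * S) := by
  have h2 := h.mul_left Complex.I
  have : (fun k : ℕ => (e k : ℂ) * (Complex.I * z ^ (k + 1) / ((k : ℂ) + 1))) =
      fun k : ℕ => Complex.I * ((e k : ℂ) * (z ^ (k + 1) / ((k : ℂ) + 1))) := by
    funext k
    ring
  rw [this]
  exact h2

theorem analyticAt_weight (θ : Fin N → ℝ) (n : Fin N) {a : ℂ → ℂ} {z : ℂ} (ha : AnalyticAt ℂ a z)
    (hz : ‖a z‖ ≠ 1) : AnalyticAt ℂ (fun ξ => weight θ (a ξ, 1) n) z := by
  have h0 : lin (a z, 1) (expPos θ n) ≠ 0 :=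
    lin_ne_zero_of_norm_ne (norm_expPos θ n) (by simpa using hz)
  simp only [weight_apply]
  simp only [lin] at h0 ⊢
  fun_prop (disch := assumption)

theorem abs_ne_one_of_sq_ne_one {μ : ℝ} (hμ₁ : μ ^ 2 ≠ 1) : |μ| ≠ 1 := by
  intro h
  apply hμ₁
  rw [← sq_abs, h, one_pow]

/-- The effect of a small positive Miwa shift on the phases. -/
theorem IsDispersion.exists_alpha {μ c : ℝ} {θ : Fin N → ℝ} {d : Dispersion N}
    (hd : IsDispersion μ c θ d) (hμ₀ : μ ≠ 0) (hc : c ≠ 0) :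
    ∃ a : ℂ → ℂ, AnalyticAt ℂ a 0 ∧ a 0 = 0 ∧
      (∀ᶠ ξ in 𝓝 0, ξ * (a ξ - μ) * (a ξ * μ - 1) = c * (μ : ℂ) ^ 2 * a ξ) ∧
      (∀ᶠ ξ in 𝓝 (0 : ℂ), ∃ S, HasSum (fun k : ℕ => (d.phi k : ℂ) *
          (Complex.I * ξ ^ (k + 1) / ((k : ℂ) + 1))) S ∧
        Complex.exp (Complex.I * S) = 1 - (μ : ℂ)⁻¹ * a ξ) ∧
      (∀ n, ∀ᶠ ξ in 𝓝 (0 : ℂ), ∃ S, HasSum (fun k : ℕ => (d.nu n k : ℂ) *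
          (Complex.I * ξ ^ (k + 1) / ((k : ℂ) + 1))) S ∧
        Complex.exp S = weight θ (a ξ, 1) n) ∧
      ∀ n, (d.nu n 0 : ℂ) * (c * μ) = 2 * Complex.sin (θ n) := by
  have hμc : (μ : ℂ) ≠ 0 := by exact_mod_cast hμ₀
  have hcc : (c : ℂ) ≠ 0 := by exact_mod_cast hc
  obtain ⟨a, ha, ha0, haeq⟩ := exists_analytic_alpha hμc hcc
  -- The given real function is only continuous at `0`; uniqueness identifies it with the analytic
  -- branch.
  have hreal : ∀ᶠ ξ : ℝ in 𝓝 0, (d.alpha ξ : ℂ) = a ξ := by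
    refine alpha_unique hμc hcc (f := fun ξ => (d.alpha ξ : ℂ)) (g := fun ξ => a ξ)
      ?_ ?_ ?_ (tendsto_ofReal_nhds_zero.eventually haeq)
    · exact Complex.continuous_ofReal.continuousAt.comp hd.alpha_continuousAt
    · refine ContinuousAt.comp (g := a) (f := fun x : ℝ => (x : ℂ)) ?_
        Complex.continuous_ofReal.continuousAt
      simpa using ha.continuousAt
    · have h := eventually_nhdsWithin_iff.1 hd.alpha_eq
      filter_upwards [h] with ξ hξ
      by_cases h0 : ξ = 0
      · rw [h0, hd.alpha_zero]; simp
      · obtain ⟨h1, h2⟩ := hξ h0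
        have h3 : ξ * (d.alpha ξ - μ) * (d.alpha ξ * μ - 1) = c * μ ^ 2 * d.alpha ξ := by
          field_simp at h2
          linear_combination h2
        exact_mod_cast h3
  have hcont : ContinuousAt d.alpha 0 := hd.alpha_continuousAt
  have hν : ∀ n, ∃ H : ℂ → ℂ, HasDerivAt H (d.nu n 0) 0 ∧
      (∀ᶠ z in 𝓝 (0 : ℂ),
        HasSum (fun k : ℕ => (d.nu n k : ℂ) * (z ^ (k + 1) / ((k : ℂ) + 1))) (H z)) ∧
      ∀ᶠ z in 𝓝 (0 : ℂ), Complex.exp (Complex.I * H z) = weight θ (a z, 1) n := by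
    intro n
    obtain ⟨H, hH, hHd, hsum, hHr⟩ := exists_analytic_extension (hd.nu_series n)
    have hne : ∀ᶠ ξ : ℝ in 𝓝 0, |d.alpha ξ| ≠ 1 := by
      refine hcont.abs.eventually_ne ?_
      simp [hd.alpha_zero]
    have hA : AnalyticAt ℂ (fun ξ => Complex.exp (Complex.I * H ξ)) 0 := by fun_prop
    refine ⟨H, hHd, hsum, eventually_eq_of_eventually_eq_ofReal hA
      (analyticAt_weight θ n ha (by simp [ha0])) ?_⟩
    filter_upwards [hHr, hreal, hne] with ξ h1 h2 h3
    rw [h1, ← h2, exp_I_mul_two_arg_one_sub θ n _ h3]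
  refine ⟨a, ha, ha0, haeq, ?_, ?_, ?_⟩
  · obtain ⟨H, hH, -, hsum, hHr⟩ := exists_analytic_extension hd.phi_series
    have hpos : ∀ᶠ ξ : ℝ in 𝓝 0, 0 < 1 - μ⁻¹ * d.alpha ξ := by
      refine (continuousAt_const.sub (continuousAt_const.mul hcont)).eventually_const_lt ?_
      simp [hd.alpha_zero]
    have hA : AnalyticAt ℂ (fun ξ => Complex.exp (Complex.I * (Complex.I * H ξ))) 0 := by fun_prop
    have hB : AnalyticAt ℂ (fun ξ => 1 - (μ : ℂ)⁻¹ * a ξ) 0 := by fun_prop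
    have h := eventually_eq_of_eventually_eq_ofReal hA hB (by
      filter_upwards [hHr, hreal, hpos] with ξ h1 h2 h3
      rw [h1, ← h2, ← mul_assoc, Complex.I_mul_I]
      push_cast
      rw [neg_one_mul, neg_neg, ← Complex.ofReal_exp, Real.exp_log h3]
      push_cast
      rfl)
    filter_upwards [h, hsum] with ξ h1 h2
    exact ⟨_, hasSum_I_mul h2, h1⟩
  · intro n
    obtain ⟨H, -, hsum, h⟩ := hν n
    filter_upwards [h, hsum] with ξ h1 h2
    exact ⟨_, hasSum_I_mul h2, h1⟩
  · intro n
    obtain ⟨H, hHd, hsum, h⟩ := hν n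
    have hda := ha.differentiableAt.hasDerivAt
    set a' := deriv a 0 with ha'
    -- Differentiation at `0`: the relation for α gives `c μ a'(0) = 1`, and the weight gives `i ν =
    -- a'(0) (e^{iθ} - e^{-iθ})`. Together they determine the growth rate in `t₁`.
    have hq1 : HasDerivAt (fun ξ => ξ * (a ξ - μ) * (a ξ * μ - 1))
        ((1 * (a 0 - μ) + 0 * a') * (a 0 * μ - 1) + (0 * (a 0 - μ)) * (a' * μ)) 0 :=
      ((hasDerivAt_id (0 : ℂ)).mul (hda.sub_const (μ : ℂ))).mul
        ((hda.mul_const (μ : ℂ)).sub_const 1)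
    have hq2 : HasDerivAt (fun ξ => c * (μ : ℂ) ^ 2 * a ξ) (c * (μ : ℂ) ^ 2 * a') 0 :=
      hda.const_mul _
    have e1 := hq1.unique (hq2.congr_of_eventuallyEq haeq)
    have hH0 : H 0 = 0 := by
      have h0 := hsum.self_of_nhds
      have : (fun k : ℕ => (d.nu n k : ℂ) * ((0 : ℂ) ^ (k + 1) / ((k : ℂ) + 1))) =
          fun _ => 0 := by
        funext k; simp
      rw [this] at h0
      exact h0.unique hasSum_zero
    have hw1 : HasDerivAt (fun ξ => Complex.exp (Complex.I * H ξ))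
        (Complex.exp (Complex.I * H 0) * (Complex.I * d.nu n 0)) 0 :=
      (hHd.const_mul Complex.I).cexp
    have hw2 : HasDerivAt (fun ξ => weight θ (a ξ, 1) n)
        (((-(a' * expNeg θ n)) * (1 - a 0 * expPos θ n) -
          (1 - a 0 * expNeg θ n) * (-(a' * expPos θ n))) / (1 - a 0 * expPos θ n) ^ 2) 0 :=
      ((hda.mul_const (expNeg θ n)).const_sub 1).div ((hda.mul_const (expPos θ n)).const_sub 1)
        (by simp [ha0, lin])
    have e2 := hw1.unique (hw2.congr_of_eventuallyEq h)
    rw [ha0] at e1 e2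
    rw [hH0] at e2
    simp only [zero_mul, sub_zero, mul_zero, Complex.exp_zero, one_mul, one_pow, div_one] at e2
    have e3 : (c : ℂ) * μ * a' = 1 := by
      apply mul_left_cancel₀ hμc
      linear_combination -e1
    have e4 : Complex.sin (θ n) = (expNeg θ n - expPos θ n) * Complex.I / 2 := by
      rw [Complex.sin, expNeg, expPos]
      ring_nf
    rw [e4]
    have hI := Complex.I_mul_I
    linear_combination (-(Complex.I * c * μ)) * e2 + (c * μ * (d.nu n 0 : ℂ)) * hI + (
      Complex.I * (expNeg θ n - expPos θ n)) * e3

/-- The effect of a small negative Miwa shift on the phases. -/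
theorem IsDispersion.exists_beta {μ c : ℝ} {θ : Fin N → ℝ} {d : Dispersion N}
    (hd : IsDispersion μ c θ d) (hμ₀ : μ ≠ 0) (hμ₁ : μ ^ 2 ≠ 1) :
    ∃ b : ℂ → ℂ, AnalyticAt ℂ b 0 ∧ b 0 = μ ∧
      (∀ᶠ η in 𝓝 0, (b η - μ) * (b η * μ - 1) = c * (μ : ℂ) ^ 2 * b η * η) ∧
      (∀ᶠ η in 𝓝 (0 : ℂ), ∃ S, HasSum (fun k : ℕ => (d.phiBar k : ℂ) *
          (Complex.I * η ^ (k + 1) / ((k : ℂ) + 1))) S ∧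
        Complex.exp (Complex.I * S) = (1 - ((μ : ℂ) ^ 2)⁻¹) / (1 - (μ : ℂ)⁻¹ * (b η)⁻¹)) ∧
      ∀ n, ∀ᶠ η in 𝓝 (0 : ℂ), ∃ S, HasSum (fun k : ℕ => (d.nuBar n k : ℂ) *
          (Complex.I * η ^ (k + 1) / ((k : ℂ) + 1))) S ∧
        Complex.exp S = weight θ (b η, 1) n / weight θ ((μ : ℂ), 1) n := by
  have hμc : (μ : ℂ) ≠ 0 := by exact_mod_cast hμ₀
  have hμc1 : (μ : ℂ) ^ 2 ≠ 1 := by exact_mod_cast hμ₁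
  obtain ⟨b, hb, hb0, hbeq⟩ := exists_analytic_beta (c := (c : ℂ)) hμc hμc1
  have hreal : ∀ᶠ η : ℝ in 𝓝 0, (d.beta η : ℂ) = b η := by
    refine beta_unique (c := (c : ℂ)) hμc1 (f := fun η => (d.beta η : ℂ)) (g := fun η => b η)
      ?_ ?_ ?_ ?_ ?_ (tendsto_ofReal_nhds_zero.eventually hbeq)
    · exact Complex.continuous_ofReal.continuousAt.comp hd.beta_continuousAt
    · refine ContinuousAt.comp (g := b) (f := fun x : ℝ => (x : ℂ)) ?_
        Complex.continuous_ofReal.continuousAt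
      simpa using hb.continuousAt
    · rw [hd.beta_zero]
    · simpa using hb0
    · filter_upwards [hd.beta_eq] with η hη
      obtain ⟨h1, h2⟩ := hη
      have h3 : (d.beta η - μ) * (d.beta η * μ - 1) = c * μ ^ 2 * d.beta η * η := by
        field_simp at h2
        linear_combination h2
      exact_mod_cast h3
  have hcont : ContinuousAt d.beta 0 := hd.beta_continuousAt
  have hone : (1 : ℝ) - (μ ^ 2)⁻¹ ≠ 0 := by
    rw [sub_ne_zero]
    intro h
    exact hμ₁ (inv_eq_one.1 h.symm)
  have honec : (1 : ℂ) - (μ : ℂ)⁻¹ * (b 0)⁻¹ ≠ 0 := by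
    rw [hb0, ← mul_inv, ← sq]
    exact_mod_cast hone
  refine ⟨b, hb, hb0, hbeq, ?_, ?_⟩
  · obtain ⟨H, hH, -, hsum, hHr⟩ := exists_analytic_extension hd.phiBar_series
    -- For `|μ| < 1` numerator and denominator are both negative near `0`, but their quotient is
    -- near `1`. The difference of logarithms of absolute values is therefore the logarithm of a
    -- positive quotient.
    have hpos : ∀ᶠ η : ℝ in 𝓝 0, 0 < (1 - μ⁻¹ * (d.beta η)⁻¹) / (1 - (μ ^ 2)⁻¹) := by
      have h0 : d.beta 0 ≠ 0 := by rwa [hd.beta_zero]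
      have hcd : ContinuousAt (fun η => (1 - μ⁻¹ * (d.beta η)⁻¹) / (1 - (μ ^ 2)⁻¹)) 0 :=
        (continuousAt_const.sub (continuousAt_const.mul (hcont.inv₀ h0))).div_const _
      refine hcd.eventually_const_lt ?_
      have : (1 - μ⁻¹ * (d.beta 0)⁻¹) / (1 - (μ ^ 2)⁻¹) = 1 := by
        rw [hd.beta_zero, ← mul_inv, ← sq, div_self hone]
      exact one_pos.trans_eq this.symm
    have hA : AnalyticAt ℂ (fun η => Complex.exp (Complex.I * (Complex.I * H η))) 0 := by fun_prop
    have hb0' : b 0 ≠ 0 := by rwa [hb0]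
    have hB : AnalyticAt ℂ (fun η => (1 - ((μ : ℂ) ^ 2)⁻¹) / (1 - (μ : ℂ)⁻¹ * (b η)⁻¹)) 0 :=
      analyticAt_const.div (analyticAt_const.sub (analyticAt_const.mul (hb.inv hb0'))) honec
    have h := eventually_eq_of_eventually_eq_ofReal hA hB (by
      filter_upwards [hHr, hreal, hpos] with η h1 h2 h3
      have h4 : (1 - μ⁻¹ * (d.beta η)⁻¹) ≠ 0 := by
        intro h
        rw [h, zero_div] at h3
        exact lt_irrefl _ h3
      rw [h1, ← h2, ← mul_assoc, Complex.I_mul_I, ← Real.log_div h4 hone, neg_one_mul,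
        ← Complex.ofReal_neg, ← Complex.ofReal_exp, Real.exp_neg, Real.exp_log h3, inv_div]
      push_cast
      rfl)
    filter_upwards [h, hsum] with η h1 h2
    exact ⟨_, hasSum_I_mul h2, h1⟩
  · intro n
    have hμa : |μ| ≠ 1 := abs_ne_one_of_sq_ne_one hμ₁
    obtain ⟨H, hH, -, hsum, hHr⟩ := exists_analytic_extension (hd.nuBar_series n)
    have hne : ∀ᶠ η : ℝ in 𝓝 0, |d.beta η| ≠ 1 := by
      refine hcont.abs.eventually_ne ?_
      rwa [hd.beta_zero]
    have hA : AnalyticAt ℂ (fun ξ => Complex.exp (Complex.I * H ξ)) 0 := by fun_prop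
    have hB : AnalyticAt ℂ (fun η => weight θ (b η, 1) n / weight θ ((μ : ℂ), 1) n) 0 :=
      (analyticAt_weight θ n hb (by simpa [hb0] using hμa)).div analyticAt_const
        (weight_ne_zero θ (by simpa using hμa) n)
    have h := eventually_eq_of_eventually_eq_ofReal hA hB (by
      filter_upwards [hHr, hreal, hne] with η h1 h2 h3
      rw [h1, ← h2, Complex.ofReal_sub, mul_sub, Complex.exp_sub,
        exp_I_mul_two_arg_one_sub θ n _ h3, exp_I_mul_two_arg_one_sub θ n _ hμa])
    filter_upwards [h, hsum] with ξ h1 h2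
    exact ⟨_, hasSum_I_mul h2, h1⟩

end Dispersion

/-! ### Rational algebra reducing the hierarchy to bilinear identities. -/

section Scalar

variable {μ c P Q : ℂ}

theorem eq_div_of_alpha_relation {ξ α : ℂ} (h1 : α - μ ≠ 0) (h2 : α * μ - 1 ≠ 0)
    (hξ : ξ * (α - μ) * (α * μ - 1) = c * μ ^ 2 * α) :
    ξ = c * μ ^ 2 * α / ((α - μ) * (α * μ - 1)) := by
  rw [eq_div_iff (mul_ne_zero h1 h2), ← hξ]
  ring

theorem eq_div_of_beta_relation {η β : ℂ} (hμ : μ ≠ 0) (hc : c ≠ 0) (hβ : β ≠ 0)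
    (hη : (β - μ) * (β * μ - 1) = c * μ ^ 2 * β * η) :
    η = (β - μ) * (β * μ - 1) / (c * μ ^ 2 * β) := by
  rw [hη]
  field_simp

theorem posWeight_eq (hμ : μ ≠ 0) (α : ℂ) : 1 - μ⁻¹ * α = -(α - μ) / μ := by
  field_simp
  ring

theorem negWeight_eq {β : ℂ} (hμ : μ ≠ 0) (hβ : β ≠ 0) :
    (1 - (μ ^ 2)⁻¹) / (1 - μ⁻¹ * β⁻¹) = (μ ^ 2 - 1) * β / (μ * (β * μ - 1)) := by
  have h3 : 1 - μ⁻¹ * β⁻¹ = (β * μ - 1) / (β * μ) := by field_simp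
  rw [h3]
  field_simp

/-- In these lemmas `P`, `Q` stand for the amplitude and its conjugate, `e` for the plane wave, the
remaining letters such as `t`, `ta`, `na`, `li` for values of τ, and `F`, `F'` for Fay identities.
Here the amplitude condition `P Q c = 1` makes the two terms of `G` match two terms of `F`, so that
`G` becomes one quotient. -/
theorem bigG_scalar (hμ : μ ≠ 0) (hPQ : P * Q * c = 1) {ξ α e t ta tm tam na ti : ℂ}
    (he : e ≠ 0) (h1 : α - μ ≠ 0) (h2 : α * μ - 1 ≠ 0)
    (hξ : ξ * (α - μ) * (α * μ - 1) = c * μ ^ 2 * α) (hta : ta ≠ 0) (htm : tm ≠ 0)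
    (F : t * tam = -(α * μ - 1) * (ta * tm) + μ * α * (ti * na)) :
    1 + ξ * (P * (e * (1 - μ⁻¹ * α)) * (na / ta)) * (Q * e⁻¹ * (ti / tm)) =
      -(t * tam) / ((α * μ - 1) * (ta * tm)) := by
  rw [F, posWeight_eq hμ, eq_div_of_alpha_relation h1 h2 hξ]
  generalize α * μ - 1 = D at *
  linear_combination (norm := (field_simp; ring)) (-(μ * α * na * ti / (D * (ta * tm)))) * hPQ

theorem smallG_scalar (hμ : μ ≠ 0) (hμ₁ : μ ^ 2 - 1 ≠ 0) (hc : c ≠ 0) (hPQ : P * Q * c = 1)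
    {η β e t tb tm tbm nb ti : ℂ} (he : e ≠ 0) (hβ : β ≠ 0) (h2 : β * μ - 1 ≠ 0)
    (hη : (β - μ) * (β * μ - 1) = c * μ ^ 2 * β * η) (ht : t ≠ 0) (htb : tb ≠ 0)
    (F : (μ ^ 2 - 1) * (tb * t) + μ * (β - μ) * (nb * ti) = (β * μ - 1) * (tbm * tm)) :
    1 + η * ((c * μ ^ 2 / (μ ^ 2 - 1) * P) * (e * ((1 - (μ ^ 2)⁻¹) / (1 - μ⁻¹ * β⁻¹))) * (nb / tb)) *
        ((c * μ ^ 2 / (μ ^ 2 - 1) * Q) * e⁻¹ * (ti / t)) =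
      (β * μ - 1) * (tbm * tm) / ((μ ^ 2 - 1) * (tb * t)) := by
  rw [← F, eq_div_of_beta_relation hμ hc hβ hη, negWeight_eq hμ hβ]
  linear_combination (norm := (field_simp; ring))
    ((β - μ) * μ / (μ ^ 2 - 1) * (nb * ti / (tb * t))) * hPQ

theorem pos_U_scalar (hμ : μ ≠ 0) {ξ₁ ξ₂ α₁ α₂ e t ta tb tm tam tbm tab na nb nab G₁ G₂ : ℂ}
    (h1 : α₁ - μ ≠ 0) (h1' : α₁ * μ - 1 ≠ 0) (h2 : α₂ - μ ≠ 0) (h2' : α₂ * μ - 1 ≠ 0)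
    (hξ₁ : ξ₁ * (α₁ - μ) * (α₁ * μ - 1) = c * μ ^ 2 * α₁)
    (hξ₂ : ξ₂ * (α₂ - μ) * (α₂ * μ - 1) = c * μ ^ 2 * α₂)
    (hta : ta ≠ 0) (htb : tb ≠ 0) (htm : tm ≠ 0) (htab : tab ≠ 0)
    (hG₁ : G₁ = -(t * tam) / ((α₁ * μ - 1) * (ta * tm)))
    (hG₂ : G₂ = -(t * tbm) / ((α₂ * μ - 1) * (tb * tm)))
    (F : (α₁ - α₂) * μ * (tab * tm) - (α₁ - μ) * α₂ * (tam * tb) + α₁ * (α₂ - μ) * (ta * tbm) = 0)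
    (F' : (α₁ - α₂) * (nab * t) - (α₁ * μ - 1) * α₂ * (ta * nb) +
      α₁ * (α₂ * μ - 1) * (na * tb) = 0) :
    (ξ₁ * G₂ - ξ₂ * G₁) * (P * (e * (1 - μ⁻¹ * α₂) * (1 - μ⁻¹ * α₁)) * (nab / tab)) -
      ξ₁ * (P * (e * (1 - μ⁻¹ * α₁)) * (na / ta)) +
      ξ₂ * (P * (e * (1 - μ⁻¹ * α₂)) * (nb / tb)) = 0 := by
  -- `F` collapses the difference to a multiple of `t * tab`. The factor `tab` cancels the
  -- denominator of the doubly shifted `U`, and `F'` does the rest.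
  have hG : ξ₁ * G₂ - ξ₂ * G₁ = c * μ ^ 3 * (α₁ - α₂) /
      ((α₁ - μ) * (α₂ - μ) * (α₁ * μ - 1) * (α₂ * μ - 1)) * (t * tab / (ta * tb)) := by
    rw [hG₁, hG₂, eq_div_of_alpha_relation h1 h1' hξ₁,
    eq_div_of_alpha_relation h2 h2' hξ₂]
    linear_combination (norm := (field_simp; ring))
      (-(c * μ ^ 2 * t /
        ((α₁ - μ) * (α₂ - μ) * (α₁ * μ - 1) * (α₂ * μ - 1) * (ta * tb * tm)))) * F
  rw [hG, posWeight_eq hμ, posWeight_eq hμ, eq_div_of_alpha_relation h1 h1' hξ₁,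
    eq_div_of_alpha_relation h2 h2' hξ₂]
  generalize α₁ * μ - 1 = D₁ at *
  generalize α₂ * μ - 1 = D₂ at *
  linear_combination (norm := (field_simp; ring)) (P * e * c * μ / (D₁ * D₂ * (ta * tb))) * F'

theorem pos_V_scalar {ξ₁ ξ₂ α₁ α₂ e ta tb tm tam tbm tab tabm ti tai tbi G₁ G₂ : ℂ}
    (hμ : μ ≠ 0) (he : e ≠ 0)
    (h1 : α₁ - μ ≠ 0) (h1' : α₁ * μ - 1 ≠ 0) (h2 : α₂ - μ ≠ 0) (h2' : α₂ * μ - 1 ≠ 0)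
    (hξ₁ : ξ₁ * (α₁ - μ) * (α₁ * μ - 1) = c * μ ^ 2 * α₁)
    (hξ₂ : ξ₂ * (α₂ - μ) * (α₂ * μ - 1) = c * μ ^ 2 * α₂)
    (htm : tm ≠ 0) (htam : tam ≠ 0) (htbm : tbm ≠ 0) (htab : tab ≠ 0)
    (hG₂ : G₂ = -(ta * tabm) / ((α₂ * μ - 1) * (tab * tam)))
    (hG₁ : G₁ = -(tb * tabm) / ((α₁ * μ - 1) * (tab * tbm)))
    (F : (α₁ - α₂) * μ * (tab * tm) - (α₁ - μ) * α₂ * (tam * tb) + α₁ * (α₂ - μ) * (ta * tbm) = 0)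
    (F' : (α₁ - α₂) * (tabm * ti) - (α₁ * μ - 1) * α₂ * (tai * tbm) +
      α₁ * (α₂ * μ - 1) * (tam * tbi) = 0) :
    (ξ₁ * G₂ - ξ₂ * G₁) * (Q * e⁻¹ * (ti / tm)) -
      ξ₁ * (Q * (e * (1 - μ⁻¹ * α₂))⁻¹ * (tbi / tbm)) +
      ξ₂ * (Q * (e * (1 - μ⁻¹ * α₁))⁻¹ * (tai / tam)) = 0 := by
  have hG : ξ₁ * G₂ - ξ₂ * G₁ = c * μ ^ 3 * (α₁ - α₂) /
      ((α₁ - μ) * (α₂ - μ) * (α₁ * μ - 1) * (α₂ * μ - 1)) * (tabm * tm / (tam * tbm)) := by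
    rw [hG₁, hG₂, eq_div_of_alpha_relation h1 h1' hξ₁,
    eq_div_of_alpha_relation h2 h2' hξ₂]
    linear_combination (norm := (field_simp; ring)) (-(c * μ ^ 2 * tabm /
        ((α₁ - μ) * (α₂ - μ) * (α₁ * μ - 1) * (α₂ * μ - 1) * (tab * tam * tbm)))) * F
  rw [hG, posWeight_eq hμ, posWeight_eq hμ, eq_div_of_alpha_relation h1 h1' hξ₁,
    eq_div_of_alpha_relation h2 h2' hξ₂]
  generalize α₁ * μ - 1 = D₁ at *
  generalize α₂ * μ - 1 = D₂ at *
  linear_combination (norm := (field_simp; ring)) (Q * e⁻¹ * c * μ ^ 3 /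
      ((α₁ - μ) * (α₂ - μ) * D₁ * D₂ * (tam * tbm))) * F'

theorem mixed_u_scalar (hμ : μ ≠ 0) (hμ₁ : μ ^ 2 - 1 ≠ 0) {ξ α e t ta tm tam na lam lm G : ℂ}
    (h1 : α - μ ≠ 0) (h2 : α * μ - 1 ≠ 0)
    (hξ : ξ * (α - μ) * (α * μ - 1) = c * μ ^ 2 * α)
    (hta : ta ≠ 0) (htm : tm ≠ 0) (htam : tam ≠ 0)
    (hG : G = -(t * tam) / ((α * μ - 1) * (ta * tm)))
    (F : -(μ - α) * (lam * t) - μ * (α * μ - 1) * (lm * ta) + (μ ^ 2 - 1) * α * (tm * na) = 0) :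
    G * ((c * μ ^ 2 / (μ ^ 2 - 1) * P) * (e * (1 - μ⁻¹ * α)) * (lam / tam)) -
      (c * μ ^ 2 / (μ ^ 2 - 1) * P) * e * (lm / tm) =
      ξ * (P * (e * (1 - μ⁻¹ * α)) * (na / ta)) := by
  rw [hG, posWeight_eq hμ, eq_div_of_alpha_relation h1 h2 hξ]
  linear_combination (norm := (field_simp; ring))
    (c * μ * P * e / ((μ ^ 2 - 1) * (α * μ - 1) * (ta * tm))) * F

theorem mixed_v_scalar (hμ : μ ≠ 0) (hμ₁ : μ ^ 2 - 1 ≠ 0) {ξ α e t ta tm tam ti li lai G : ℂ}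
    (he : e ≠ 0) (h1 : α - μ ≠ 0) (h2 : α * μ - 1 ≠ 0)
    (hξ : ξ * (α - μ) * (α * μ - 1) = c * μ ^ 2 * α)
    (ht : t ≠ 0) (hta : ta ≠ 0) (htm : tm ≠ 0)
    (hG : G = -(t * tam) / ((α * μ - 1) * (ta * tm)))
    (F : -(μ - α) * (tam * li) - μ * (α * μ - 1) * (tm * lai) + (μ ^ 2 - 1) * α * (ti * ta) = 0) :
    G * ((c * μ ^ 2 / (μ ^ 2 - 1) * Q) * e⁻¹ * (li / t)) -
      (c * μ ^ 2 / (μ ^ 2 - 1) * Q) * (e * (1 - μ⁻¹ * α))⁻¹ * (lai / ta) =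
      ξ * (Q * e⁻¹ * (ti / tm)) := by
  rw [hG, posWeight_eq hμ, eq_div_of_alpha_relation h1 h2 hξ]
  linear_combination (norm := (field_simp; ring))
    (-(c * μ ^ 2 * Q * e⁻¹ / ((μ ^ 2 - 1) * (α * μ - 1) * (α - μ) * (ta * tm)))) * F

theorem mixed_U_scalar (hμ : μ ≠ 0) (hμ₁ : μ ^ 2 - 1 ≠ 0) (hc : c ≠ 0)
    {η β e t tb tm tbm nb n nbm g : ℂ} (hβ : β ≠ 0) (h2 : β * μ - 1 ≠ 0)
    (hη : (β - μ) * (β * μ - 1) = c * μ ^ 2 * β * η) (ht : t ≠ 0) (htb : tb ≠ 0) (htbm : tbm ≠ 0)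
    (hg : g = (β * μ - 1) * (tbm * tm) / ((μ ^ 2 - 1) * (tb * t)))
    (F : μ * (n * tb) - β * (tm * nbm) - (μ - β) * (nb * t) = 0) :
    g * (P * (e * ((1 - (μ ^ 2)⁻¹) / (1 - μ⁻¹ * β⁻¹))) * (nbm / tbm)) - P * e * (n / t) =
      η * ((c * μ ^ 2 / (μ ^ 2 - 1) * P) * (e * ((1 - (μ ^ 2)⁻¹) / (1 - μ⁻¹ * β⁻¹))) *
        (nb / tb)) := by
  rw [hg, eq_div_of_beta_relation hμ hc hβ hη, negWeight_eq hμ hβ]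
  linear_combination (norm := (field_simp; ring)) (-(P * e / (μ * tb * t))) * F

theorem mixed_V_scalar (hμ : μ ≠ 0) (hμ₁ : μ ^ 2 - 1 ≠ 0) (hc : c ≠ 0)
    {η β e t tb tm tbm ti li lbi g : ℂ} (he : e ≠ 0) (hβ : β ≠ 0)
    (hη : (β - μ) * (β * μ - 1) = c * μ ^ 2 * β * η) (ht : t ≠ 0) (htb : tb ≠ 0) (htm : tm ≠ 0)
    (hg : g = (β * μ - 1) * (tbm * tm) / ((μ ^ 2 - 1) * (tb * t)))
    (F : μ * (t * lbi) - β * (ti * tbm) - (μ - β) * (tb * li) = 0) :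
    g * (Q * e⁻¹ * (ti / tm)) - Q * (e * ((1 - (μ ^ 2)⁻¹) / (1 - μ⁻¹ * β⁻¹)))⁻¹ * (lbi / tb) =
      η * ((c * μ ^ 2 / (μ ^ 2 - 1) * Q) * e⁻¹ * (li / t)) := by
  rw [hg, eq_div_of_beta_relation hμ hc hβ hη, negWeight_eq hμ hβ]
  linear_combination (norm := (field_simp; ring))
    (-(Q * e⁻¹ * (β * μ - 1) / ((μ ^ 2 - 1) * β * (tb * t)))) * F

theorem neg_u_scalar (hμ : μ ≠ 0) (hμ₁ : μ ^ 2 - 1 ≠ 0) (hc : c ≠ 0)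
    {η₁ η₂ β₁ β₂ e t ta tb tm tam tbm tabm na nb nab g₁ g₂ : ℂ}
    (h1 : β₁ ≠ 0) (h1' : β₁ * μ - 1 ≠ 0) (h2 : β₂ ≠ 0) (h2' : β₂ * μ - 1 ≠ 0)
    (hη₁ : (β₁ - μ) * (β₁ * μ - 1) = c * μ ^ 2 * β₁ * η₁)
    (hη₂ : (β₂ - μ) * (β₂ * μ - 1) = c * μ ^ 2 * β₂ * η₂)
    (ht : t ≠ 0) (hta : ta ≠ 0) (htb : tb ≠ 0) (htabm : tabm ≠ 0)
    (hg₁ : g₁ = (β₁ * μ - 1) * (tam * tm) / ((μ ^ 2 - 1) * (ta * t)))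
    (hg₂ : g₂ = (β₂ * μ - 1) * (tbm * tm) / ((μ ^ 2 - 1) * (tb * t)))
    (F : (β₁ - β₂) * μ * (tabm * t) - (β₁ - μ) * β₂ * (ta * tbm) + β₁ * (β₂ - μ) * (tam * tb) = 0)
    (F' : -(β₁ - β₂) * (nab * tm) + (β₁ - μ) * (na * tb) -
      (β₂ - μ) * (ta * nb) = 0) :
    (η₁ * g₂ - η₂ * g₁) * ((c * μ ^ 2 / (μ ^ 2 - 1) * P) *
        (e * ((1 - (μ ^ 2)⁻¹) / (1 - μ⁻¹ * β₂⁻¹)) * ((1 - (μ ^ 2)⁻¹) / (1 - μ⁻¹ * β₁⁻¹))) *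
        (nab / tabm)) -
      η₁ * ((c * μ ^ 2 / (μ ^ 2 - 1) * P) * (e * ((1 - (μ ^ 2)⁻¹) / (1 - μ⁻¹ * β₁⁻¹))) *
        (na / ta)) +
      η₂ * ((c * μ ^ 2 / (μ ^ 2 - 1) * P) * (e * ((1 - (μ ^ 2)⁻¹) / (1 - μ⁻¹ * β₂⁻¹))) *
        (nb / tb)) = 0 := by
  -- As for the positive shifts, `F` produces the factor `tabm` that cancels the denominator of the
  -- doubly shifted `u`.
  have hG : η₁ * g₂ - η₂ * g₁ = (β₁ * μ - 1) * (β₂ * μ - 1) * (β₁ - β₂) /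
      (c * μ * (μ ^ 2 - 1) * β₁ * β₂) * (tabm * tm / (ta * tb)) := by
    rw [hg₁, hg₂, eq_div_of_beta_relation hμ hc h1 hη₁, eq_div_of_beta_relation hμ hc h2 hη₂]
    linear_combination (norm := (field_simp; ring)) (-((β₁ * μ - 1) * (β₂ * μ - 1) * tm /
        (c * μ ^ 2 * (μ ^ 2 - 1) * t * (β₁ * β₂ * ta * tb)))) * F
  rw [hG, negWeight_eq hμ h1, negWeight_eq hμ h2, eq_div_of_beta_relation hμ hc h1 hη₁,
    eq_div_of_beta_relation hμ hc h2 hη₂]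
  generalize β₁ * μ - 1 = D₁ at *
  generalize β₂ * μ - 1 = D₂ at *
  linear_combination (norm := (field_simp; ring)) (-(P * e / (μ * ta * tb))) * F'

theorem neg_v_scalar (hμ : μ ≠ 0) (hμ₁ : μ ^ 2 - 1 ≠ 0) (hc : c ≠ 0)
    {η₁ η₂ β₁ β₂ e t ta tb tam tbm tabm tabmm li lami lbmi g₁ g₂ : ℂ} (he : e ≠ 0)
    (h1 : β₁ ≠ 0) (h2 : β₂ ≠ 0)
    (hη₁ : (β₁ - μ) * (β₁ * μ - 1) = c * μ ^ 2 * β₁ * η₁)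
    (hη₂ : (β₂ - μ) * (β₂ * μ - 1) = c * μ ^ 2 * β₂ * η₂)
    (ht : t ≠ 0) (htam : tam ≠ 0) (htbm : tbm ≠ 0) (htabm : tabm ≠ 0)
    (hg₂ : g₂ = (β₂ * μ - 1) * (tabmm * ta) / ((μ ^ 2 - 1) * (tabm * tam)))
    (hg₁ : g₁ = (β₁ * μ - 1) * (tabmm * tb) / ((μ ^ 2 - 1) * (tabm * tbm)))
    (F : (β₁ - β₂) * μ * (tabm * t) - (β₁ - μ) * β₂ * (ta * tbm) + β₁ * (β₂ - μ) * (tam * tb) = 0)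
    (F' : -(β₁ - β₂) * (tabmm * li) + (β₁ - μ) * (tam * lbmi) -
      (β₂ - μ) * (lami * tbm) = 0) :
    (η₁ * g₂ - η₂ * g₁) * ((c * μ ^ 2 / (μ ^ 2 - 1) * Q) * e⁻¹ * (li / t)) -
      η₁ * ((c * μ ^ 2 / (μ ^ 2 - 1) * Q) * (e * ((1 - (μ ^ 2)⁻¹) / (1 - μ⁻¹ * β₂⁻¹)))⁻¹ *
        (lbmi / tbm)) +
      η₂ * ((c * μ ^ 2 / (μ ^ 2 - 1) * Q) * (e * ((1 - (μ ^ 2)⁻¹) / (1 - μ⁻¹ * β₁⁻¹)))⁻¹ *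
        (lami / tam)) = 0 := by
  have hG : η₁ * g₂ - η₂ * g₁ = (β₁ * μ - 1) * (β₂ * μ - 1) * (β₁ - β₂) /
      (c * μ * (μ ^ 2 - 1) * β₁ * β₂) * (tabmm * t / (tam * tbm)) := by
    rw [hg₁, hg₂, eq_div_of_beta_relation hμ hc h1 hη₁, eq_div_of_beta_relation hμ hc h2 hη₂]
    linear_combination (norm := (field_simp; ring)) (-((β₁ * μ - 1) * (β₂ * μ - 1) * tabmm /
        (c * μ ^ 2 * (μ ^ 2 - 1) * (β₁ * β₂ * tabm * tam * tbm)))) * F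
  rw [hG, negWeight_eq hμ h1, negWeight_eq hμ h2, eq_div_of_beta_relation hμ hc h1 hη₁,
    eq_div_of_beta_relation hμ hc h2 hη₂]
  linear_combination (norm := (field_simp; ring)) (-(Q * e⁻¹ * μ * (β₁ * μ - 1) * (β₂ * μ - 1) /
      ((μ ^ 2 - 1) ^ 2 * (β₁ * β₂ * tam * tbm)))) * F'

end Scalar

/-! ### The soliton τ function and the Fay identities used by the hierarchy. -/

section Tau

variable {N : ℕ} {θ : Fin N → ℝ}

/-- The `N`-soliton tau function with exponentials `X`. -/
noncomputable def solitonTau (θ : Fin N → ℝ) (X : Fin N → ℂ) : ℂ :=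
  Matrix.det (Matrix.of fun m n : Fin N =>
    (if m = n then (1 : ℂ) else 0) + X n / (Real.sin ((θ m + θ n) / 2) : ℂ))

theorem solitonTau_eq_det (Y s : Fin N → ℂ) :
    solitonTau θ (Y * s) = (1 + Matrix.of (fun m n : Fin N =>
      Y n / (Real.sin ((θ m + θ n) / 2) : ℂ)) * Matrix.diagonal s).det := by
  rw [solitonTau]
  congr 1
  ext m n
  rw [Matrix.add_apply, Matrix.mul_diagonal, Matrix.one_apply, Matrix.of_apply, Matrix.of_apply,
    Pi.mul_apply]
  ring

theorem sin_half_add_eq (θ : Fin N → ℝ) (m n : Fin N) :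
    (Real.sin ((θ m + θ n) / 2) : ℂ) * (2 * Complex.I) =
      Complex.exp (Complex.I * θ m / 2) * Complex.exp (-Complex.I * θ n / 2) *
        (expPos θ n - expNeg θ m) := by
  have h1 : Complex.exp (Complex.I * θ m / 2) * Complex.exp (-Complex.I * θ n / 2) * expPos θ n =
      Complex.exp (((θ m + θ n) / 2 : ℂ) * Complex.I) := by
    rw [expPos, ← Complex.exp_add, ← Complex.exp_add]
    congr 1
    ring
  have h2 : Complex.exp (Complex.I * θ m / 2) * Complex.exp (-Complex.I * θ n / 2) * expNeg θ m =
      Complex.exp (-((θ m + θ n) / 2 : ℂ) * Complex.I) := by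
    rw [expNeg, ← Complex.exp_add, ← Complex.exp_add]
    congr 1
    ring
  rw [mul_sub, h1, h2, Complex.ofReal_sin, Complex.sin]
  push_cast
  have hI := Complex.I_mul_I
  linear_combination (Complex.exp (-((θ m + θ n) / 2 : ℂ) * Complex.I) -
    Complex.exp (((θ m + θ n) / 2 : ℂ) * Complex.I)) * hI

/-- The factorization `sin_half_add_eq` supplies the displacement equation. The six arguments are
left free, with the products only required pointwise, so that each application can keep the form in
which the exponentials occur. -/
theorem solitonTau_fay (hθ : ∀ m n, Real.sin ((θ m + θ n) / 2) ≠ 0) (Y : Fin N → ℂ)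
    (a b c d : ℂ × ℂ) (ha : ‖a.1‖ ≠ ‖a.2‖) (hb : ‖b.1‖ ≠ ‖b.2‖) (hc : ‖c.1‖ ≠ ‖c.2‖)
    (hd : ‖d.1‖ ≠ ‖d.2‖) (Xab Xcd Xac Xbd Xad Xbc : Fin N → ℂ)
    (h : ∀ n, Xab n = Y n * (weight θ a n * weight θ b n) ∧
      Xcd n = Y n * (weight θ c n * weight θ d n) ∧ Xac n = Y n * (weight θ a n * weight θ c n) ∧
      Xbd n = Y n * (weight θ b n * weight θ d n) ∧ Xad n = Y n * (weight θ a n * weight θ d n) ∧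
      Xbc n = Y n * (weight θ b n * weight θ c n)) :
    bracket a b * bracket c d * (solitonTau θ Xab * solitonTau θ Xcd) -
      bracket a c * bracket b d * (solitonTau θ Xac * solitonTau θ Xbd) +
      bracket a d * bracket b c * (solitonTau θ Xad * solitonTau θ Xbc) = 0 := by
  have hA : ∀ m n, (Matrix.of (fun m n : Fin N => Y n / (Real.sin ((θ m + θ n) / 2) : ℂ))) m n *
      (expPos θ n - expNeg θ m) = Complex.exp (-(Complex.I * θ m / 2)) *
        (Y n * (2 * Complex.I) * Complex.exp (-(-Complex.I * θ n / 2))) := by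
    intro m n
    have hs : (Real.sin ((θ m + θ n) / 2) : ℂ) ≠ 0 := by exact_mod_cast hθ m n
    have h1 := sin_half_add_eq θ m n
    have h2 := Complex.exp_ne_zero (Complex.I * θ m / 2)
    have h3 := Complex.exp_ne_zero (-Complex.I * θ n / 2)
    rw [Matrix.of_apply, Complex.exp_neg, Complex.exp_neg]
    generalize Complex.exp (Complex.I * θ m / 2) = E₁ at *
    generalize Complex.exp (-Complex.I * θ n / 2) = E₂ at *
    field_simp
    linear_combination (-Y n) * h1
  have hp : ∀ {a : ℂ × ℂ}, ‖a.1‖ ≠ ‖a.2‖ → ∀ n, lin a (expPos θ n) ≠ 0 := fun h n =>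
    lin_ne_zero_of_norm_ne (norm_expPos θ n) h
  have hq : ∀ {a : ℂ × ℂ}, ‖a.1‖ ≠ ‖a.2‖ → ∀ n, lin a (expNeg θ n) ≠ 0 := fun h n =>
    lin_ne_zero_of_norm_ne (norm_expNeg θ n) h
  have key := fay_identity hA a b c d (hp ha) (hq ha) (hp hb) (hq hb) (hp hc) (hq hc)
    (hp hd) (hq hd) (fun s => solitonTau θ (Y * s)) (fun s => solitonTau_eq_det Y s)
  have e1 : Xab = Y * (weight θ a * weight θ b) := funext fun n => (h n).1
  have e2 : Xcd = Y * (weight θ c * weight θ d) := funext fun n => (h n).2.1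
  have e3 : Xac = Y * (weight θ a * weight θ c) := funext fun n => (h n).2.2.1
  have e4 : Xbd = Y * (weight θ b * weight θ d) := funext fun n => (h n).2.2.2.1
  have e5 : Xad = Y * (weight θ a * weight θ d) := funext fun n => (h n).2.2.2.2.1
  have e6 : Xbc = Y * (weight θ b * weight θ c) := funext fun n => (h n).2.2.2.2.2
  rw [e1, e2, e3, e4, e5, e6]
  exact key

theorem weight_zero (θ : Fin N → ℝ) : weight θ (0, 1) = 1 := by
  funext n
  simp [weight_apply, lin]

/-- Since `q = p⁻¹`, the weights of `μ` and `1/μ` multiply to `p⁻²`, independently of `μ`. This lets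
the point at infinity account for the factor M J. -/
theorem weight_infty (θ : Fin N → ℝ) {μ : ℂ} (hμ : ‖μ‖ ≠ 1) :
    weight θ (1, 0) = weight θ (μ, 1) * weight θ (1, μ) := by
  funext n
  have h1 := lin_ne_zero_of_norm_ne (a := (μ, 1)) (norm_expPos θ n) (by simpa using hμ)
  have h2 := lin_ne_zero_of_norm_ne (a := (1, μ)) (norm_expPos θ n) (by simpa using hμ.symm)
  have h3 := lin_ne_zero_of_norm_ne (a := (1, 0)) (norm_expPos θ n) (by simp)
  have h := expPos_mul_expNeg θ n
  rw [Pi.mul_apply, weight_apply, weight_apply, weight_apply, div_mul_div_comm,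
    div_eq_div_iff h3 (mul_ne_zero h1 h2)]
  simp only [lin]
  generalize expPos θ n = p at *
  generalize expNeg θ n = q at *
  linear_combination (-(μ * (p - q))) * h

theorem weights_ne_zero {μ : ℂ} (hμ : ‖μ‖ ≠ 1) {M J : Fin N → ℂ} (hM : M = weight θ (μ, 1))
    (hJ : J = weight θ (1, μ)) (n : Fin N) : M n ≠ 0 ∧ J n ≠ 0 :=
  ⟨by rw [hM]; exact weight_ne_zero θ (by simpa using hμ) n,
    by rw [hJ]; exact weight_ne_zero θ (by simpa using hμ.symm) n⟩

/-- Each of the following identities is determined by four points and a base `Y`, chosen so that all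
six pairwise products are the required arguments. Here the points are 1/μ, 0, α, ∞. -/
theorem solitonTau_bigG (hθ : ∀ m n, Real.sin ((θ m + θ n) / 2) ≠ 0) {μ : ℂ} (hμ : ‖μ‖ ≠ 1)
    {M J : Fin N → ℂ} (hM : M = weight θ (μ, 1)) (hJ : J = weight θ (1, μ))
    {α : ℂ} (hα : ‖α‖ ≠ 1) {A : Fin N → ℂ} (hA : A = weight θ (α, 1))
    (X : Fin N → ℂ) :
    solitonTau θ X * solitonTau θ (X * A * M) = -(α * μ - 1) * (solitonTau θ (X * A) *
      solitonTau θ (X * M)) + μ * α * (solitonTau θ (X * (M * J)) * solitonTau θ (X * A / J)) := by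
  have h := solitonTau_fay hθ (X / J) (1, μ) (0, 1) (α, 1) (1, 0) (by simpa using hμ.symm)
    (by simp) (by simpa using hα) (by simp)
    X (X * A * M) (X * A) (X * M) (X * (M * J)) (X * A / J) (by
      intro n
      obtain ⟨hMn, hJn⟩ := weights_ne_zero hμ hM hJ n
      simp only [weight_zero, weight_infty θ hμ, ← hA, ← hM, ← hJ, Pi.mul_apply,
        Pi.div_apply, Pi.one_apply]
      refine ⟨?_, ?_, ?_, ?_, ?_, ?_⟩ <;> field_simp)
  simp only [bracket] at h
  linear_combination -h

theorem solitonTau_pos (hθ : ∀ m n, Real.sin ((θ m + θ n) / 2) ≠ 0) {μ : ℂ} (hμ : ‖μ‖ ≠ 1)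
    {M : Fin N → ℂ} (hM : M = weight θ (μ, 1))
    {α₁ α₂ : ℂ} (hα₁ : ‖α₁‖ ≠ 1) (hα₂ : ‖α₂‖ ≠ 1)
    {A₁ A₂ : Fin N → ℂ} (hA₁ : A₁ = weight θ (α₁, 1)) (hA₂ : A₂ = weight θ (α₂, 1))
    (X : Fin N → ℂ) :
    (α₁ - α₂) * μ * (solitonTau θ (X * A₂ * A₁) * solitonTau θ (X * M)) - (α₁ - μ) * α₂ *
      (solitonTau θ (X * A₁ * M) * solitonTau θ (X * A₂)) + α₁ * (α₂ - μ) *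
      (solitonTau θ (X * A₁) * solitonTau θ (X * A₂ * M)) = 0 := by
  have h := solitonTau_fay hθ X (α₁, 1) (α₂, 1) (μ, 1) (0, 1) (by simpa using hα₁)
    (by simpa using hα₂) (by simpa using hμ) (by simp)
    (X * A₂ * A₁) (X * M) (X * A₁ * M) (X * A₂) (X * A₁) (X * A₂ * M) (by
      intro n
      simp only [weight_zero, ← hA₁, ← hA₂, ← hM, Pi.mul_apply, Pi.one_apply]
      refine ⟨?_, ?_, ?_, ?_, ?_, ?_⟩ <;> first | trivial | ring)
  simp only [bracket] at h
  linear_combination h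

theorem solitonTau_pos_U (hθ : ∀ m n, Real.sin ((θ m + θ n) / 2) ≠ 0) {μ : ℂ} (hμ : ‖μ‖ ≠ 1)
    {M J : Fin N → ℂ} (hM : M = weight θ (μ, 1)) (hJ : J = weight θ (1, μ))
    {α₁ α₂ : ℂ} (hα₁ : ‖α₁‖ ≠ 1) (hα₂ : ‖α₂‖ ≠ 1)
    {A₁ A₂ : Fin N → ℂ} (hA₁ : A₁ = weight θ (α₁, 1)) (hA₂ : A₂ = weight θ (α₂, 1))
    (X : Fin N → ℂ) :
    (α₁ - α₂) * (solitonTau θ (X * A₂ * A₁ / J) * solitonTau θ X) - (α₁ * μ - 1) * α₂ *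
      (solitonTau θ (X * A₁) * solitonTau θ (X * A₂ / J)) + α₁ * (α₂ * μ - 1) *
      (solitonTau θ (X * A₁ / J) * solitonTau θ (X * A₂)) = 0 := by
  have h := solitonTau_fay hθ (X / J) (α₁, 1) (α₂, 1) (1, μ) (0, 1) (by simpa using hα₁)
    (by simpa using hα₂) (by simpa using hμ.symm) (by simp)
    (X * A₂ * A₁ / J) X (X * A₁) (X * A₂ / J) (X * A₁ / J) (X * A₂) (by
      intro n
      obtain ⟨hMn, hJn⟩ := weights_ne_zero hμ hM hJ n
      simp only [weight_zero, ← hA₁, ← hA₂, ← hJ, Pi.mul_apply, Pi.div_apply, Pi.one_apply]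
      refine ⟨?_, ?_, ?_, ?_, ?_, ?_⟩ <;> field_simp)
  simp only [bracket] at h
  linear_combination h

/-- The four points are those of `solitonTau_pos_U`; only the base moves, from X / J to X M. The
other identities for `V` and `v` arise from those for `U` and `u` in the same way. -/
theorem solitonTau_pos_V (hθ : ∀ m n, Real.sin ((θ m + θ n) / 2) ≠ 0) {μ : ℂ} (hμ : ‖μ‖ ≠ 1)
    {M J : Fin N → ℂ} (hJ : J = weight θ (1, μ))
    {α₁ α₂ : ℂ} (hα₁ : ‖α₁‖ ≠ 1) (hα₂ : ‖α₂‖ ≠ 1)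
    {A₁ A₂ : Fin N → ℂ} (hA₁ : A₁ = weight θ (α₁, 1)) (hA₂ : A₂ = weight θ (α₂, 1))
    (X : Fin N → ℂ) :
    (α₁ - α₂) * (solitonTau θ (X * A₂ * A₁ * M) * solitonTau θ (X * (M * J))) - (α₁ * μ - 1) *
      α₂ * (solitonTau θ (X * A₁ * (M * J)) * solitonTau θ (X * A₂ * M)) + α₁ * (α₂ * μ - 1) *
      (solitonTau θ (X * A₁ * M) * solitonTau θ (X * A₂ * (M * J))) = 0 := by
  have h := solitonTau_fay hθ (X * M) (α₁, 1) (α₂, 1) (1, μ) (0, 1) (by simpa using hα₁)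
    (by simpa using hα₂) (by simpa using hμ.symm) (by simp)
    (X * A₂ * A₁ * M) (X * (M * J)) (X * A₁ * (M * J)) (X * A₂ * M) (X * A₁ * M) (X * A₂ * (M * J)) (by
      intro n
      simp only [weight_zero, ← hA₁, ← hA₂, ← hJ, Pi.mul_apply, Pi.one_apply]
      refine ⟨?_, ?_, ?_, ?_, ?_, ?_⟩ <;> first | trivial | ring)
  simp only [bracket] at h
  linear_combination h

theorem solitonTau_mixed_u (hθ : ∀ m n, Real.sin ((θ m + θ n) / 2) ≠ 0) {μ : ℂ} (hμ : ‖μ‖ ≠ 1)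
    {M J : Fin N → ℂ} (hM : M = weight θ (μ, 1)) (hJ : J = weight θ (1, μ))
    {α : ℂ} (hα : ‖α‖ ≠ 1) {A : Fin N → ℂ} (hA : A = weight θ (α, 1))
    (X : Fin N → ℂ) :
    -(μ - α) * (solitonTau θ (X * A * M / J) * solitonTau θ X) - μ * (α * μ - 1) *
      (solitonTau θ (X * M / J) * solitonTau θ (X * A)) + (μ ^ 2 - 1) * α *
      (solitonTau θ (X * M) * solitonTau θ (X * A / J)) = 0 := by
  have h := solitonTau_fay hθ (X / J) (μ, 1) (α, 1) (0, 1) (1, μ) (by simpa using hμ)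
    (by simpa using hα) (by simp) (by simpa using hμ.symm)
    (X * A * M / J) X (X * M / J) (X * A) (X * M) (X * A / J) (by
      intro n
      obtain ⟨hMn, hJn⟩ := weights_ne_zero hμ hM hJ n
      simp only [weight_zero, ← hA, ← hM, ← hJ, Pi.mul_apply, Pi.div_apply, Pi.one_apply]
      refine ⟨?_, ?_, ?_, ?_, ?_, ?_⟩ <;> field_simp)
  simp only [bracket] at h
  linear_combination h

theorem solitonTau_mixed_v (hθ : ∀ m n, Real.sin ((θ m + θ n) / 2) ≠ 0) {μ : ℂ} (hμ : ‖μ‖ ≠ 1)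
    {M J : Fin N → ℂ} (hM : M = weight θ (μ, 1)) (hJ : J = weight θ (1, μ))
    {α : ℂ} (hα : ‖α‖ ≠ 1) {A : Fin N → ℂ} (hA : A = weight θ (α, 1))
    (X : Fin N → ℂ) :
    -(μ - α) * (solitonTau θ (X * A * M) * solitonTau θ (X * J)) - μ * (α * μ - 1) *
      (solitonTau θ (X * M) * solitonTau θ (X * A * J)) + (μ ^ 2 - 1) * α *
      (solitonTau θ (X * (M * J)) * solitonTau θ (X * A)) = 0 := by
  have h := solitonTau_fay hθ X (μ, 1) (α, 1) (0, 1) (1, μ) (by simpa using hμ)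
    (by simpa using hα) (by simp) (by simpa using hμ.symm)
    (X * A * M) (X * J) (X * M) (X * A * J) (X * (M * J)) (X * A) (by
      intro n
      simp only [weight_zero, ← hA, ← hM, ← hJ, Pi.mul_apply, Pi.one_apply]
      refine ⟨?_, ?_, ?_, ?_, ?_, ?_⟩ <;> first | trivial | ring)
  simp only [bracket] at h
  linear_combination h

theorem solitonTau_smallG (hθ : ∀ m n, Real.sin ((θ m + θ n) / 2) ≠ 0) {μ : ℂ} (hμ : ‖μ‖ ≠ 1)
    {M J : Fin N → ℂ} (hM : M = weight θ (μ, 1)) (hJ : J = weight θ (1, μ))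
    {α : ℂ} (hα : ‖α‖ ≠ 1) {A : Fin N → ℂ} (hA : A = weight θ (α, 1))
    (X : Fin N → ℂ) :
    (μ ^ 2 - 1) * (solitonTau θ (X * A / M * M) * solitonTau θ X) + μ * (α - μ) *
      (solitonTau θ (X * A / M * M / J) * solitonTau θ (X * J)) = (α * μ - 1) *
      (solitonTau θ (X * A / M) * solitonTau θ (X * M)) := by
  have h := solitonTau_fay hθ (X / (M * J)) (α, 1) (1, μ) (1, 0) (μ, 1) (by simpa using hα)
    (by simpa using hμ.symm) (by simp) (by simpa using hμ)
    (X * A / M) (X * M) (X * A / M * M) X (X * A / M * M / J) (X * J) (by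
      intro n
      obtain ⟨hMn, hJn⟩ := weights_ne_zero hμ hM hJ n
      simp only [weight_infty θ hμ, ← hA, ← hM, ← hJ, Pi.mul_apply, Pi.div_apply]
      refine ⟨?_, ?_, ?_, ?_, ?_, ?_⟩ <;> field_simp)
  simp only [bracket] at h
  linear_combination -h

theorem solitonTau_mixed_U (hθ : ∀ m n, Real.sin ((θ m + θ n) / 2) ≠ 0) {μ : ℂ} (hμ : ‖μ‖ ≠ 1)
    {M J : Fin N → ℂ} (hM : M = weight θ (μ, 1)) (hJ : J = weight θ (1, μ))
    {α : ℂ} (hα : ‖α‖ ≠ 1) {A : Fin N → ℂ} (hA : A = weight θ (α, 1))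
    (X : Fin N → ℂ) :
    μ * (solitonTau θ (X / J) * solitonTau θ (X * A / M * M)) - α * (solitonTau θ (X * M) *
      solitonTau θ (X * A / M / J)) - (μ - α) * (solitonTau θ (X * A / M * M / J) *
      solitonTau θ X) = 0 := by
  have h := solitonTau_fay hθ (X / (M * J)) (μ, 1) (0, 1) (1, 0) (α, 1) (by simpa using hμ)
    (by simp) (by simp) (by simpa using hα)
    (X / J) (X * A / M * M) (X * M) (X * A / M / J) (X * A / M * M / J) X (by
      intro n
      obtain ⟨hMn, hJn⟩ := weights_ne_zero hμ hM hJ n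
      simp only [weight_zero, weight_infty θ hμ, ← hA, ← hM, ← hJ, Pi.mul_apply,
        Pi.div_apply, Pi.one_apply]
      refine ⟨?_, ?_, ?_, ?_, ?_, ?_⟩ <;> field_simp)
  simp only [bracket] at h
  linear_combination h

theorem solitonTau_mixed_V (hθ : ∀ m n, Real.sin ((θ m + θ n) / 2) ≠ 0) {μ : ℂ} (hμ : ‖μ‖ ≠ 1)
    {M J : Fin N → ℂ} (hM : M = weight θ (μ, 1)) (hJ : J = weight θ (1, μ))
    {α : ℂ} (hα : ‖α‖ ≠ 1) {A : Fin N → ℂ} (hA : A = weight θ (α, 1))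
    (X : Fin N → ℂ) :
    μ * (solitonTau θ X * solitonTau θ (X * A / M * (M * J))) - α * (solitonTau θ (X * (M * J))
      * solitonTau θ (X * A / M)) - (μ - α) * (solitonTau θ (X * A / M * M) *
      solitonTau θ (X * J)) = 0 := by
  have h := solitonTau_fay hθ (X / M) (μ, 1) (0, 1) (1, 0) (α, 1) (by simpa using hμ)
    (by simp) (by simp) (by simpa using hα)
    X (X * A / M * (M * J)) (X * (M * J)) (X * A / M) (X * A / M * M) (X * J) (by
      intro n
      obtain ⟨hMn, hJn⟩ := weights_ne_zero hμ hM hJ n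
      simp only [weight_zero, weight_infty θ hμ, ← hA, ← hM, ← hJ, Pi.mul_apply,
        Pi.div_apply, Pi.one_apply]
      refine ⟨?_, ?_, ?_, ?_, ?_, ?_⟩ <;> field_simp)
  simp only [bracket] at h
  linear_combination h

theorem solitonTau_neg (hθ : ∀ m n, Real.sin ((θ m + θ n) / 2) ≠ 0) {μ : ℂ} (hμ : ‖μ‖ ≠ 1)
    {M : Fin N → ℂ} (hM : M = weight θ (μ, 1))
    {α₁ α₂ : ℂ} (hα₁ : ‖α₁‖ ≠ 1) (hα₂ : ‖α₂‖ ≠ 1)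
    {A₁ A₂ : Fin N → ℂ} (hA₁ : A₁ = weight θ (α₁, 1)) (hA₂ : A₂ = weight θ (α₂, 1))
    (X : Fin N → ℂ) :
    (α₁ - α₂) * μ * (solitonTau θ (X * A₂ / M * A₁ / M * M) * solitonTau θ X) - (α₁ - μ) * α₂ *
      (solitonTau θ (X * A₁ / M * M) * solitonTau θ (X * A₂ / M)) + α₁ * (α₂ - μ) *
      (solitonTau θ (X * A₁ / M) * solitonTau θ (X * A₂ / M * M)) = 0 := by
  have h := solitonTau_fay hθ (X / M) (α₁, 1) (α₂, 1) (μ, 1) (0, 1) (by simpa using hα₁)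
    (by simpa using hα₂) (by simpa using hμ) (by simp)
    (X * A₂ / M * A₁ / M * M) X (X * A₁ / M * M) (X * A₂ / M) (X * A₁ / M) (X * A₂ / M * M) (by
      intro n
      have hMn := (weights_ne_zero hμ hM rfl n).1
      simp only [weight_zero, ← hA₁, ← hA₂, ← hM, Pi.mul_apply, Pi.div_apply, Pi.one_apply]
      refine ⟨?_, ?_, ?_, ?_, ?_, ?_⟩ <;> field_simp)
  simp only [bracket] at h
  linear_combination h

theorem solitonTau_neg_u (hθ : ∀ m n, Real.sin ((θ m + θ n) / 2) ≠ 0) {μ : ℂ} (hμ : ‖μ‖ ≠ 1)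
    {M J : Fin N → ℂ} (hM : M = weight θ (μ, 1)) (hJ : J = weight θ (1, μ))
    {α₁ α₂ : ℂ} (hα₁ : ‖α₁‖ ≠ 1) (hα₂ : ‖α₂‖ ≠ 1)
    {A₁ A₂ : Fin N → ℂ} (hA₁ : A₁ = weight θ (α₁, 1)) (hA₂ : A₂ = weight θ (α₂, 1))
    (X : Fin N → ℂ) :
    -(α₁ - α₂) * (solitonTau θ (X * A₂ / M * A₁ / M * M / J) * solitonTau θ (X * M)) + (α₁ - μ)
      * (solitonTau θ (X * A₁ / M * M / J) * solitonTau θ (X * A₂ / M * M)) - (α₂ - μ) *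
      (solitonTau θ (X * A₁ / M * M) * solitonTau θ (X * A₂ / M * M / J)) = 0 := by
  have h := solitonTau_fay hθ (X / (M * J)) (α₁, 1) (α₂, 1) (μ, 1) (1, 0) (by simpa using hα₁)
    (by simpa using hα₂) (by simpa using hμ) (by simp)
    (X * A₂ / M * A₁ / M * M / J) (X * M) (X * A₁ / M * M / J) (X * A₂ / M * M)
    (X * A₁ / M * M) (X * A₂ / M * M / J) (by
      intro n
      obtain ⟨hMn, hJn⟩ := weights_ne_zero hμ hM hJ n
      simp only [weight_infty θ hμ, ← hA₁, ← hA₂, ← hM, ← hJ, Pi.mul_apply, Pi.div_apply]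
      refine ⟨?_, ?_, ?_, ?_, ?_, ?_⟩ <;> field_simp)
  simp only [bracket] at h
  linear_combination h

theorem solitonTau_neg_v (hθ : ∀ m n, Real.sin ((θ m + θ n) / 2) ≠ 0) {μ : ℂ} (hμ : ‖μ‖ ≠ 1)
    {M J : Fin N → ℂ} (hM : M = weight θ (μ, 1)) (hJ : J = weight θ (1, μ))
    {α₁ α₂ : ℂ} (hα₁ : ‖α₁‖ ≠ 1) (hα₂ : ‖α₂‖ ≠ 1)
    {A₁ A₂ : Fin N → ℂ} (hA₁ : A₁ = weight θ (α₁, 1)) (hA₂ : A₂ = weight θ (α₂, 1))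
    (X : Fin N → ℂ) :
    -(α₁ - α₂) * (solitonTau θ (X * A₂ / M * A₁ / M) * solitonTau θ (X * J)) + (α₁ - μ) *
      (solitonTau θ (X * A₁ / M) * solitonTau θ (X * A₂ / M * J)) - (α₂ - μ) *
      (solitonTau θ (X * A₁ / M * J) * solitonTau θ (X * A₂ / M)) = 0 := by
  have h := solitonTau_fay hθ (X / (M * M)) (α₁, 1) (α₂, 1) (μ, 1) (1, 0) (by simpa using hα₁)
    (by simpa using hα₂) (by simpa using hμ) (by simp)
    (X * A₂ / M * A₁ / M) (X * J) (X * A₁ / M) (X * A₂ / M * J) (X * A₁ / M * J) (X * A₂ / M) (by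
      intro n
      obtain ⟨hMn, hJn⟩ := weights_ne_zero hμ hM hJ n
      simp only [weight_infty θ hμ, ← hA₁, ← hA₂, ← hM, ← hJ, Pi.mul_apply, Pi.div_apply]
      refine ⟨?_, ?_, ?_, ?_, ?_, ?_⟩ <;> field_simp)
  simp only [bracket] at h
  linear_combination h

end Tau

/-! ### The soliton functions in terms of τ, their reflections and their shifts. -/

section Solution

variable {N : ℕ} {μ c : ℝ} {U₀ : ℂ} {θ C : Fin N → ℝ} {d : Dispersion N}

/-- The exponentials of the tau function `Δ₂`. -/
noncomputable def solitonExp (μ : ℝ) (θ C : Fin N → ℝ) (d : Dispersion N) (p : Times) :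
    Fin N → ℂ :=
  fun n => (C n : ℂ) * Complex.exp (solitonPhase d n p + Complex.I * gammaTwo μ θ n)

/-- The plane wave `e^{iφ}`. -/
noncomputable def planeWave (d : Dispersion N) (p : Times) : ℂ :=
  Complex.exp (Complex.I * phase d p)

theorem planeWave_ne_zero (d : Dispersion N) (p : Times) : planeWave d p ≠ 0 :=
  Complex.exp_ne_zero _

theorem deltaTwo_eq (p : Times) : deltaTwo μ θ C d p = solitonTau θ (solitonExp μ θ C d p) := rfl

theorem exp_I_mul_two_gammaTwo (hμ : |μ| ≠ 1) (n : Fin N) :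
    Complex.exp (Complex.I * ((2 * gammaTwo μ θ n : ℝ) : ℂ)) * weight θ ((μ : ℂ), 1) n = 1 := by
  have h1 : (1 : ℂ) - μ * expPos θ n ≠ 0 :=
    lin_ne_zero_of_norm_ne (a := ((μ : ℂ), 1)) (norm_expPos θ n) (by simpa using hμ)
  have h2 : (1 : ℂ) - μ * expNeg θ n ≠ 0 :=
    lin_ne_zero_of_norm_ne (a := ((μ : ℂ), 1)) (norm_expNeg θ n) (by simpa using hμ)
  have h := exp_I_mul_two_arg _ h1
  rw [map_sub, map_mul, map_one, Complex.conj_ofReal, conj_expPos] at h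
  have h' : Complex.exp (Complex.I * ((2 * gammaTwo μ θ n : ℝ) : ℂ)) =
    (1 - μ * expPos θ n) / (1 - μ * expNeg θ n) := h
  rw [h', weight_apply, lin, lin]
  field_simp

theorem norm_ofReal_ne_one (hμ : |μ| ≠ 1) : ‖(μ : ℂ)‖ ≠ 1 := by simpa using hμ

/-- The quotient of the constant phase factors is `e^{2iθ} e^{-2iγ₂} = p² M`. As M J = p⁻², this
equals 1 / J. -/
theorem solitonExp_gammaOne (hμ : |μ| ≠ 1) (p : Times) (n : Fin N) :
    (C n : ℂ) * Complex.exp (solitonPhase d n p + Complex.I * gammaOne μ θ n) =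
      (solitonExp μ θ C d p / weight θ (1, (μ : ℂ))) n := by
  have hM := exp_I_mul_two_gammaTwo (θ := θ) hμ n
  have hJ := weight_ne_zero θ (a := (1, (μ : ℂ))) (by simpa using hμ.symm) n
  have hi := congrFun (weight_infty θ (norm_ofReal_ne_one hμ)) n
  rw [Pi.mul_apply, weight_apply θ (1, 0)] at hi
  simp only [lin, zero_sub, one_mul, neg_div_neg_eq] at hi
  have hp : expPos θ n ≠ 0 := Complex.exp_ne_zero _
  have hpq := expPos_mul_expNeg θ n
  rw [div_eq_iff hp] at hi
  have h1 : Complex.exp (solitonPhase d n p + Complex.I * gammaOne μ θ n) *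
      Complex.exp (Complex.I * ((2 * gammaTwo μ θ n : ℝ) : ℂ)) =
      Complex.exp (solitonPhase d n p + Complex.I * gammaTwo μ θ n) * (expPos θ n * expPos θ n) := by
    rw [expPos, ← Complex.exp_add, ← Complex.exp_add, ← Complex.exp_add]
    congr 1
    simp only [gammaOne]
    push_cast
    ring
  rw [Pi.div_apply, eq_div_iff hJ, solitonExp]
  generalize Complex.exp (Complex.I * ((2 * gammaTwo μ θ n : ℝ) : ℂ)) = g at *
  generalize Complex.exp (solitonPhase d n p + Complex.I * gammaOne μ θ n) = e₁ at *
  generalize Complex.exp (solitonPhase d n p + Complex.I * gammaTwo μ θ n) = e₂ at *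
  generalize weight θ ((μ : ℂ), 1) n = M at *
  generalize weight θ (1, (μ : ℂ)) n = J at *
  have h2 : e₁ = e₂ * (expPos θ n * expPos θ n) * M := by
    linear_combination (-e₁) * hM + M * h1
  rw [h2]
  linear_combination (-(C n) * e₂ * expPos θ n) * hi + (C n) * e₂ * hpq

theorem deltaOne_eq (hμ : |μ| ≠ 1) (p : Times) :
    deltaOne μ θ C d p = solitonTau θ (solitonExp μ θ C d p / weight θ (1, (μ : ℂ))) := by
  rw [deltaOne, solitonDet, solitonTau]
  simp only [solitonExp_gammaOne hμ]

theorem solitonU_eq (hμ : |μ| ≠ 1) (p : Times) :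
    solitonU μ U₀ θ C d p = U₀ * planeWave d p *
      (solitonTau θ (solitonExp μ θ C d p / weight θ (1, (μ : ℂ))) /
        solitonTau θ (solitonExp μ θ C d p)) := by
  rw [solitonU, deltaOne_eq hμ, deltaTwo_eq, planeWave]

section Conjugation

theorem conj_solitonTau (X : Fin N → ℂ) :
    starRingEnd ℂ (solitonTau θ X) = solitonTau θ (fun n => starRingEnd ℂ (X n)) := by
  rw [solitonTau, RingHom.map_det, solitonTau]
  congr 1
  ext m n
  simp only [RingHom.mapMatrix_apply, Matrix.map_apply, Matrix.of_apply, map_add, map_div₀,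
    Complex.conj_ofReal]
  congr 1
  split_ifs <;> simp

theorem conj_solitonPhase (p : Times) (n : Fin N) :
    starRingEnd ℂ (solitonPhase d n p.conj) = solitonPhase d n p := by
  rw [solitonPhase, solitonPhase, Complex.conj_tsum]
  simp [Times.conj]

theorem conj_phase (p : Times) : starRingEnd ℂ (phase d p.conj) = phase d p := by
  rw [phase, phase, Complex.conj_tsum]
  simp [Times.conj]

theorem conj_planeWave (p : Times) :
    starRingEnd ℂ (planeWave d p.conj) = (planeWave d p)⁻¹ := by
  rw [planeWave, planeWave, ← Complex.exp_conj, map_mul, conj_phase, Complex.conj_I,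
    ← Complex.exp_neg, neg_mul]

/-- Reflection fixes `ν_n` and reverses the sign of `γ₂`, which costs `e^{-2iγ₂} = M`. -/
theorem conj_solitonExp (hμ : |μ| ≠ 1) (p : Times) (n : Fin N) :
    starRingEnd ℂ (solitonExp μ θ C d p.conj n) =
      (solitonExp μ θ C d p * weight θ ((μ : ℂ), 1)) n := by
  have hM := exp_I_mul_two_gammaTwo (θ := θ) hμ n
  have h1 : Complex.exp (solitonPhase d n p + -Complex.I * gammaTwo μ θ n) *
      Complex.exp (Complex.I * ((2 * gammaTwo μ θ n : ℝ) : ℂ)) =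
      Complex.exp (solitonPhase d n p + Complex.I * gammaTwo μ θ n) := by
    rw [← Complex.exp_add]
    congr 1
    push_cast
    ring
  rw [Pi.mul_apply, solitonExp, solitonExp, map_mul, ← Complex.exp_conj, map_add, map_mul,
    conj_solitonPhase, Complex.conj_ofReal, Complex.conj_ofReal, Complex.conj_I]
  linear_combination (C n * weight θ ((μ : ℂ), 1) n) * h1 -
    (C n * Complex.exp (solitonPhase d n p + -Complex.I * gammaTwo μ θ n)) * hM

theorem conj_weight (x y : ℝ) (n : Fin N) :
    starRingEnd ℂ (weight θ ((x : ℂ), (y : ℂ)) n) = (weight θ ((x : ℂ), (y : ℂ)) n)⁻¹ := by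
  rw [weight_apply, map_div₀, inv_div]
  simp [lin, conj_expPos, conj_expNeg]

end Conjugation

/-- Weights of real points are inverted by conjugation, so X / J reflects to X M J. -/
theorem reflect_solitonU (hμ : |μ| ≠ 1) (p : Times) :
    reflect (solitonU μ U₀ θ C d) p = starRingEnd ℂ U₀ * (planeWave d p)⁻¹ *
      (solitonTau θ (solitonExp μ θ C d p * (weight θ ((μ : ℂ), 1) * weight θ (1, (μ : ℂ)))) /
        solitonTau θ (solitonExp μ θ C d p * weight θ ((μ : ℂ), 1))) := by
  rw [reflect, solitonU_eq hμ, map_mul, map_mul, map_div₀, conj_planeWave, conj_solitonTau,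
    conj_solitonTau]
  have h1 : (fun n => starRingEnd ℂ ((solitonExp μ θ C d p.conj / weight θ (1, (μ : ℂ))) n)) =
      solitonExp μ θ C d p * (weight θ ((μ : ℂ), 1) * weight θ (1, (μ : ℂ))) := by
    funext n
    have hJ := conj_weight (θ := θ) 1 μ n
    rw [Complex.ofReal_one] at hJ
    rw [Pi.div_apply, map_div₀, conj_solitonExp hμ, hJ, div_inv_eq_mul, ← mul_assoc]
    rfl
  have h2 : (fun n => starRingEnd ℂ (solitonExp μ θ C d p.conj n)) =
      solitonExp μ θ C d p * weight θ ((μ : ℂ), 1) := funext fun n => conj_solitonExp hμ p n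
  rw [h1, h2]

/-- The companion function `u` of the `N`-soliton function `U`. -/
noncomputable def companionU (μ c : ℝ) (U₀ : ℂ) (θ C : Fin N → ℝ) (d : Dispersion N) (p : Times) :
    ℂ :=
  (c * (μ : ℂ) ^ 2 / ((μ : ℂ) ^ 2 - 1) * U₀) * planeWave d p *
    (solitonTau θ (solitonExp μ θ C d p * weight θ ((μ : ℂ), 1) / weight θ (1, (μ : ℂ))) /
      solitonTau θ (solitonExp μ θ C d p * weight θ ((μ : ℂ), 1)))

/-- The companion function `v` of the complex conjugate of the `N`-soliton function. -/
noncomputable def companionV (μ c : ℝ) (U₀ : ℂ) (θ C : Fin N → ℝ) (d : Dispersion N) (p : Times) :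
    ℂ :=
  (c * (μ : ℂ) ^ 2 / ((μ : ℂ) ^ 2 - 1) * starRingEnd ℂ U₀) * (planeWave d p)⁻¹ *
    (solitonTau θ (solitonExp μ θ C d p * weight θ (1, (μ : ℂ))) /
      solitonTau θ (solitonExp μ θ C d p))

theorem reflect_companionU (hμ : |μ| ≠ 1) :
    reflect (companionU μ c U₀ θ C d) = companionV μ c U₀ θ C d := by
  funext p
  rw [reflect, companionU, companionV, map_mul, map_mul, map_div₀, conj_planeWave,
    conj_solitonTau, conj_solitonTau]
  have hM' : ∀ n, weight θ ((μ : ℂ), 1) n ≠ 0 := weight_ne_zero θ (by simpa using hμ)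
  have hM : ∀ n, starRingEnd ℂ (weight θ ((μ : ℂ), 1) n) = (weight θ ((μ : ℂ), 1) n)⁻¹ := by
    intro n
    have h := conj_weight (θ := θ) μ 1 n
    rwa [Complex.ofReal_one] at h
  have h2 : (fun n => starRingEnd ℂ
      ((solitonExp μ θ C d p.conj * weight θ ((μ : ℂ), 1)) n)) = solitonExp μ θ C d p := by
    funext n
    rw [Pi.mul_apply, map_mul, conj_solitonExp hμ, hM, Pi.mul_apply,
      mul_inv_cancel_right₀ (hM' n)]
  have h1 : (fun n => starRingEnd ℂ ((solitonExp μ θ C d p.conj * weight θ ((μ : ℂ), 1) /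
      weight θ (1, (μ : ℂ))) n)) = solitonExp μ θ C d p * weight θ (1, (μ : ℂ)) := by
    funext n
    have hJ := conj_weight (θ := θ) 1 μ n
    rw [Complex.ofReal_one] at hJ
    have h2n : starRingEnd ℂ ((solitonExp μ θ C d p.conj * weight θ ((μ : ℂ), 1)) n) =
      solitonExp μ θ C d p n := congrFun h2 n
    rw [Pi.div_apply, map_div₀, hJ, div_inv_eq_mul, h2n]
    rfl
  rw [h1, h2]
  simp

/-- `companionV` shares the denominator τ(X) with `U`, and `companionU` shares τ(X M) with `V`.
Hence all four functions are regular on this domain. -/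
theorem mem_regularDomain_iff (hμ : |μ| ≠ 1) (p : Times) :
    p ∈ regularDomain μ θ C d ↔ p ∈ convergenceDomain d ∧
      solitonTau θ (solitonExp μ θ C d p) ≠ 0 ∧
      solitonTau θ (solitonExp μ θ C d p * weight θ ((μ : ℂ), 1)) ≠ 0 := by
  have h2 : (fun n => starRingEnd ℂ (solitonExp μ θ C d p.conj n)) =
      solitonExp μ θ C d p * weight θ ((μ : ℂ), 1) := funext fun n => conj_solitonExp hμ p n
  rw [← h2, ← conj_solitonTau, ← deltaTwo_eq, ← deltaTwo_eq, map_ne_zero]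
  rfl

/-- The relation between the parameter `ξ` of a positive Miwa shift and `α = α(ξ)`, with the effect of
the shift on the phases. -/
structure IsPosShift (μ c : ℝ) (θ : Fin N → ℝ) (d : Dispersion N) (ξ α : ℂ) : Prop where
  relation : ξ * (α - μ) * (α * μ - 1) = c * (μ : ℂ) ^ 2 * α
  sub_ne : α - μ ≠ 0
  mul_sub_ne : α * μ - 1 ≠ 0
  norm_ne : ‖α‖ ≠ 1
  phi : ∃ S, HasSum (fun k : ℕ => (d.phi k : ℂ) *
    (Complex.I * ξ ^ (k + 1) / ((k : ℂ) + 1))) S ∧ Complex.exp (Complex.I * S) = 1 - (μ : ℂ)⁻¹ * α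
  nu : ∀ n, ∃ S, HasSum (fun k : ℕ => (d.nu n k : ℂ) *
    (Complex.I * ξ ^ (k + 1) / ((k : ℂ) + 1))) S ∧ Complex.exp S = weight θ (α, 1) n

/-- The relation between the parameter `η` of a negative Miwa shift and `β = β(η)`, with the effect of
the shift on the phases. -/
structure IsNegShift (μ c : ℝ) (θ : Fin N → ℝ) (d : Dispersion N) (η β : ℂ) : Prop where
  relation : (β - μ) * (β * μ - 1) = c * (μ : ℂ) ^ 2 * β * η
  ne_zero : β ≠ 0
  mul_sub_ne : β * μ - 1 ≠ 0
  norm_ne : ‖β‖ ≠ 1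
  phi : ∃ S, HasSum (fun k : ℕ => (d.phiBar k : ℂ) *
    (Complex.I * η ^ (k + 1) / ((k : ℂ) + 1))) S ∧
      Complex.exp (Complex.I * S) = (1 - ((μ : ℂ) ^ 2)⁻¹) / (1 - (μ : ℂ)⁻¹ * β⁻¹)
  nu : ∀ n, ∃ S, HasSum (fun k : ℕ => (d.nuBar n k : ℂ) *
    (Complex.I * η ^ (k + 1) / ((k : ℂ) + 1))) S ∧
      Complex.exp S = weight θ (β, 1) n / weight θ ((μ : ℂ), 1) n

theorem IsDispersion.exists_isPosShift (hd : IsDispersion μ c θ d) (hμ₀ : μ ≠ 0) (hc : c ≠ 0) :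
    ∃ a : ℂ → ℂ, AnalyticAt ℂ a 0 ∧ a 0 = 0 ∧ ∀ᶠ ξ in 𝓝 0, IsPosShift μ c θ d ξ (a ξ) := by
  obtain ⟨a, ha, ha0, h1, h2, h3, -⟩ := hd.exists_alpha hμ₀ hc
  have hac := ha.continuousAt
  refine ⟨a, ha, ha0, ?_⟩
  have e1 : ∀ᶠ ξ in 𝓝 0, a ξ - μ ≠ 0 :=
    (hac.sub continuousAt_const).eventually_ne (by simpa [ha0] using hμ₀)
  have e2 : ∀ᶠ ξ in 𝓝 0, a ξ * μ - 1 ≠ 0 :=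
    ((hac.mul continuousAt_const).sub continuousAt_const).eventually_ne (by simp [ha0])
  have e3 : ∀ᶠ ξ in 𝓝 0, ‖a ξ‖ ≠ 1 := hac.norm.eventually_ne (by simp [ha0])
  filter_upwards [h1, h2, eventually_all.2 h3, e1, e2, e3] with ξ k1 k2 k3 k4 k5 k6
  exact ⟨k1, k4, k5, k6, k2, k3⟩

theorem IsDispersion.exists_isNegShift (hd : IsDispersion μ c θ d) (hμ₀ : μ ≠ 0)
    (hμ₁ : μ ^ 2 ≠ 1) :
    ∃ b : ℂ → ℂ, AnalyticAt ℂ b 0 ∧ b 0 = μ ∧ ∀ᶠ η in 𝓝 0, IsNegShift μ c θ d η (b η) := by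
  obtain ⟨b, hb, hb0, h1, h2, h3⟩ := hd.exists_beta hμ₀ hμ₁
  have hbc := hb.continuousAt
  refine ⟨b, hb, hb0, ?_⟩
  have e1 : ∀ᶠ η in 𝓝 0, b η ≠ 0 := hbc.eventually_ne (by simpa [hb0] using hμ₀)
  have e2 : ∀ᶠ η in 𝓝 0, b η * μ - 1 ≠ 0 :=
    ((hbc.mul continuousAt_const).sub continuousAt_const).eventually_ne (by
      change b 0 * (μ : ℂ) - 1 ≠ 0
      rw [hb0, ← sq, sub_ne_zero]
      exact_mod_cast hμ₁)
  have e3 : ∀ᶠ η in 𝓝 0, ‖b η‖ ≠ 1 := hbc.norm.eventually_ne (by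
    rw [hb0]
    exact norm_ofReal_ne_one (abs_ne_one_of_sq_ne_one hμ₁))
  filter_upwards [h1, h2, eventually_all.2 h3, e1, e2, e3] with ξ k1 k2 k3 k4 k5 k6
  exact ⟨k1, k4, k5, k6, k2, k3⟩

section Shifts

variable {p : Times} {ξ η α β : ℂ}

theorem hasSum_shiftPos {e e' : ℕ → ℝ} {S : ℂ}
    (h : Summable fun k : ℕ => (e k : ℂ) * p.pos k + (e' k : ℂ) * p.neg k)
    (hS : HasSum (fun k : ℕ => (e k : ℂ) * (Complex.I * ξ ^ (k + 1) / ((k : ℂ) + 1))) S) :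
    HasSum (fun k : ℕ => (e k : ℂ) * (shiftPos ξ p).pos k + (e' k : ℂ) * (shiftPos ξ p).neg k)
      ((∑' k : ℕ, ((e k : ℂ) * p.pos k + (e' k : ℂ) * p.neg k)) + S) := by
  have : (fun k : ℕ => (e k : ℂ) * (shiftPos ξ p).pos k + (e' k : ℂ) * (shiftPos ξ p).neg k) =
      fun k : ℕ => ((e k : ℂ) * p.pos k + (e' k : ℂ) * p.neg k) +
        (e k : ℂ) * (Complex.I * ξ ^ (k + 1) / ((k : ℂ) + 1)) := by
    funext k
    simp only [shiftPos]
    ring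
  rw [this]
  exact h.hasSum.add hS

theorem hasSum_shiftNeg {e e' : ℕ → ℝ} {S : ℂ}
    (h : Summable fun k : ℕ => (e k : ℂ) * p.pos k + (e' k : ℂ) * p.neg k)
    (hS : HasSum (fun k : ℕ => (e' k : ℂ) * (Complex.I * η ^ (k + 1) / ((k : ℂ) + 1))) S) :
    HasSum (fun k : ℕ => (e k : ℂ) * (shiftNeg η p).pos k + (e' k : ℂ) * (shiftNeg η p).neg k)
      ((∑' k : ℕ, ((e k : ℂ) * p.pos k + (e' k : ℂ) * p.neg k)) + S) := by
  have : (fun k : ℕ => (e k : ℂ) * (shiftNeg η p).pos k + (e' k : ℂ) * (shiftNeg η p).neg k) =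
      fun k : ℕ => ((e k : ℂ) * p.pos k + (e' k : ℂ) * p.neg k) +
        (e' k : ℂ) * (Complex.I * η ^ (k + 1) / ((k : ℂ) + 1)) := by
    funext k
    simp only [shiftNeg]
    ring
  rw [this]
  exact h.hasSum.add hS

theorem IsPosShift.mem_convergenceDomain (h : IsPosShift μ c θ d ξ α)
    (hp : p ∈ convergenceDomain d) : shiftPos ξ p ∈ convergenceDomain d := by
  obtain ⟨S, hS, -⟩ := h.phi
  refine ⟨(hasSum_shiftPos hp.1 hS).summable, fun n => ?_⟩
  obtain ⟨S, hS, -⟩ := h.nu n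
  exact (hasSum_shiftPos (hp.2 n) hS).summable

theorem IsNegShift.mem_convergenceDomain (h : IsNegShift μ c θ d η β)
    (hp : p ∈ convergenceDomain d) : shiftNeg η p ∈ convergenceDomain d := by
  obtain ⟨S, hS, -⟩ := h.phi
  refine ⟨(hasSum_shiftNeg hp.1 hS).summable, fun n => ?_⟩
  obtain ⟨S, hS, -⟩ := h.nu n
  exact (hasSum_shiftNeg (hp.2 n) hS).summable

theorem IsPosShift.planeWave_shiftPos (h : IsPosShift μ c θ d ξ α)
    (hp : p ∈ convergenceDomain d) :
    planeWave d (shiftPos ξ p) = planeWave d p * (1 - (μ : ℂ)⁻¹ * α) := by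
  obtain ⟨S, hS, hS'⟩ := h.phi
  rw [planeWave, planeWave, ← hS', ← Complex.exp_add, ← mul_add, phase, phase,
    (hasSum_shiftPos hp.1 hS).tsum_eq]

theorem IsNegShift.planeWave_shiftNeg (h : IsNegShift μ c θ d η β)
    (hp : p ∈ convergenceDomain d) :
    planeWave d (shiftNeg η p) =
      planeWave d p * ((1 - ((μ : ℂ) ^ 2)⁻¹) / (1 - (μ : ℂ)⁻¹ * β⁻¹)) := by
  obtain ⟨S, hS, hS'⟩ := h.phi
  rw [planeWave, planeWave, ← hS', ← Complex.exp_add, ← mul_add, phase, phase,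
    (hasSum_shiftNeg hp.1 hS).tsum_eq]

theorem IsPosShift.solitonExp_shiftPos (h : IsPosShift μ c θ d ξ α)
    (hp : p ∈ convergenceDomain d) :
    solitonExp μ θ C d (shiftPos ξ p) = solitonExp μ θ C d p * weight θ (α, 1) := by
  funext n
  obtain ⟨S, hS, hS'⟩ := h.nu n
  rw [Pi.mul_apply, solitonExp, solitonExp, ← hS', mul_assoc, ← Complex.exp_add, solitonPhase,
    solitonPhase, (hasSum_shiftPos (hp.2 n) hS).tsum_eq]
  ring_nf

theorem IsNegShift.solitonExp_shiftNeg (h : IsNegShift μ c θ d η β)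
    (hp : p ∈ convergenceDomain d) :
    solitonExp μ θ C d (shiftNeg η p) =
      solitonExp μ θ C d p * weight θ (β, 1) / weight θ ((μ : ℂ), 1) := by
  funext n
  obtain ⟨S, hS, hS'⟩ := h.nu n
  rw [Pi.div_apply, Pi.mul_apply, mul_div_assoc, solitonExp, solitonExp, ← hS', mul_assoc,
    ← Complex.exp_add, solitonPhase, solitonPhase, (hasSum_shiftNeg (hp.2 n) hS).tsum_eq]
  ring_nf

theorem shiftPos_comm (ξ₁ ξ₂ : ℂ) (p : Times) :
    shiftPos ξ₁ (shiftPos ξ₂ p) = shiftPos ξ₂ (shiftPos ξ₁ p) := by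
  simp only [shiftPos, Times.mk.injEq, and_true]
  funext j
  ring

theorem shiftNeg_comm (η₁ η₂ : ℂ) (p : Times) :
    shiftNeg η₁ (shiftNeg η₂ p) = shiftNeg η₂ (shiftNeg η₁ p) := by
  simp only [shiftNeg, Times.mk.injEq, true_and]
  funext j
  ring

end Shifts

end Solution

/-! ### Verification of the hierarchy. -/

section Hierarchy

variable {N : ℕ} {μ c : ℝ} {U₀ : ℂ} {θ C : Fin N → ℝ} {d : Dispersion N} {p : Times}
  {ξ η ξ₁ ξ₂ η₁ η₂ α β α₁ α₂ β₁ β₂ : ℂ}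

theorem bigG_eq (hμ₀ : μ ≠ 0) (hμ : |μ| ≠ 1)
    (hU : U₀ * starRingEnd ℂ U₀ * c = 1) (hθ : ∀ m n, Real.sin ((θ m + θ n) / 2) ≠ 0)
    (h : IsPosShift μ c θ d ξ α) (hp : p ∈ regularDomain μ θ C d)
    (hp' : shiftPos ξ p ∈ regularDomain μ θ C d) :
    bigG (solitonU μ U₀ θ C d) (reflect (solitonU μ U₀ θ C d)) ξ p =
      -(solitonTau θ (solitonExp μ θ C d p) *
        solitonTau θ (solitonExp μ θ C d p * weight θ (α, 1) * weight θ ((μ : ℂ), 1))) /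
      ((α * μ - 1) * (solitonTau θ (solitonExp μ θ C d p * weight θ (α, 1)) *
        solitonTau θ (solitonExp μ θ C d p * weight θ ((μ : ℂ), 1)))) := by
  rw [mem_regularDomain_iff hμ] at hp hp'
  rw [h.solitonExp_shiftPos hp.1] at hp'
  rw [bigG, solitonU_eq hμ, reflect_solitonU hμ, h.solitonExp_shiftPos hp.1,
    h.planeWave_shiftPos hp.1]
  exact bigG_scalar (by exact_mod_cast hμ₀) hU (planeWave_ne_zero d p) h.sub_ne h.mul_sub_ne
    h.relation hp'.2.1 hp.2.2 (solitonTau_bigG hθ (norm_ofReal_ne_one hμ) rfl rfl h.norm_ne rfl _)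

theorem sq_sub_one_ne_zero (hμ : |μ| ≠ 1) : (μ : ℂ) ^ 2 - 1 ≠ 0 := by
  rw [sub_ne_zero]
  intro h
  apply hμ
  have : μ ^ 2 = 1 := by exact_mod_cast h
  rw [← pow_eq_one_iff_of_nonneg (abs_nonneg μ) two_ne_zero, sq_abs, this]

theorem smallG_eq (hμ₀ : μ ≠ 0) (hμ : |μ| ≠ 1) (hc : c ≠ 0)
    (hU : U₀ * starRingEnd ℂ U₀ * c = 1) (hθ : ∀ m n, Real.sin ((θ m + θ n) / 2) ≠ 0)
    (h : IsNegShift μ c θ d η β) (hp : p ∈ regularDomain μ θ C d)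
    (hp' : shiftNeg η p ∈ regularDomain μ θ C d) :
    smallG (companionU μ c U₀ θ C d) (companionV μ c U₀ θ C d) η p =
      (β * μ - 1) * (solitonTau θ (solitonExp μ θ C d p * weight θ (β, 1) / weight θ ((μ : ℂ), 1)) *
        solitonTau θ (solitonExp μ θ C d p * weight θ ((μ : ℂ), 1))) /
      (((μ : ℂ) ^ 2 - 1) * (solitonTau θ (solitonExp μ θ C d p * weight θ (β, 1) /
        weight θ ((μ : ℂ), 1) * weight θ ((μ : ℂ), 1)) *
          solitonTau θ (solitonExp μ θ C d p))) := by
  rw [mem_regularDomain_iff hμ] at hp hp'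
  rw [h.solitonExp_shiftNeg hp.1] at hp'
  rw [smallG, companionU, companionV, h.solitonExp_shiftNeg hp.1, h.planeWave_shiftNeg hp.1]
  exact smallG_scalar (by exact_mod_cast hμ₀) (sq_sub_one_ne_zero hμ) (by exact_mod_cast hc) hU
    (planeWave_ne_zero d p) h.ne_zero h.mul_sub_ne h.relation hp.2.1 hp'.2.2
    (solitonTau_smallG hθ (norm_ofReal_ne_one hμ) rfl rfl h.norm_ne rfl _)

/-- The equations of the extended hierarchy for the `N`-soliton functions, in terms of the
parametrizations `α(ξ)` and `β(η)` of small Miwa shifts. -/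
theorem isExtendedDNLSH_soliton (hμ₀ : μ ≠ 0) (hμ : |μ| ≠ 1) (hc : c ≠ 0)
    (hU : U₀ * starRingEnd ℂ U₀ * c = 1) (hθ : ∀ m n, Real.sin ((θ m + θ n) / 2) ≠ 0)
    {r : ℝ} {a b : ℂ → ℂ} (ha : ∀ ξ, ‖ξ‖ < r → IsPosShift μ c θ d ξ (a ξ))
    (hb : ∀ η, ‖η‖ < r → IsNegShift μ c θ d η (b η)) :
    IsExtendedDNLSH (regularDomain μ θ C d) r (solitonU μ U₀ θ C d)
      (reflect (solitonU μ U₀ θ C d)) (companionU μ c U₀ θ C d) (companionV μ c U₀ θ C d) := by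
  have hμc : (μ : ℂ) ≠ 0 := by exact_mod_cast hμ₀
  have hcc : (c : ℂ) ≠ 0 := by exact_mod_cast hc
  have hn := norm_ofReal_ne_one hμ
  have hsq := sq_sub_one_ne_zero hμ
  constructor
  · intro ξ₁ ξ₂ hξ₁ hξ₂ p hp hp₁ hp₂ hp₁₂
    have h1 := ha ξ₁ hξ₁
    have h2 := ha ξ₂ hξ₂
    have hG₁ := bigG_eq hμ₀ hμ hU hθ h1 hp hp₁
    have hG₂ := bigG_eq hμ₀ hμ hU hθ h2 hp hp₂
    rw [mem_regularDomain_iff hμ] at hp hp₁ hp₂ hp₁₂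
    rw [h1.solitonExp_shiftPos hp₂.1] at hp₁₂
    rw [solitonU_eq hμ, solitonU_eq hμ, solitonU_eq hμ, h1.solitonExp_shiftPos hp₂.1,
      h1.planeWave_shiftPos hp₂.1]
    rw [h1.solitonExp_shiftPos hp.1] at hp₁ ⊢
    rw [h2.solitonExp_shiftPos hp.1] at hp₂ hp₁₂ ⊢
    rw [h1.planeWave_shiftPos hp.1, h2.planeWave_shiftPos hp.1]
    exact pos_U_scalar hμc h1.sub_ne h1.mul_sub_ne h2.sub_ne h2.mul_sub_ne h1.relation h2.relation
      hp₁.2.1 hp₂.2.1 hp.2.2 hp₁₂.2.1 hG₁ hG₂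
      (solitonTau_pos hθ hn rfl h1.norm_ne h2.norm_ne rfl rfl _)
      (solitonTau_pos_U hθ hn rfl rfl h1.norm_ne h2.norm_ne rfl rfl _)
  · intro ξ₁ ξ₂ hξ₁ hξ₂ p hp hp₁ hp₂ hp₁₂
    have h1 := ha ξ₁ hξ₁
    have h2 := ha ξ₂ hξ₂
    have hG₁ := bigG_eq hμ₀ hμ hU hθ h1 hp₂ hp₁₂
    -- `G₂` is taken at the point shifted by `ξ₁`, so its double shift is reached in the opposite
    -- order.
    have hG₂ := bigG_eq hμ₀ hμ hU hθ h2 hp₁ (shiftPos_comm ξ₁ ξ₂ p ▸ hp₁₂)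
    rw [mem_regularDomain_iff hμ] at hp hp₁ hp₂ hp₁₂
    rw [h1.solitonExp_shiftPos hp₂.1] at hp₁₂
    rw [h1.solitonExp_shiftPos hp.1] at hp₁ hG₂
    rw [h2.solitonExp_shiftPos hp.1] at hp₂ hp₁₂ hG₁
    rw [reflect_solitonU hμ, reflect_solitonU hμ, reflect_solitonU hμ,
      h1.solitonExp_shiftPos hp.1, h2.solitonExp_shiftPos hp.1, h1.planeWave_shiftPos hp.1,
      h2.planeWave_shiftPos hp.1]
    rw [mul_right_comm _ (weight θ (a ξ₁, 1))] at hG₂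
    exact pos_V_scalar hμc (planeWave_ne_zero d p) h1.sub_ne h1.mul_sub_ne h2.sub_ne h2.mul_sub_ne
      h1.relation h2.relation hp.2.2 hp₁.2.2 hp₂.2.2 hp₁₂.2.1 hG₂ hG₁
      (solitonTau_pos hθ hn rfl h1.norm_ne h2.norm_ne rfl rfl _)
      (solitonTau_pos_V hθ hn rfl h1.norm_ne h2.norm_ne rfl rfl _)
  · intro η₁ η₂ hη₁ hη₂ p hp hp₁ hp₂ hp₁₂
    have h1 := hb η₁ hη₁
    have h2 := hb η₂ hη₂
    have hg₁ := smallG_eq hμ₀ hμ hc hU hθ h1 hp hp₁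
    have hg₂ := smallG_eq hμ₀ hμ hc hU hθ h2 hp hp₂
    rw [mem_regularDomain_iff hμ] at hp hp₁ hp₂ hp₁₂
    rw [h1.solitonExp_shiftNeg hp₂.1] at hp₁₂
    rw [companionU, companionU, companionU, h1.solitonExp_shiftNeg hp₂.1,
      h1.planeWave_shiftNeg hp₂.1]
    rw [h1.solitonExp_shiftNeg hp.1] at hp₁ ⊢
    rw [h2.solitonExp_shiftNeg hp.1] at hp₂ hp₁₂ ⊢
    rw [h1.planeWave_shiftNeg hp.1, h2.planeWave_shiftNeg hp.1]
    exact neg_u_scalar hμc hsq hcc h1.ne_zero h1.mul_sub_ne h2.ne_zero h2.mul_sub_ne h1.relation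
      h2.relation hp.2.1 hp₁.2.2 hp₂.2.2 hp₁₂.2.2 hg₁ hg₂
      (solitonTau_neg hθ hn rfl h1.norm_ne h2.norm_ne rfl rfl _)
      (solitonTau_neg_u hθ hn rfl rfl h1.norm_ne h2.norm_ne rfl rfl _)
  · intro η₁ η₂ hη₁ hη₂ p hp hp₁ hp₂ hp₁₂
    have h1 := hb η₁ hη₁
    have h2 := hb η₂ hη₂
    have hg₁ := smallG_eq hμ₀ hμ hc hU hθ h1 hp₂ hp₁₂
    have hg₂ := smallG_eq hμ₀ hμ hc hU hθ h2 hp₁ (shiftNeg_comm η₁ η₂ p ▸ hp₁₂)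
    rw [mem_regularDomain_iff hμ] at hp hp₁ hp₂ hp₁₂
    rw [h1.solitonExp_shiftNeg hp₂.1] at hp₁₂
    rw [h1.solitonExp_shiftNeg hp.1] at hp₁ hg₂
    rw [h2.solitonExp_shiftNeg hp.1] at hp₂ hp₁₂ hg₁
    rw [companionV, companionV, companionV,
      h1.solitonExp_shiftNeg hp.1, h2.solitonExp_shiftNeg hp.1, h1.planeWave_shiftNeg hp.1,
      h2.planeWave_shiftNeg hp.1]
    have hcomm : solitonExp μ θ C d p * weight θ (b η₁, 1) / weight θ ((μ : ℂ), 1) *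
        weight θ (b η₂, 1) / weight θ ((μ : ℂ), 1) =
        solitonExp μ θ C d p * weight θ (b η₂, 1) / weight θ ((μ : ℂ), 1) *
        weight θ (b η₁, 1) / weight θ ((μ : ℂ), 1) := by
      funext n
      simp only [Pi.mul_apply, Pi.div_apply]
      ring
    rw [hcomm] at hg₂
    exact neg_v_scalar hμc hsq hcc (planeWave_ne_zero d p) h1.ne_zero h2.ne_zero
      h1.relation h2.relation hp.2.1 hp₁.2.1 hp₂.2.1 hp₁₂.2.2 hg₂ hg₁
      (solitonTau_neg hθ hn rfl h1.norm_ne h2.norm_ne rfl rfl _)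
      (solitonTau_neg_v hθ hn rfl rfl h1.norm_ne h2.norm_ne rfl rfl _)
  · intro η hη p hp hp₁
    have h1 := hb η hη
    have hg := smallG_eq hμ₀ hμ hc hU hθ h1 hp hp₁
    rw [mem_regularDomain_iff hμ] at hp hp₁
    rw [h1.solitonExp_shiftNeg hp.1] at hp₁
    rw [solitonU_eq hμ, solitonU_eq hμ, companionU, h1.solitonExp_shiftNeg hp.1,
      h1.planeWave_shiftNeg hp.1]
    exact mixed_U_scalar hμc hsq hcc h1.ne_zero h1.mul_sub_ne h1.relation hp.2.1 hp₁.2.2 hp₁.2.1 hg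
      (solitonTau_mixed_U hθ hn rfl rfl h1.norm_ne rfl _)
  · intro η hη p hp hp₁
    have h1 := hb η hη
    have hg := smallG_eq hμ₀ hμ hc hU hθ h1 hp hp₁
    rw [mem_regularDomain_iff hμ] at hp hp₁
    rw [h1.solitonExp_shiftNeg hp.1] at hp₁
    have F := solitonTau_mixed_V hθ hn rfl rfl h1.norm_ne rfl (solitonExp μ θ C d p)
    rw [reflect_solitonU hμ, reflect_solitonU hμ, h1.solitonExp_shiftNeg hp.1,
      h1.planeWave_shiftNeg hp.1, companionV]
    exact mixed_V_scalar hμc hsq hcc (planeWave_ne_zero d p) h1.ne_zero h1.relation hp.2.1 hp₁.2.2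
      hp.2.2 hg F
  · intro ξ hξ p hp hp₁
    have h1 := ha ξ hξ
    have hG := bigG_eq hμ₀ hμ hU hθ h1 hp hp₁
    rw [mem_regularDomain_iff hμ] at hp hp₁
    rw [h1.solitonExp_shiftPos hp.1] at hp₁
    rw [companionU, companionU, solitonU_eq hμ, h1.solitonExp_shiftPos hp.1,
      h1.planeWave_shiftPos hp.1]
    exact mixed_u_scalar hμc hsq h1.sub_ne h1.mul_sub_ne h1.relation hp₁.2.1 hp.2.2 hp₁.2.2 hG
      (solitonTau_mixed_u hθ hn rfl rfl h1.norm_ne rfl _)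
  · intro ξ hξ p hp hp₁
    have h1 := ha ξ hξ
    have hG := bigG_eq hμ₀ hμ hU hθ h1 hp hp₁
    rw [mem_regularDomain_iff hμ] at hp hp₁
    rw [h1.solitonExp_shiftPos hp.1] at hp₁
    rw [companionV, companionV, reflect_solitonU hμ, h1.solitonExp_shiftPos hp.1,
      h1.planeWave_shiftPos hp.1]
    exact mixed_v_scalar hμc hsq (planeWave_ne_zero d p) h1.sub_ne h1.mul_sub_ne h1.relation hp.2.1
      hp₁.2.1 hp.2.2 hG (solitonTau_mixed_v hθ hn rfl rfl h1.norm_ne rfl _)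

end Hierarchy

/-! ### Stability of the regular domain under small shifts. -/

section Stability

variable {N : ℕ} {μ c : ℝ} {θ C : Fin N → ℝ} {d : Dispersion N}

theorem continuous_solitonTau (θ : Fin N → ℝ) : Continuous (solitonTau θ) := by
  unfold solitonTau
  refine Continuous.matrix_det ?_
  refine continuous_matrix fun m n => ?_
  simp only [Matrix.of_apply]
  fun_prop

theorem continuousAt_weight {X : Type*} [TopologicalSpace X] (θ : Fin N → ℝ) {f : X → ℂ} {x : X}
    (hf : ContinuousAt f x) (hx : ‖f x‖ ≠ 1) : ContinuousAt (fun y => weight θ (f y, 1)) x := by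
  refine continuousAt_pi.2 fun n => ?_
  exact ContinuousAt.comp (g := fun z => weight θ (z, 1) n) (f := f)
    (analyticAt_weight θ n analyticAt_id (by simpa using hx)).continuousAt hf

theorem eventually_solitonTau_ne_zero {X : Type*} [TopologicalSpace X] {F : X → Fin N → ℂ} {x : X}
    (hF : ContinuousAt F x) (h : solitonTau θ (F x) ≠ 0) : ∀ᶠ y in 𝓝 x, solitonTau θ (F y) ≠ 0 :=
  (ContinuousAt.comp (g := solitonTau θ) (continuous_solitonTau θ).continuousAt hF).eventually_ne h

theorem isShiftStable_regularDomain (hd : IsDispersion μ c θ d) (hμ₀ : μ ≠ 0) (hμ₁ : μ ^ 2 ≠ 1)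
    (hc : c ≠ 0) : IsShiftStable (regularDomain μ θ C d) := by
  have hμ := abs_ne_one_of_sq_ne_one hμ₁
  obtain ⟨a, ha, ha0, hpos⟩ := hd.exists_isPosShift hμ₀ hc
  obtain ⟨b, hb, hb0, hneg⟩ := hd.exists_isNegShift hμ₀ hμ₁
  intro p hp
  rw [mem_regularDomain_iff hμ] at hp
  obtain ⟨hconv, ht, htm⟩ := hp
  set X := solitonExp μ θ C d p with hX
  set M := weight θ ((μ : ℂ), 1) with hM
  have hMM : M / M = 1 := by
    funext n
    exact div_self (weight_ne_zero θ (by simpa using hμ) n)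
  have h1 : Tendsto (fun q : ℂ × ℂ => q.1) (𝓝 (0, 0)) (𝓝 0) := continuous_fst.tendsto' _ _ rfl
  have h2 : Tendsto (fun q : ℂ × ℂ => q.2) (𝓝 (0, 0)) (𝓝 0) := continuous_snd.tendsto' _ _ rfl
  have hA : ContinuousAt (fun z => weight θ (a z, 1)) 0 :=
    continuousAt_weight θ ha.continuousAt (by simp [ha0])
  have hB : ContinuousAt (fun z => weight θ (b z, 1) / M) 0 := by
    have h := continuousAt_weight θ hb.continuousAt (by rw [hb0]; exact norm_ofReal_ne_one hμ)
    exact continuousAt_pi.2 fun n => (continuousAt_pi.1 h n).div_const (M n)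
  have hA0 : weight θ (a 0, 1) = 1 := by rw [ha0, weight_zero]
  have hB0 : weight θ (b 0, 1) / M = 1 := by rw [hb0, hMM]
  -- Both kinds of shift act by factors that are continuous with value `1` at zero parameter. One
  -- statement thus covers both denominators under all three combinations of shifts.
  have key : ∀ {A B : ℂ → Fin N → ℂ}, ContinuousAt A 0 → ContinuousAt B 0 → A 0 = 1 → B 0 = 1 →
      ∀ {Y : Fin N → ℂ}, solitonTau θ Y ≠ 0 →
      ∀ᶠ q : ℂ × ℂ in 𝓝 (0, 0), solitonTau θ (Y * (A q.2 * B q.1)) ≠ 0 := by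
    intro A B hA hB hA0 hB0 Y hY
    refine eventually_solitonTau_ne_zero (F := fun q : ℂ × ℂ => Y * (A q.2 * B q.1)) ?_ ?_
    · exact continuousAt_const.mul
        ((ContinuousAt.comp (f := Prod.snd) (x := ((0 : ℂ), (0 : ℂ))) hA continuousAt_snd).mul
          (ContinuousAt.comp (f := Prod.fst) (x := ((0 : ℂ), (0 : ℂ))) hB continuousAt_fst))
    · simpa [hA0, hB0] using hY
  filter_upwards [h1.eventually hpos, h2.eventually hpos, h1.eventually hneg, h2.eventually hneg,
    key hA hA hA0 hA0 ht, key hA hA hA0 hA0 htm, key hB hB hB0 hB0 ht, key hB hB hB0 hB0 htm,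
    key hB hA hB0 hA0 ht, key hB hA hB0 hA0 htm] with q p1 p2 n1 n2 k1 k2 k3 k4 k5 k6
  have c1 := p2.mem_convergenceDomain hconv
  have c2 := n2.mem_convergenceDomain hconv
  simp only [mem_regularDomain_iff hμ]
  rw [p1.solitonExp_shiftPos c1, p2.solitonExp_shiftPos hconv, n1.solitonExp_shiftNeg c2,
    n2.solitonExp_shiftNeg hconv, p1.solitonExp_shiftPos c2, n2.solitonExp_shiftNeg hconv]
  have e : ∀ {s s' : Fin N → ℂ}, s = s' → solitonTau θ s ≠ 0 → solitonTau θ s' ≠ 0 :=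
    fun h h' => h ▸ h'
  refine ⟨⟨p1.mem_convergenceDomain c1, e ?_ k1, e ?_ k2⟩,
    ⟨n1.mem_convergenceDomain c2, e ?_ k3, e ?_ k4⟩, ⟨p1.mem_convergenceDomain c2, e ?_ k5, e ?_ k6⟩⟩
  all_goals
    funext n
    simp only [Pi.mul_apply, Pi.div_apply]
    ring

end Stability

/-! ### Nonvanishing of the leading coefficients of τ. -/

section Cauchy

variable {N : ℕ} {θ C : Fin N → ℝ}

/-- A Cauchy matrix has trivial kernel. -/
theorem eq_zero_of_sum_div_eq_zero {K ι : Type*} [Field K] [DecidableEq ι] {I : Finset ι}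
    {p q x : ι → K} (hp : Set.InjOn p I) (hq : Set.InjOn q I)
    (hpq : ∀ m ∈ I, ∀ n ∈ I, p n ≠ q m) (h : ∀ m ∈ I, ∑ n ∈ I, x n / (p n - q m) = 0) :
    ∀ n ∈ I, x n = 0 := by
  -- Up to sign this is the numerator of the rational function `∑ x n / (p n - T)`. Its degree is
  -- below `|I|` and it vanishes at the `|I|` distinct nodes `q m`, so it is zero; its value at `p
  -- n` isolates `x n`.
  let R : Polynomial K := ∑ n ∈ I, Polynomial.C (x n) * Lagrange.nodal (I.erase n) p
  have hdeg : R.degree < I.card := by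
    rw [← Polynomial.mem_degreeLT]
    refine Submodule.sum_mem _ fun n hn => ?_
    rw [← Polynomial.smul_eq_C_mul]
    refine Submodule.smul_mem _ _ ?_
    rw [Polynomial.mem_degreeLT, Lagrange.degree_nodal, Nat.cast_lt]
    exact Finset.card_erase_lt_of_mem hn
  have hR : R = 0 := by
    refine Polynomial.eq_zero_of_degree_lt_of_eval_index_eq_zero I hq hdeg fun m hm => ?_
    have h1 : ∀ n ∈ I, (Polynomial.C (x n) * Lagrange.nodal (I.erase n) p).eval (q m) =
        -(Lagrange.nodal I p).eval (q m) * (x n / (p n - q m)) := by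
      intro n hn
      have h2 : p n - q m ≠ 0 := sub_ne_zero.2 (hpq m hm n hn)
      rw [Lagrange.nodal_eq_mul_nodal_erase hn]
      simp only [Polynomial.eval_mul, Polynomial.eval_C, Polynomial.eval_sub, Polynomial.eval_X]
      field_simp
      ring
    rw [Polynomial.eval_finsetSum, Finset.sum_congr rfl h1, ← Finset.mul_sum, h m hm, mul_zero]
  intro n hn
  have h1 : R.eval (p n) = x n * (Lagrange.nodal (I.erase n) p).eval (p n) := by
    rw [Polynomial.eval_finsetSum, Finset.sum_eq_single_of_mem n hn]
    · simp
    · intro k _ hkn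
      rw [Polynomial.eval_mul, Lagrange.eval_nodal_at_node (Finset.mem_erase.2 ⟨hkn.symm, hn⟩),
        mul_zero]
  rw [hR, Polynomial.eval_zero] at h1
  refine (mul_eq_zero.1 h1.symm).resolve_right (Lagrange.eval_nodal_not_at_node ?_)
  intro k hk hpk
  exact Finset.ne_of_mem_erase hk (hp (Finset.mem_of_mem_erase hk) hn hpk.symm)

theorem expPos_injective (hθ : ∀ m n, m ≠ n → Real.sin ((θ m - θ n) / 2) ≠ 0) :
    Function.Injective (expPos θ) := by
  intro m n h
  by_contra hmn
  apply hθ m n hmn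
  have h1 : (Real.sin ((θ m - θ n) / 2) : ℂ) * (2 * Complex.I) =
      Complex.exp (-Complex.I * (θ m + θ n) / 2) * (expPos θ m - expPos θ n) := by
    have e1 : Complex.exp (-Complex.I * (θ m + θ n) / 2) * expPos θ m =
        Complex.exp (((θ m - θ n) / 2 : ℂ) * Complex.I) := by
      rw [expPos, ← Complex.exp_add]
      congr 1
      ring
    have e2 : Complex.exp (-Complex.I * (θ m + θ n) / 2) * expPos θ n =
        Complex.exp (-((θ m - θ n) / 2 : ℂ) * Complex.I) := by
      rw [expPos, ← Complex.exp_add]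
      congr 1
      ring
    rw [mul_sub, e1, e2, Complex.ofReal_sin, Complex.sin]
    push_cast
    have hI := Complex.I_mul_I
    linear_combination (Complex.exp (-((θ m - θ n) / 2 : ℂ) * Complex.I) -
      Complex.exp (((θ m - θ n) / 2 : ℂ) * Complex.I)) * hI
  rw [h, sub_self, mul_zero] at h1
  have h2 := (mul_eq_zero.1 h1).resolve_right (mul_ne_zero two_ne_zero Complex.I_ne_zero)
  exact_mod_cast h2

theorem expNeg_injective (hθ : ∀ m n, m ≠ n → Real.sin ((θ m - θ n) / 2) ≠ 0) :
    Function.Injective (expNeg θ) := by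
  intro m n h
  apply expPos_injective hθ
  rw [← conj_expNeg, ← conj_expNeg, h]

/-- The matrix of the leading coefficients of the tau function in the variables with index in `I`. -/
noncomputable def leadingMatrix (θ : Fin N → ℝ) (I : Finset (Fin N)) : Matrix (Fin N) (Fin N) ℂ :=
  Matrix.of fun m n => if n ∈ I then (1 : ℂ) / (Real.sin ((θ m + θ n) / 2) : ℂ) else
    if m = n then 1 else 0

/-- For a kernel vector the rows in `I` form a rescaled Cauchy system for the entries in `I`. Once
these vanish, each remaining row reads `x m = 0`. -/
theorem det_leadingMatrix_ne_zero (hθ : ∀ m n, Real.sin ((θ m + θ n) / 2) ≠ 0)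
    (hθ' : ∀ m n, m ≠ n → Real.sin ((θ m - θ n) / 2) ≠ 0) (I : Finset (Fin N)) :
    (leadingMatrix θ I).det ≠ 0 := by
  intro h0
  obtain ⟨x, hx, hx0⟩ := Matrix.exists_mulVec_eq_zero_iff.2 h0
  apply hx
  have hsin : ∀ m n, (Real.sin ((θ m + θ n) / 2) : ℂ) ≠ 0 := fun m n => by exact_mod_cast hθ m n
  have hpq : ∀ m n, expPos θ n - expNeg θ m ≠ 0 := by
    intro m n h
    have h1 := sin_half_add_eq θ m n
    rw [h, mul_zero] at h1
    exact mul_ne_zero (hsin m n) (mul_ne_zero two_ne_zero Complex.I_ne_zero) h1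
  have hrow : ∀ m, (∑ n ∈ I, x n / (Real.sin ((θ m + θ n) / 2) : ℂ)) +
      (if m ∈ I then 0 else x m) = 0 := by
    intro m
    have h1 : ∑ n, leadingMatrix θ I m n * x n = 0 := congrFun hx0 m
    have h2 : ∀ n, leadingMatrix θ I m n * x n =
        (if n ∈ I then x n / (Real.sin ((θ m + θ n) / 2) : ℂ) else 0) +
          (if m = n then (if m ∈ I then 0 else x m) else 0) := by
      intro n
      simp only [leadingMatrix, Matrix.of_apply]
      by_cases hn : n ∈ I
      · by_cases hmn : m = n
        · subst hmn; simp [hn]; ring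
        · simp [hn, hmn]; ring
      · by_cases hmn : m = n
        · subst hmn; simp [hn]
        · simp [hn, hmn]
    rw [Finset.sum_congr rfl fun n _ => h2 n, Finset.sum_add_distrib, Finset.sum_ite_mem,
      Finset.univ_inter, Finset.sum_ite_eq] at h1
    simpa using h1
  have hI : ∀ n ∈ I, x n / Complex.exp (-Complex.I * θ n / 2) = 0 := by
    refine eq_zero_of_sum_div_eq_zero (p := expPos θ) (q := expNeg θ)
      (expPos_injective hθ').injOn (expNeg_injective hθ').injOn
      (fun m _ n _ => sub_ne_zero.1 (hpq m n)) fun m hm => ?_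
    have h1 := hrow m
    rw [if_pos hm, add_zero] at h1
    have h2 : ∀ n ∈ I, x n / Complex.exp (-Complex.I * θ n / 2) / (expPos θ n - expNeg θ m) =
        (Complex.exp (Complex.I * θ m / 2) / (2 * Complex.I)) *
          (x n / (Real.sin ((θ m + θ n) / 2) : ℂ)) := by
      intro n _
      have h3 := sin_half_add_eq θ m n
      have h4 := hsin m n
      have h5 := hpq m n
      have h6 := Complex.exp_ne_zero (-Complex.I * θ n / 2)
      have h7 := Complex.I_ne_zero
      rw [div_div, div_mul_div_comm, div_eq_div_iff (mul_ne_zero h6 h5)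
        (mul_ne_zero (mul_ne_zero two_ne_zero h7) h4)]
      linear_combination x n * h3
    rw [Finset.sum_congr rfl h2, ← Finset.mul_sum, h1, mul_zero]
  have hI' : ∀ n ∈ I, x n = 0 := fun n hn =>
    (div_eq_zero_iff.1 (hI n hn)).resolve_right (Complex.exp_ne_zero _)
  funext m
  by_cases hm : m ∈ I
  · exact hI' m hm
  · have h1 := hrow m
    rw [if_neg hm, Finset.sum_eq_zero fun n hn => by rw [hI' n hn, zero_div], zero_add] at h1
    exact h1

end Cauchy

/-! ### Asymptotics along the first time. -/

section Boundary

variable {N : ℕ} {μ c : ℝ} {U₀ : ℂ} {θ C : Fin N → ℝ} {d : Dispersion N}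

theorem tendsto_solitonTau_scaled {l : Filter ℝ} {I : Finset (Fin N)} {X : ℝ → Fin N → ℂ}
    (h1 : ∀ n ∈ I, (∀ x, X x n ≠ 0) ∧ Tendsto (fun x => (X x n)⁻¹) l (𝓝 0))
    (h2 : ∀ n ∉ I, Tendsto (fun x => X x n) l (𝓝 0)) :
    Tendsto (fun x => (∏ n ∈ I, (X x n)⁻¹) * solitonTau θ (X x)) l
      (𝓝 (leadingMatrix θ I).det) := by
  have e : ∀ x, (∏ n ∈ I, (X x n)⁻¹) * solitonTau θ (X x) =
      (Matrix.of fun m n : Fin N => (if n ∈ I then (X x n)⁻¹ else 1) *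
        ((if m = n then (1 : ℂ) else 0) + X x n / (Real.sin ((θ m + θ n) / 2) : ℂ))).det := by
    intro x
    rw [solitonTau, ← Finset.univ_inter I, ← Finset.prod_ite_mem, Finset.univ_inter]
    exact (Matrix.det_mul_row _ _).symm
  simp only [e]
  have hdet : Continuous fun A : Matrix (Fin N) (Fin N) ℂ => A.det := continuous_id.matrix_det
  refine (hdet.tendsto (leadingMatrix θ I)).comp ?_
  refine tendsto_pi_nhds.2 fun m => tendsto_pi_nhds.2 fun n => ?_
  simp only [leadingMatrix, Matrix.of_apply]
  by_cases hn : n ∈ I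
  · simp only [if_pos hn]
    obtain ⟨h3, h4⟩ := h1 n hn
    have h5 : ∀ x, (X x n)⁻¹ * ((if m = n then (1 : ℂ) else 0) +
        X x n / (Real.sin ((θ m + θ n) / 2) : ℂ)) =
        (X x n)⁻¹ * (if m = n then (1 : ℂ) else 0) + 1 / (Real.sin ((θ m + θ n) / 2) : ℂ) := by
      intro x
      rw [mul_add, ← mul_div_assoc, inv_mul_cancel₀ (h3 x)]
    simp only [h5]
    simpa using (h4.mul_const (if m = n then (1 : ℂ) else 0)).add_const
      (1 / (Real.sin ((θ m + θ n) / 2) : ℂ))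
  · simp only [if_neg hn, one_mul]
    simpa using ((h2 n hn).div_const (Real.sin ((θ m + θ n) / 2) : ℂ)).const_add
      (if m = n then (1 : ℂ) else 0)

/-- Dividing the columns in `I` by their growing exponentials gives numerator and denominator the
same nonzero limit, so only the factors `J n` with `n ∈ I` survive. In particular the denominator is
eventually nonzero. -/
theorem tendsto_solitonTau_ratio (hθ : ∀ m n, Real.sin ((θ m + θ n) / 2) ≠ 0)
    (hθ' : ∀ m n, m ≠ n → Real.sin ((θ m - θ n) / 2) ≠ 0)
    {l : Filter ℝ} {I : Finset (Fin N)} {X : ℝ → Fin N → ℂ} {J : Fin N → ℂ} (hJ : ∀ n, J n ≠ 0)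
    (h1 : ∀ n ∈ I, (∀ x, X x n ≠ 0) ∧ Tendsto (fun x => (X x n)⁻¹) l (𝓝 0))
    (h2 : ∀ n ∉ I, Tendsto (fun x => X x n) l (𝓝 0)) :
    Tendsto (fun x => solitonTau θ (X x / J) / solitonTau θ (X x)) l (𝓝 (∏ n ∈ I, (J n)⁻¹)) := by
  have hdet := det_leadingMatrix_ne_zero hθ hθ' I
  have k1 := tendsto_solitonTau_scaled (θ := θ) h1 h2
  have k2 : Tendsto (fun x => (∏ n ∈ I, ((X x / J) n)⁻¹) * solitonTau θ (X x / J)) l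
      (𝓝 (leadingMatrix θ I).det) := by
    refine tendsto_solitonTau_scaled (fun n hn => ⟨fun x => div_ne_zero ((h1 n hn).1 x) (hJ n), ?_⟩)
      fun n hn => ?_
    · have := (h1 n hn).2.const_mul (J n)
      simpa [div_eq_mul_inv] using this
    · have := (h2 n hn).div_const (J n)
      simpa using this
  have k3 := (k2.div k1 hdet).const_mul (∏ n ∈ I, (J n)⁻¹)
  rw [div_self hdet, mul_one] at k3
  refine k3.congr fun x => ?_
  have hX : (∏ n ∈ I, (X x n)⁻¹) ≠ 0 :=
    Finset.prod_ne_zero_iff.2 fun n hn => inv_ne_zero ((h1 n hn).1 x)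
  have hJ' : (∏ n ∈ I, (J n)⁻¹) * (∏ n ∈ I, J n) = 1 := by
    rw [← Finset.prod_mul_distrib]
    exact Finset.prod_eq_one fun n _ => inv_mul_cancel₀ (hJ n)
  have hprod : (∏ n ∈ I, ((X x / J) n)⁻¹) = (∏ n ∈ I, J n) * ∏ n ∈ I, (X x n)⁻¹ := by
    rw [← Finset.prod_mul_distrib]
    exact Finset.prod_congr rfl fun n _ => by rw [Pi.div_apply, inv_div, div_eq_mul_inv]
  rw [Pi.div_apply, hprod, mul_assoc, ← mul_div_assoc, ← mul_assoc, hJ', one_mul,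
    mul_div_mul_left _ _ hX]

theorem norm_weight_eq_one {x y : ℝ} (hxy : |x| ≠ |y|) (n : Fin N) :
    ‖weight θ ((x : ℂ), (y : ℂ)) n‖ = 1 := by
  have h0 := weight_ne_zero θ (a := ((x : ℂ), (y : ℂ))) (by simpa using hxy) n
  have h := congrArg norm (conj_weight (θ := θ) x y n)
  rw [RCLike.norm_conj, norm_inv] at h
  have h1 : ‖weight θ ((x : ℂ), (y : ℂ)) n‖ ≠ 0 := norm_ne_zero_iff.2 h0
  have h2 : ‖weight θ ((x : ℂ), (y : ℂ)) n‖ ^ 2 = 1 := by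
    rw [sq]
    nth_rewrite 2 [h]
    exact mul_inv_cancel₀ h1
  exact (pow_eq_one_iff_of_nonneg (norm_nonneg _) two_ne_zero).1 h2

theorem solitonExp_addFirst {p : Times} (hp : p ∈ convergenceDomain d) (x : ℝ) (n : Fin N) :
    solitonExp μ θ C d (p.addFirst x) n =
      solitonExp μ θ C d p n * Complex.exp ((d.nu n 0 * x : ℝ) : ℂ) := by
  have h : HasSum (fun k : ℕ => (d.nu n k : ℂ) * (p.addFirst x).pos k +
      (d.nuBar n k : ℂ) * (p.addFirst x).neg k) (solitonPhase d n p + (d.nu n 0 * x : ℝ)) := by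
    have h1 := (hp.2 n).hasSum.add (hasSum_ite_eq 0 ((d.nu n 0 * x : ℝ) : ℂ))
    refine h1.congr_fun ?_
    intro k
    by_cases hk : k = 0
    · subst hk
      simp [Times.addFirst]
      ring
    · simp [Times.addFirst, hk]
  have h2 : solitonPhase d n (p.addFirst x) = solitonPhase d n p + (d.nu n 0 * x : ℝ) := h.tsum_eq
  rw [solitonExp, solitonExp, h2, mul_assoc, ← Complex.exp_add]
  ring_nf

theorem tendsto_exp_mul_zero {l : Filter ℝ} {f : ℝ → ℝ} (hf : Tendsto f l atBot) (A : ℂ) :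
    Tendsto (fun x => A * Complex.exp ((f x : ℝ) : ℂ)) l (𝓝 0) := by
  have h : Tendsto (fun x => ((Real.exp (f x) : ℝ) : ℂ)) l (𝓝 0) := by
    have := (Complex.continuous_ofReal.tendsto 0).comp (Real.tendsto_exp_atBot.comp hf)
    rwa [Complex.ofReal_zero] at this
  have := h.const_mul A
  rw [mul_zero] at this
  simpa using this

theorem tendsto_solitonU_ratio (hμ : |μ| ≠ 1)
    (hU₀ : U₀ ≠ 0) (hθ : ∀ m n, Real.sin ((θ m + θ n) / 2) ≠ 0)
    (hθ' : ∀ m n, m ≠ n → Real.sin ((θ m - θ n) / 2) ≠ 0) {l : Filter ℝ} {I : Finset (Fin N)}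
    (h1 : ∀ n ∈ I, C n ≠ 0 ∧ Tendsto (fun x => -(d.nu n 0 * x)) l atBot)
    (h2 : ∀ n ∉ I, C n = 0 ∨ Tendsto (fun x => d.nu n 0 * x) l atBot)
    {p : Times} (hp : p ∈ convergenceDomain d) :
    Tendsto (fun x : ℝ => solitonU μ U₀ θ C d (p.addFirst x) /
        (U₀ * Complex.exp (Complex.I * phase d (p.addFirst x)))) l
      (𝓝 (∏ n ∈ I, (weight θ (1, (μ : ℂ)) n)⁻¹)) := by
  have e : ∀ x : ℝ, solitonU μ U₀ θ C d (p.addFirst x) /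
      (U₀ * Complex.exp (Complex.I * phase d (p.addFirst x))) =
      solitonTau θ (solitonExp μ θ C d (p.addFirst x) / weight θ (1, (μ : ℂ))) /
        solitonTau θ (solitonExp μ θ C d (p.addFirst x)) := by
    intro x
    rw [solitonU_eq hμ]
    exact mul_div_cancel_left₀ _ (mul_ne_zero hU₀ (Complex.exp_ne_zero _))
  simp only [e]
  refine tendsto_solitonTau_ratio hθ hθ' (X := fun x => solitonExp μ θ C d (p.addFirst x))
    (weight_ne_zero θ (by simpa using hμ.symm)) (fun n hn => ⟨fun x => ?_, ?_⟩) fun n hn => ?_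
  · exact mul_ne_zero (by exact_mod_cast (h1 n hn).1) (Complex.exp_ne_zero _)
  · simp only [solitonExp_addFirst hp, mul_inv, ← Complex.exp_neg, ← Complex.ofReal_neg]
    exact tendsto_exp_mul_zero (h1 n hn).2 _
  · simp only [solitonExp_addFirst hp]
    rcases h2 n hn with h | h
    · simpa [solitonExp, h] using tendsto_const_nhds
    · exact tendsto_exp_mul_zero h _

theorem hasNonvanishingBoundary_soliton (hd : IsDispersion μ c θ d) (hμ₀ : μ ≠ 0) (hμ : |μ| ≠ 1)
    (hc : c ≠ 0) (hU₀ : U₀ ≠ 0) (hθ : ∀ m n, Real.sin ((θ m + θ n) / 2) ≠ 0)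
    (hθ' : ∀ m n, m ≠ n → Real.sin ((θ m - θ n) / 2) ≠ 0) :
    HasNonvanishingBoundary U₀ d (solitonU μ U₀ θ C d) := by
  have hν : ∀ n, d.nu n 0 ≠ 0 := by
    obtain ⟨a, -, -, -, -, -, h⟩ := hd.exists_alpha hμ₀ hc
    intro n h0
    have h1 := h n
    rw [h0, Complex.ofReal_zero, zero_mul, ← Complex.ofReal_sin] at h1
    have h2 := hθ n n
    rw [add_self_div_two] at h2
    have h3 : (Real.sin (θ n) : ℂ) = 0 := (mul_eq_zero.1 h1.symm).resolve_left two_ne_zero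
    exact h2 (by exact_mod_cast h3)
  have hnorm : ∀ I : Finset (Fin N), ‖∏ n ∈ I, (weight θ (1, (μ : ℂ)) n)⁻¹‖ = 1 := by
    intro I
    rw [norm_prod]
    refine Finset.prod_eq_one fun n _ => ?_
    have := norm_weight_eq_one (θ := θ) (x := 1) (y := μ) (by simpa using hμ.symm) n
    rw [Complex.ofReal_one] at this
    rw [norm_inv, this, inv_one]
  -- `I` collects the exponentials that grow at the given end. Those with `C n = 0` vanish
  -- identically and must be counted with the decaying ones. The limits depend only on `I`, hence
  -- not on the other times.
  refine ⟨_, _, hnorm (Finset.univ.filter fun n => C n ≠ 0 ∧ 0 < d.nu n 0),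
    hnorm (Finset.univ.filter fun n => C n ≠ 0 ∧ d.nu n 0 < 0), fun p hp _ => ⟨?_, ?_⟩⟩
  · refine tendsto_solitonU_ratio hμ hU₀ hθ hθ' (fun n hn => ?_) (fun n hn => ?_) hp
    · obtain ⟨h1, h2⟩ := (Finset.mem_filter.1 hn).2
      exact ⟨h1, tendsto_neg_atTop_atBot.comp (tendsto_id.const_mul_atTop h2)⟩
    · by_cases hC : C n = 0
      · exact Or.inl hC
      · refine Or.inr (tendsto_id.const_mul_atTop_of_neg (lt_of_le_of_ne ?_ (hν n)))
        by_contra hlt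
        exact hn (Finset.mem_filter.2 ⟨Finset.mem_univ n, hC, not_le.1 hlt⟩)
  · refine tendsto_solitonU_ratio hμ hU₀ hθ hθ' (fun n hn => ?_) (fun n hn => ?_) hp
    · obtain ⟨h1, h2⟩ := (Finset.mem_filter.1 hn).2
      exact ⟨h1, tendsto_neg_atTop_atBot.comp (tendsto_id.const_mul_atBot_of_neg h2)⟩
    · by_cases hC : C n = 0
      · exact Or.inl hC
      · refine Or.inr (tendsto_id.const_mul_atBot (lt_of_le_of_ne ?_ (hν n).symm))
        by_contra hlt
        exact hn (Finset.mem_filter.2 ⟨Finset.mem_univ n, hC, not_le.1 hlt⟩)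

end Boundary

/-! ### Existence of the dispersion data. -/

section Existence

variable {N : ℕ} {μ c : ℝ} {θ : Fin N → ℝ}

theorem exists_real_alpha (hμ₀ : μ ≠ 0) (hc : c ≠ 0) :
    ∃ a : ℂ → ℂ, AnalyticAt ℂ a 0 ∧ a 0 = 0 ∧
      (∀ᶠ ξ : ℝ in 𝓝 0, ((a ξ).re : ℂ) = a ξ) ∧
      ∀ᶠ ξ : ℝ in 𝓝 0, ξ * ((a ξ).re - μ) * ((a ξ).re * μ - 1) = c * μ ^ 2 * (a ξ).re := by
  have hμc : (μ : ℂ) ≠ 0 := by exact_mod_cast hμ₀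
  have hcc : (c : ℂ) ≠ 0 := by exact_mod_cast hc
  obtain ⟨a, ha, ha0, haeq⟩ := exists_analytic_alpha hμc hcc
  have haeq' := tendsto_ofReal_nhds_zero.eventually haeq
  have hcont : ContinuousAt (fun ξ : ℝ => a ξ) 0 :=
    ContinuousAt.comp (g := a) (f := fun x : ℝ => (x : ℂ)) (by simpa using ha.continuousAt)
      Complex.continuous_ofReal.continuousAt
  -- The equation has real coefficients, so the conjugate is again a solution and uniqueness makes
  -- the branch real on the real axis.
  have hreal : ∀ᶠ ξ : ℝ in 𝓝 0, ((a ξ).re : ℂ) = a ξ := by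
    have h := alpha_unique hμc hcc (f := fun ξ : ℝ => starRingEnd ℂ (a ξ)) (g := fun ξ : ℝ => a ξ)
      (Complex.continuous_conj.continuousAt.comp hcont) hcont (by
        filter_upwards [haeq'] with ξ h
        have := congrArg (starRingEnd ℂ) h
        simpa using this) haeq'
    filter_upwards [h] with ξ h
    exact Complex.conj_eq_iff_re.1 h
  refine ⟨a, ha, ha0, hreal, ?_⟩
  filter_upwards [haeq', hreal] with ξ h1 h2
  rw [← h2] at h1
  exact_mod_cast h1

theorem exists_real_beta (hμ₀ : μ ≠ 0) (hμ₁ : μ ^ 2 ≠ 1) (c : ℝ) :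
    ∃ b : ℂ → ℂ, AnalyticAt ℂ b 0 ∧ b 0 = μ ∧
      (∀ᶠ η : ℝ in 𝓝 0, ((b η).re : ℂ) = b η) ∧
      ∀ᶠ η : ℝ in 𝓝 0, ((b η).re - μ) * ((b η).re * μ - 1) = c * μ ^ 2 * (b η).re * η := by
  have hμc : (μ : ℂ) ≠ 0 := by exact_mod_cast hμ₀
  have hμc1 : (μ : ℂ) ^ 2 ≠ 1 := by exact_mod_cast hμ₁
  obtain ⟨b, hb, hb0, hbeq⟩ := exists_analytic_beta (c := (c : ℂ)) hμc hμc1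
  have hbeq' := tendsto_ofReal_nhds_zero.eventually hbeq
  have hcont : ContinuousAt (fun η : ℝ => b η) 0 :=
    ContinuousAt.comp (g := b) (f := fun x : ℝ => (x : ℂ)) (by simpa using hb.continuousAt)
      Complex.continuous_ofReal.continuousAt
  have hreal : ∀ᶠ η : ℝ in 𝓝 0, ((b η).re : ℂ) = b η := by
    have h := beta_unique (c := (c : ℂ)) hμc1 (f := fun η : ℝ => starRingEnd ℂ (b η))
      (g := fun η : ℝ => b η)
      (Complex.continuous_conj.continuousAt.comp hcont) hcont (by simp [hb0]) (by simp [hb0]) (by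
        filter_upwards [hbeq'] with η h
        have := congrArg (starRingEnd ℂ) h
        simpa using this) hbeq'
    filter_upwards [h] with η h
    exact Complex.conj_eq_iff_re.1 h
  refine ⟨b, hb, hb0, hreal, ?_⟩
  filter_upwards [hbeq', hreal] with η h1 h2
  rw [← h2] at h1
  exact_mod_cast h1

/-- The imaginary part is `μ sin t`. This keeps the argument in the series for `ν̃` away from the
branch cut at `β(0) = μ`, whatever the size of `μ`. -/
theorem one_sub_mul_exp_mem_slitPlane (hμ₀ : μ ≠ 0) {t : ℝ} (ht : Real.sin t ≠ 0) :
    (1 : ℂ) - μ * Complex.exp (-Complex.I * t) ∈ Complex.slitPlane := by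
  rw [Complex.mem_slitPlane_iff]
  right
  have h : Complex.exp (-Complex.I * t) = Complex.exp (((-t : ℝ) : ℂ) * Complex.I) := by
    congr 1
    push_cast
    ring
  rw [h, Complex.sub_im, Complex.one_im, Complex.im_ofReal_mul, Complex.exp_ofReal_mul_I_im,
    Real.sin_neg]
  simpa using ⟨hμ₀, ht⟩

theorem exists_isDispersion (hμ₀ : μ ≠ 0) (hμ₁ : μ ^ 2 ≠ 1) (hc : c ≠ 0)
    (hθ : ∀ n, Real.sin (θ n) ≠ 0) : ∃ d : Dispersion N, IsDispersion μ c θ d := by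
  obtain ⟨a, ha, ha0, har, haeq⟩ := exists_real_alpha hμ₀ hc
  obtain ⟨b, hb, hb0, hbr, hbeq⟩ := exists_real_beta hμ₀ hμ₁ c
  have hone : (1 : ℝ) - (μ ^ 2)⁻¹ ≠ 0 := by
    rw [sub_ne_zero]
    intro h
    exact hμ₁ (inv_eq_one.1 h.symm)
  have honec : (1 : ℂ) - ((μ : ℂ) ^ 2)⁻¹ ≠ 0 := by exact_mod_cast hone
  have hb0' : b 0 ≠ 0 := by rw [hb0]; exact_mod_cast hμ₀
  have hnu : ∀ n, ∃ e : ℕ → ℝ, ∀ᶠ ξ : ℝ in 𝓝 0,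
      HasSum (fun k : ℕ => e k * ξ ^ (k + 1) / ((k : ℝ) + 1))
        (2 * Complex.arg (1 - (a ξ).re * Complex.exp (-Complex.I * θ n))) := by
    intro n
    -- The real part of `-2 i log w` is `2 arg w`.
    have hF : AnalyticAt ℂ (fun ξ => -2 * Complex.I *
        Complex.log (1 - a ξ * Complex.exp (-Complex.I * θ n))) 0 :=
      analyticAt_const.mul ((analyticAt_const.sub (ha.mul analyticAt_const)).clog (by simp [ha0]))
    obtain ⟨e, he⟩ := exists_real_coefficients hF (by simp [ha0])
    refine ⟨e, ?_⟩
    filter_upwards [he, har] with ξ h1 h2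
    rw [h2]
    convert h1 using 1
    simp [Complex.log_im]
  have hnuBar : ∀ n, ∃ e : ℕ → ℝ, ∀ᶠ η : ℝ in 𝓝 0,
      HasSum (fun k : ℕ => e k * η ^ (k + 1) / ((k : ℝ) + 1))
        (2 * Complex.arg (1 - (b η).re * Complex.exp (-Complex.I * θ n))
          - 2 * Complex.arg (1 - μ * Complex.exp (-Complex.I * θ n))) := by
    intro n
    have hF : AnalyticAt ℂ (fun η => -2 * Complex.I *
        (Complex.log (1 - b η * Complex.exp (-Complex.I * θ n)) -
          Complex.log (1 - μ * Complex.exp (-Complex.I * θ n)))) 0 :=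
      analyticAt_const.mul (((analyticAt_const.sub (hb.mul analyticAt_const)).clog (by
        change (1 : ℂ) - b 0 * Complex.exp (-Complex.I * θ n) ∈ Complex.slitPlane
        rw [hb0]
        exact one_sub_mul_exp_mem_slitPlane hμ₀ (hθ n))).sub analyticAt_const)
    obtain ⟨e, he⟩ := exists_real_coefficients hF (by simp [hb0])
    refine ⟨e, ?_⟩
    filter_upwards [he, hbr] with ξ h1 h2
    rw [h2]
    convert h1 using 1
    simp [Complex.log_im]
    ring
  have hphi : ∃ e : ℕ → ℝ, ∀ᶠ ξ : ℝ in 𝓝 0,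
      HasSum (fun k : ℕ => e k * ξ ^ (k + 1) / ((k : ℝ) + 1))
        (-Real.log (1 - μ⁻¹ * (a ξ).re)) := by
    have hF : AnalyticAt ℂ (fun ξ => -Complex.log (1 - (μ : ℂ)⁻¹ * a ξ)) 0 :=
      ((analyticAt_const.sub (analyticAt_const.mul ha)).clog (by simp [ha0])).neg
    obtain ⟨e, he⟩ := exists_real_coefficients hF (by simp [ha0])
    refine ⟨e, ?_⟩
    filter_upwards [he, har] with ξ h1 h2
    convert h1 using 1
    have h3 : (1 : ℂ) - (μ : ℂ)⁻¹ * a ξ = ((1 - μ⁻¹ * (a ξ).re : ℝ) : ℂ) := by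
      nth_rewrite 1 [← h2]
      push_cast
      rfl
    rw [h3, Complex.neg_re, Complex.log_re, Complex.norm_real, Real.norm_eq_abs, Real.log_abs]
  have hphiBar : ∃ e : ℕ → ℝ, ∀ᶠ η : ℝ in 𝓝 0,
      HasSum (fun k : ℕ => e k * η ^ (k + 1) / ((k : ℝ) + 1))
        (Real.log (1 - μ⁻¹ * ((b η).re)⁻¹) - Real.log (1 - (μ ^ 2)⁻¹)) := by
    have hratio : (1 - (μ : ℂ)⁻¹ * (b 0)⁻¹) / (1 - ((μ : ℂ) ^ 2)⁻¹) = 1 := by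
      rw [hb0, ← mul_inv, ← sq, div_self honec]
    have hG : AnalyticAt ℂ (fun η => (1 - (μ : ℂ)⁻¹ * (b η)⁻¹) / (1 - ((μ : ℂ) ^ 2)⁻¹)) 0 :=
      (analyticAt_const.sub (analyticAt_const.mul (hb.inv hb0'))).div analyticAt_const honec
    -- The logarithm of the quotient is used because `1 - μ⁻²` is negative for `|μ| < 1` and so lies
    -- on the branch cut, whereas the quotient is near `1`.
    have hF : AnalyticAt ℂ (fun η =>
        Complex.log ((1 - (μ : ℂ)⁻¹ * (b η)⁻¹) / (1 - ((μ : ℂ) ^ 2)⁻¹))) 0 :=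
      hG.clog (by rw [hratio]; exact Complex.one_mem_slitPlane)
    obtain ⟨e, he⟩ := exists_real_coefficients hF (by rw [hratio, Complex.log_one])
    refine ⟨e, ?_⟩
    have hne : ∀ᶠ η : ℝ in 𝓝 0,
        (1 - (μ : ℂ)⁻¹ * (b η)⁻¹) / (1 - ((μ : ℂ) ^ 2)⁻¹) ≠ 0 :=
      tendsto_ofReal_nhds_zero.eventually
        (hG.continuousAt.eventually_ne (by rw [hratio]; exact one_ne_zero))
    filter_upwards [he, hbr, hne] with η h1 h2 h3
    convert h1 using 1
    have h4 : (1 - (μ : ℂ)⁻¹ * (b η)⁻¹) / (1 - ((μ : ℂ) ^ 2)⁻¹) =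
        (((1 - μ⁻¹ * ((b η).re)⁻¹) / (1 - (μ ^ 2)⁻¹) : ℝ) : ℂ) := by
      nth_rewrite 1 [← h2]
      push_cast
      rfl
    rw [h4] at h3
    have h5 : (1 - μ⁻¹ * ((b η).re)⁻¹) / (1 - (μ ^ 2)⁻¹) ≠ 0 := by exact_mod_cast h3
    rw [h4, Complex.log_re, Complex.norm_real, Real.norm_eq_abs, Real.log_abs,
      Real.log_div (div_ne_zero_iff.1 h5).1 hone]
  choose nu hnu using hnu
  choose nuBar hnuBar using hnuBar
  obtain ⟨phi, hphi⟩ := hphi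
  obtain ⟨phiBar, hphiBar⟩ := hphiBar
  have hac : ContinuousAt (fun ξ : ℝ => (a ξ).re) 0 :=
    Complex.continuous_re.continuousAt.comp
      (ContinuousAt.comp (g := a) (f := fun x : ℝ => (x : ℂ)) (by simpa using ha.continuousAt)
        Complex.continuous_ofReal.continuousAt)
  have hbc : ContinuousAt (fun η : ℝ => (b η).re) 0 :=
    Complex.continuous_re.continuousAt.comp
      (ContinuousAt.comp (g := b) (f := fun x : ℝ => (x : ℂ)) (by simpa using hb.continuousAt)
        Complex.continuous_ofReal.continuousAt)
  refine ⟨⟨fun ξ => (a ξ).re, fun η => (b η).re, nu, nuBar, phi, phiBar⟩, ?_⟩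
  refine ⟨hac, by simp [ha0], ?_, hbc, by simp [hb0], ?_, hnu, hnuBar, hphi, hphiBar⟩
  · refine eventually_nhdsWithin_iff.2 ?_
    filter_upwards [haeq] with ξ h1 h2
    have hξ : ξ ≠ 0 := h2
    have h3 : (a ξ).re ≠ 0 := by
      intro h0
      rw [h0] at h1
      have : ξ * μ = 0 := by linear_combination h1
      exact mul_ne_zero hξ hμ₀ this
    refine ⟨h3, ?_⟩
    field_simp
    linear_combination h1
  · have hne : ∀ᶠ η : ℝ in 𝓝 0, (b η).re ≠ 0 := hbc.eventually_ne (by simpa [hb0] using hμ₀)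
    filter_upwards [hbeq, hne] with η h1 h2
    refine ⟨h2, ?_⟩
    field_simp
    linear_combination h1

end Existence

end DNLS

theorem proposition6 {N : ℕ} (μ : ℝ) (hμ₀ : μ ≠ 0) (hμ₁ : μ ^ 2 ≠ 1) (U₀ : ℂ) (hU₀ : U₀ ≠ 0)
    (θ : Fin N → ℝ) (hθ : ∀ m n, Real.sin ((θ m + θ n) / 2) ≠ 0) :
    (∃ d : DNLS.Dispersion N, DNLS.IsDispersion μ ((‖U₀‖ ^ 2)⁻¹) θ d) ∧
    ∀ d : DNLS.Dispersion N, DNLS.IsDispersion μ ((‖U₀‖ ^ 2)⁻¹) θ d →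
      ∀ C : Fin N → ℝ,
        DNLS.IsShiftStable (DNLS.regularDomain μ θ C d) ∧
        (∃ V u v : DNLS.Times → ℂ,
          V = DNLS.reflect (DNLS.solitonU μ U₀ θ C d) ∧
          (∀ p : DNLS.Times, p.IsReal →
            V p = starRingEnd ℂ (DNLS.solitonU μ U₀ θ C d p) ∧ v p = starRingEnd ℂ (u p)) ∧
          ∃ r : ℝ, 0 < r ∧
            DNLS.IsExtendedDNLSH (DNLS.regularDomain μ θ C d) r
              (DNLS.solitonU μ U₀ θ C d) V u v) ∧
        ((∀ m n, m ≠ n → Real.sin ((θ m - θ n) / 2) ≠ 0) →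
          DNLS.HasNonvanishingBoundary U₀ d (DNLS.solitonU μ U₀ θ C d)) := by
  have hc : (‖U₀‖ ^ 2)⁻¹ ≠ 0 := inv_ne_zero (pow_ne_zero 2 (norm_ne_zero_iff.2 hU₀))
  have hμ := DNLS.abs_ne_one_of_sq_ne_one hμ₁
  -- The only place where the value of `c` matters: it ties the amplitude to the dispersion
  -- relation.
  have hU : U₀ * starRingEnd ℂ U₀ * (((‖U₀‖ ^ 2)⁻¹ : ℝ) : ℂ) = 1 := by
    rw [Complex.mul_conj, Complex.normSq_eq_norm_sq, ← Complex.ofReal_mul,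
      mul_inv_cancel₀ (pow_ne_zero 2 (norm_ne_zero_iff.2 hU₀)), Complex.ofReal_one]
  refine ⟨DNLS.exists_isDispersion hμ₀ hμ₁ hc fun n => ?_, fun d hd C => ⟨?_, ?_, fun hθ' => ?_⟩⟩
  · have h := hθ n n
    rwa [add_self_div_two] at h
  · exact DNLS.isShiftStable_regularDomain hd hμ₀ hμ₁ hc
  · refine ⟨_, DNLS.companionU μ ((‖U₀‖ ^ 2)⁻¹) U₀ θ C d,
      DNLS.companionV μ ((‖U₀‖ ^ 2)⁻¹) U₀ θ C d, rfl, fun p hp => ⟨?_, ?_⟩, ?_⟩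
    · rw [DNLS.reflect, show p.conj = p from hp]
    · rw [← DNLS.reflect_companionU hμ, DNLS.reflect, show p.conj = p from hp]
    · obtain ⟨a, -, -, ha⟩ := hd.exists_isPosShift hμ₀ hc
      obtain ⟨b, -, -, hb⟩ := hd.exists_isNegShift hμ₀ hμ₁
      obtain ⟨r, hr, hball⟩ := Metric.eventually_nhds_iff.1 (ha.and hb)
      refine ⟨r, hr, DNLS.isExtendedDNLSH_soliton hμ₀ hμ hc hU hθ (a := a) (b := b)
        (fun ξ hξ => (hball ?_).1) fun η hη => (hball ?_).2⟩
      · rwa [dist_zero_right]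
      · rwa [dist_zero_right]
  · exact DNLS.hasNonvanishingBoundary_soliton hd hμ₀ hμ hc hU₀ hθ hθ'
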